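/- Let $q\in\mathbb C^\times$ not be a root of unity, $\beta=-q-q^{-1}$, and $n\ge 0$. Let $\operatorname{TL}_m$ be the complex algebra with basis the $m$-diagrams (non-crossing perfect matchings of $m$ top and $m$ bottom vertices), where $DD'$ is the diagram obtained by placing $D$ on top of $D'$, times $\beta$ for each closed loop removed. Let $e_i\in\operatorname{TL}_m$ be the diagram with a link joining the vertices $i,i+1$ on each line and vertical links elsewhere. Let $v_+,v_-$ be the standard basis of $\mathbb C^2$, let $\epsilon\colon\mathbb C^2\otimes\mathbb C^2\to\mathbb C$ be given by $v_+\otimes v_-\mapsto -q$, $v_-\otimes v_+\mapsto 1$, $v_\pm\otimes v_\pm\mapsto 0$, and $\delta\colon\mathbb C\to\mathbb C^2\otimes\mathbb C^2$ by $1\mapsto v_+\otimes v_--q^{-1}v_-\otimes v_+$. Diagrams act on $(\mathbb C^2)^{\otimes m}$ from bottom to top: each bottom link acts by $\epsilon$, each top link by $\delta$, each link between the lines by the identity. Let $\mathbf U=\mathcal U_q(\mathfrak{sl}_2)$ be the complex algebra generated by $E,F,K^{\pm1}$ with $KE=q^2EK$, $KF=q^{-2}FK$, $EF-FE=(K-K^{-1})/(q-q^{-1})$,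 comultiplication $\Delta K^{\pm1}=K^{\pm1}\otimes K^{\pm1}$, $\Delta E=E\otimes 1+K^{-1}\otimes E$, $\Delta F=F\otimes K+1\otimes F$, counit $E,F\mapsto 0$, $K^{\pm1}\mapsto 1$, and antipode $S(K)=K^{-1}$, $S(E)=-KE$, $S(F)=-FK^{-1}$. It acts on $\mathbb C^2$ by $Kv_\pm=q^{\pm1}v_\pm$, $Ev_-=v_+$, $Fv_+=v_-$, $Ev_+=Fv_-=0$, on tensor powers through $\Delta$, and on $\operatorname{End}((\mathbb C^2)^{\otimes n})$ by $u\cdot T=\sum u_{(1)}\,T\,S(u_{(2)})$. Write $v^\pm$ for the dual basis of $(\mathbb C^2)^*$ and let $\Phi\colon\operatorname{End}((\mathbb C^2)^{\otimes n})\to(\mathbb C^2)^{\otimes 2n}$ be the linear isomorphism which sends the endomorphism $v_1\otimes\dots\otimes v_n\mapsto \alpha_1(v_n)\cdots\alpha_n(v_1)\,w$ (with $w\in(\mathbb C^2)^{\otimes n}$, $\alpha_j\in(\mathbb C^2)^*$) to $w\otimes\phi_3(\alpha_1)\otimes\dots\otimes\phi_3(\alpha_n)$, where $\phi_3(v^+)=v_-$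 and $\phi_3(v^-)=-q^{-1}v_+$. Let $\mathbb C_{\mathrm{triv}}$ be the one-dimensional $\operatorname{TL}_n\otimes\operatorname{TL}_n$-module on which every $e_i\otimes 1$ and $1\otimes e_i$ acts by $0$, and let $I=\operatorname{Ind}_{\operatorname{TL}_n\otimes\operatorname{TL}_n}^{\operatorname{TL}_{2n}}\mathbb C_{\mathrm{triv}}=\operatorname{TL}_{2n}\otimes_{\operatorname{TL}_n\otimes\operatorname{TL}_n}\mathbb C_{\mathrm{triv}}$, where $\operatorname{TL}_n\otimes\operatorname{TL}_n\to\operatorname{TL}_{2n}$ places diagrams side by side. Let $R_n$ be the $2n$-diagram with $n$ nested links on the top line and $n$ nested links on the bottom line. For an $n$-diagram $D$ let $D'$ be the diagram obtained by placing $D$ to the left of $n$ vertical lines, on top of $R_n$. Theorem. 1. For every $m$, the action of diagrams makes $(\mathbb C^2)^{\otimes m}$ a representation $\zeta_m$ of the algebra $\operatorname{TL}_m$, in which $e_i$ acts as $\delta\circ\epsilon$ on the tensor factors $i,i+1$ (the spin representation), and $\zeta_n$ is an isomorphism of $\operatorname{TL}_n$ onto $\operatorname{End}_{\mathbf U}((\mathbb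 C^2)^{\otimes n})$. 2. $\Phi$ is $\mathbf U$-linear, and restricts to an isomorphism $\operatorname{End}_{\mathbf U}((\mathbb C^2)^{\otimes n})\cong((\mathbb C^2)^{\otimes 2n})^{\mathbf U}$. 3. No closed loop arises in forming $D'$ (that is, $(D\text{ beside }n\text{ vertical lines})\cdot R_n=D'$ in $\operatorname{TL}_{2n}$), and the linear map $\iota\colon\operatorname{TL}_n\to I$ with $\iota(D)=D'\otimes 1$ for every diagram $D$ is injective. The class $R_n\otimes 1\in I$ is nonzero, and $R_n$ is the only $2n$-diagram with $n$ nested links on the top line whose class in $I$ is nonzero. 4. There is an injective linear map $b\colon I\to(\mathbb C^2)^{\otimes 2n}$ with $b(x\otimes c)=c\,\zeta_{2n}(x)(v_-^{\otimes n}\otimes v_+^{\otimes n})$, and $b(\iota(x))=\Phi(\zeta_n(x))$ for all $x\in\operatorname{TL}_n$. That is, under the identifications $\operatorname{TL}_n\cong\operatorname{End}_{\mathbf U}((\mathbb C^2)^{\otimes n})$ and $I\subset(\mathbb C^2)^{\otimes 2n}$, the isomorphism of part 2 is the diagrammatic embedding $\iota$. -/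

import Mathlib

open scoped TensorProduct

noncomputable section

namespace TLDiag

/-- The vertices of an `n`-diagram: `inl i` is the `i`-th vertex of the top line and `inr i` the
`i`-th vertex of the bottom line, counted from the left. -/
abbrev Vert (n : ℕ) : Type := Fin n ⊕ Fin n

/-- The position of a vertex on the boundary circle: along the top line from left to right, then
along the bottom line from right to left. -/
def pos {n : ℕ} : Vert n → ℕ
  | Sum.inl i => i
  | Sum.inr i => n + i.rev

/-- An `n`-diagram up to homotopy: a partition of the `2n` vertices into pairs (the links) such
that no two links cross. -/
@[ext]
structure Diagram (n : ℕ) where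
  rel : Setoid (Vert n)
  pair : ∀ u, ∃! v, v ≠ u ∧ rel u v
  planar : ∀ u u' v v', rel u u' → rel v v' →
    ¬ (pos u < pos v ∧ pos v < pos u' ∧ pos u' < pos v')

/-! ### Concatenation of diagrams -/

/-- The vertices of two diagrams placed on top of each other: top, middle and bottom line. -/
abbrev Stack (n : ℕ) : Type := Fin n ⊕ (Fin n ⊕ Fin n)

def upper {n : ℕ} : Vert n → Stack n
  | Sum.inl i => Sum.inl i
  | Sum.inr i => Sum.inr (Sum.inl i)

def lower {n : ℕ} : Vert n → Stack n
  | Sum.inl i => Sum.inr (Sum.inl i)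
  | Sum.inr i => Sum.inr (Sum.inr i)

def outer {n : ℕ} : Vert n → Stack n
  | Sum.inl i => Sum.inl i
  | Sum.inr i => Sum.inr (Sum.inr i)

/-- Two vertices of the stack are related when a path of links of the upper diagram `r` and of
the lower diagram `s` joins them. -/
def stack {n : ℕ} (r s : Setoid (Vert n)) : Setoid (Stack n) :=
  Relation.EqvGen.setoid fun x y =>
    (∃ u v, r u v ∧ upper u = x ∧ upper v = y) ∨ (∃ u v, s u v ∧ lower u = x ∧ lower v = y)

/-- The links of the concatenation: the outer vertices joined by a path. -/
def compRel {n : ℕ} (r s : Setoid (Vert n)) : Setoid (Vert n) :=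
  (stack r s).comap outer

/-- The connected components of the stack that do not meet the outer lines: the closed loops. -/
def ClosedLoop {n : ℕ} (r s : Setoid (Vert n)) : Type :=
  {c : Quotient (stack r s) // ∀ u, Quotient.mk (stack r s) (outer u) ≠ c}

def loops {n : ℕ} (r s : Setoid (Vert n)) : ℕ := Nat.card (ClosedLoop r s)

/-! ### The concatenation of two diagrams is a diagram -/

section Reconnect

variable {X : Type*} (p : X → ℕ)

/-- `f` is the partner map of a non-crossing perfect matching of points on a line. -/
def NC (f : X → X) : Prop :=
  (∀ x, f (f x) = x) ∧ (∀ x, f x ≠ x) ∧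
    ∀ u v, ¬ (p u < p v ∧ p v < p (f u) ∧ p (f u) < p (f v))

open Classical in
/-- Link `x` with `y`, and the former partners of `x` and `y` with each other. -/
def reconnect (f : X → X) (x y : X) (z : X) : X :=
  if f x = y then f z else if z = x then y else if z = y then x
    else if z = f x then f y else if z = f y then f x else f z

set_option maxHeartbeats 4000000 in
theorem nc_reconnect (hp : Function.Injective p) {f : X → X} (hf : NC p f) {x y : X}
    (hxy : p x < p y)
    (hin : ∀ z, p x < p z → p z < p y → p x < p (f z) ∧ p (f z) < p y) :
    NC p (reconnect f x y) := by
  obtain ⟨h1, h2, h3⟩ := hf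
  have hne : x ≠ y := fun h => by simp [h] at hxy
  refine ⟨fun z => ?_, fun z => ?_, fun u v => ?_⟩
  · unfold reconnect; grind
  · unfold reconnect; grind
  · by_cases hc : f x = y
    · simpa [reconnect, hc] using h3 u v
    have e1 : ∀ a b, p a = p b → a = b := fun a b h => hp h
    have ax := h1 x
    have ay := h1 y
    have hax := h2 x
    have hay := h2 y
    have hout : ∀ z, ¬ (p x < p z ∧ p z < p y) → ¬ (p x < p (f z) ∧ p (f z) < p y) := by
      intro z hz h
      have := hin (f z) h.1 h.2
      rw [h1] at this
      exact hz this
    have n1 : ∀ a b, a ≠ b → p a ≠ p b := fun a b h h' => h (hp h')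
    have hab : f x ≠ f y := fun h => hne (by rw [← h1 x, h, h1])
    have hfyx : f y ≠ x := fun h => hc (by rw [← h, h1])
    have xa := n1 _ _ (h2 x)
    have yb := n1 _ _ (h2 y)
    have ya := n1 _ _ hc
    have xb := n1 _ _ hfyx
    have ab := n1 _ _ hab
    have oa := hout x (by omega)
    have ob := hout y (by omega)
    have c1 := h3 (f x) (f y)
    have c2 := h3 (f y) (f x)
    have c3 := h3 x (f y)
    have c4 := h3 (f y) x
    have c5 := h3 (f x) y
    have c6 := h3 y (f x)
    have c7 := h3 x y
    rw [ax] at c1 c5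
    rw [ay] at c2 c4
    have g : ∀ w, w ≠ x → w ≠ y → w ≠ f x → w ≠ f y →
        ((p x < p w ∧ p w < p y) ↔ (p x < p (f w) ∧ p (f w) < p y)) ∧
        (¬ (p (f x) < p w ∧ p w < p (f y) ∧ p (f y) < p (f w))) ∧
        (¬ (p (f y) < p w ∧ p w < p (f x) ∧ p (f x) < p (f w))) ∧
        (¬ (p w < p (f x) ∧ p (f x) < p (f w) ∧ p (f w) < p (f y))) ∧
        (¬ (p w < p (f y) ∧ p (f y) < p (f w) ∧ p (f w) < p (f x))) := by
      intro w wx wy wa wb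
      have i1 := hin w
      have i2 := hout w
      have fx : f w ≠ x := fun h => wa (by rw [← h, h1])
      have fy : f w ≠ y := fun h => wb (by rw [← h, h1])
      have d1 := n1 _ _ fx
      have d2 := n1 _ _ fy
      have d3 := n1 _ _ wx
      have d4 := n1 _ _ wy
      have d5 := n1 _ _ wa
      have d6 := n1 _ _ wb
      have e1 := h3 w x
      have e2 := h3 w y
      have e3 := h3 w (f x)
      have e4 := h3 w (f y)
      have e5 := h3 x w
      have e6 := h3 y w
      have e7 := h3 (f x) w
      have e8 := h3 (f y) w
      rw [ax] at e3 e7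
      rw [ay] at e4 e8
      have k : (p x < p w ∧ p w < p y) ↔ (p x < p (f w) ∧ p (f w) < p y) :=
        ⟨fun h => i1 h.1 h.2, fun h => by by_contra h'; exact i2 h' h⟩
      clear hin hout i1 i2 h3
      refine ⟨k, ?_, ?_, ?_, ?_⟩
      all_goals
        rintro ⟨q1, q2, q3⟩
        rcases lt_or_gt_of_ne xa with xa | xa <;> rcases lt_or_gt_of_ne xb with xb | xb <;>
        omega
    have huv := h3 u v
    have gu := g u
    have gv := g v
    clear g hin hout h3
    have Fx : reconnect f x y x = y := by unfold reconnect; grind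
    have Fy : reconnect f x y y = x := by unfold reconnect; grind
    have Fa : reconnect f x y (f x) = f y := by unfold reconnect; grind
    have Fb : reconnect f x y (f y) = f x := by unfold reconnect; grind
    have F : ∀ w, w ≠ x → w ≠ y → w ≠ f x → w ≠ f y → reconnect f x y w = f w := by
      unfold reconnect; grind
    by_cases u1 : u = x <;> [skip; by_cases u2 : u = y <;> [skip; by_cases u3 : u = f x <;>
      [skip; by_cases u4 : u = f y]]] <;>
    (by_cases v1 : v = x <;> [skip; by_cases v2 : v = y <;> [skip; by_cases v3 : v = f x <;>
      [skip; by_cases v4 : v = f y]]])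
    all_goals
      first
      | rw [F u u1 u2 u3 u4]; replace gu := gu u1 u2 u3 u4
      | clear gu; subst u
      | skip
    all_goals
      first
      | rw [F v v1 v2 v3 v4]; replace gv := gv v1 v2 v3 v4
      | clear gv; subst v
      | skip
    all_goals
      try simp only [Fx, Fy, Fa, Fb]
      clear Fx Fy Fa Fb F
      rintro ⟨q1, q2, q3⟩
      omega

end Reconnect

section Glue
variable {X : Type*} (p : X → ℕ)

/-- Joined by the arcs of `f` together with the identifications in `G`. -/
def Joined (f : X → X) (G : X → X → Prop) : X → X → Prop :=
  Relation.EqvGen fun u v => v = f u ∨ G u v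

theorem joined_reconnect {f : X → X} (h1 : ∀ x, f (f x) = x) (h2 : ∀ x, f x ≠ x) {x y : X} (hne : x ≠ y)
    (G : X → X → Prop) (hG : ∀ u v, G u v → u ≠ x ∧ u ≠ y ∧ v ≠ x ∧ v ≠ y)
    {u v : X} (hux : u ≠ x) (huy : u ≠ y) (hvx : v ≠ x) (hvy : v ≠ y) :
    Joined f (fun a b => G a b ∨ (a = x ∧ b = y)) u v ↔ Joined (reconnect f x y) G u v := by
  classical
  have inj : ∀ a b, f a = f b → a = b := fun a b h => by rw [← h1 a, h, h1]
  constructor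
  · intro h
    by_cases hc : f x = y
    · have hr : reconnect f x y = f := by funext z; simp [reconnect, hc]
      rw [hr]
      refine h.mono ?_
      rintro a b (h | h | ⟨rfl, rfl⟩)
      · exact Or.inl h
      · exact Or.inr h
      · exact Or.inl hc.symm
    · have hfyx : f y ≠ x := fun h => hc (by rw [← h, h1])
      have hab : f x ≠ f y := fun h => hne (inj _ _ h)
      let π : X → X := fun z => if z = x then f x else if z = y then f y else z
      have key : ∀ a b, Joined f (fun a b => G a b ∨ (a = x ∧ b = y)) a b →
          Joined (reconnect f x y) G (π a) (π b) := by
        intro a b h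
        induction h with
        | rel a b h =>
          by_cases e : π a = π b
          · rw [e]; exact Relation.EqvGen.refl _
          · apply Relation.EqvGen.rel
            rcases h with h | h | ⟨ha, hb⟩
            · left
              simp only [π, reconnect] at e ⊢
              grind
            · right
              obtain ⟨a1, a2, a3, a4⟩ := hG _ _ h
              simpa [π, a1, a2, a3, a4] using h
            · left
              simp only [π, reconnect] at e ⊢
              grind
        | refl a => exact Relation.EqvGen.refl _
        | symm a b _ ih => exact ih.symm
        | trans a b c _ _ ih1 ih2 => exact ih1.trans _ _ _ ih2
      simpa [π, hux, huy, hvx, hvy] using key u v h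
  · intro h
    have R := Relation.EqvGen.is_equivalence
      (fun u v => v = f u ∨ (G u v ∨ (u = x ∧ v = y)))
    have arc : ∀ a, Joined f (fun a b => G a b ∨ (a = x ∧ b = y)) a (f a) :=
      fun a => Relation.EqvGen.rel _ _ (Or.inl rfl)
    have gl : Joined f (fun a b => G a b ∨ (a = x ∧ b = y)) x y :=
      Relation.EqvGen.rel _ _ (Or.inr (Or.inr ⟨rfl, rfl⟩))
    have key : ∀ a, Joined f (fun a b => G a b ∨ (a = x ∧ b = y)) a (reconnect f x y a) := by
      intro a
      by_cases c1 : f x = y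
      · simpa [reconnect, c1] using arc a
      by_cases c2 : a = x
      · subst c2; simpa [reconnect, c1] using gl
      by_cases c3 : a = y
      · have : reconnect f x y a = x := by simp only [reconnect]; grind
        rw [this, c3]
        exact R.symm gl
      by_cases c4 : a = f x
      · have : reconnect f x y a = f y := by simp only [reconnect]; grind
        rw [this, c4]
        exact R.trans (R.symm (arc x)) (R.trans gl (arc y))
      by_cases c5 : a = f y
      · have : reconnect f x y a = f x := by simp only [reconnect]; grind
        rw [this, c5]
        exact R.trans (R.symm (arc y)) (R.trans (R.symm gl) (arc x))
      simpa [reconnect, c1, c2, c3, c4, c5] using arc a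
    clear hux huy hvx hvy
    induction h with
    | rel a b h =>
      rcases h with h | h
      · rw [h]; exact key a
      · exact Relation.EqvGen.rel _ _ (Or.inr (Or.inl h))
    | refl a => exact Relation.EqvGen.refl _
    | symm a b _ ih => exact R.symm ih
    | trans a b c _ _ ih1 ih2 => exact R.trans ih1 ih2

/-- Gluing nested pairs of points of a non-crossing matching leaves a non-crossing matching of
the other points, in which two points are partners when a path joined them before. -/
theorem exists_glued (hp : Function.Injective p) {f : X → X} (hf : NC p f) {n : ℕ}
    (x y : ℕ → X) (hxy : ∀ i < n, p (x i) < p (y i))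
    (hb : ∀ i < n, ∀ z, p (x i) < p z → p z < p (y i) → ∃ j < i, z = x j ∨ z = y j)
    (hb' : ∀ i < n, ∀ j < i, p (x i) < p (x j) ∧ p (y j) < p (y i)) :
    ∃ g : X → X, NC p g ∧ (∀ i < n, g (x i) = y i) ∧
      ∀ u v, (∀ i < n, u ≠ x i ∧ u ≠ y i) → (∀ i < n, v ≠ x i ∧ v ≠ y i) →
        (Joined f (fun a b => ∃ i < n, a = x i ∧ b = y i) u v ↔ (v = u ∨ v = g u)) := by
  have main : ∀ k ≤ n, ∃ g : X → X, NC p g ∧ (∀ i < k, g (x i) = y i) ∧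
      ∀ u v, (∀ i < k, u ≠ x i ∧ u ≠ y i) → (∀ i < k, v ≠ x i ∧ v ≠ y i) →
        (Joined f (fun a b => ∃ i < n, a = x i ∧ b = y i) u v ↔
          Joined g (fun a b => ∃ i, k ≤ i ∧ i < n ∧ a = x i ∧ b = y i) u v) := by
    intro k hk
    induction k with
    | zero => exact ⟨f, hf, by simp, by simp⟩
    | succ k ih =>
      obtain ⟨g, hg, hgx, hgj⟩ := ih (by omega)
      have hgy : ∀ i < k, g (y i) = x i := fun i hi => by rw [← hgx i hi, hg.1]
      have hkn : k < n := hk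
      have hne : x k ≠ y k := fun h => by have := hxy k hkn; rw [h] at this; omega
      -- the points of distinct pairs are distinct
      have dist : ∀ i j, i < j → j < n → x i ≠ x j ∧ x i ≠ y j ∧ y i ≠ x j ∧ y i ≠ y j := by
        intro i j hij hj
        have h1 := hb' j hj i hij
        have h2 := hxy i (by omega)
        refine ⟨?_, ?_, ?_, ?_⟩ <;> intro h <;> rw [h] at h1 h2 <;> omega
      refine ⟨reconnect g (x k) (y k), nc_reconnect p hp hg (hxy k hkn) ?_, ?_, ?_⟩
      · intro z hz1 hz2
        obtain ⟨j, hj, rfl | rfl⟩ := hb k hkn z hz1 hz2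
        · rw [hgx j hj]
          have h1 := hb' k hkn j hj
          have h2 := hxy j (by omega)
          omega
        · rw [hgy j hj]
          have h1 := hb' k hkn j hj
          have h2 := hxy j (by omega)
          omega
      · intro i hi
        by_cases hik : i = k
        · subst hik
          unfold reconnect; grind
        · have hi' : i < k := by omega
          have d := dist i k hi' hkn
          have e1 := hgx i hi'
          have e2 := hgy i hi'
          have inj : ∀ a b, g a = g b → a = b := fun a b h => by rw [← hg.1 a, h, hg.1]
          have e3 : x i ≠ g (x k) := fun h => d.2.2.1 (by rw [← e1, h, hg.1])
          have e4 : x i ≠ g (y k) := fun h => d.2.2.2 (by rw [← e1, h, hg.1])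
          simp [reconnect, d.1, d.2.1, e3, e4, e1]
      · intro u v hu hv
        rw [hgj u v (fun i hi => hu i (by omega)) (fun i hi => hv i (by omega))]
        rw [← joined_reconnect hg.1 hg.2.1 hne _ ?_ (hu k (by omega)).1 (hu k (by omega)).2
          (hv k (by omega)).1 (hv k (by omega)).2]
        · have : (fun a b => ∃ i, k ≤ i ∧ i < n ∧ a = x i ∧ b = y i) =
              fun a b => (∃ i, k + 1 ≤ i ∧ i < n ∧ a = x i ∧ b = y i) ∨ a = x k ∧ b = y k := by
            funext a b
            apply propext
            constructor
            · rintro ⟨i, h1, h2, h3⟩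
              by_cases h : i = k
              · subst h; exact Or.inr h3
              · exact Or.inl ⟨i, by omega, h2, h3⟩
            · rintro (⟨i, h1, h2, h3⟩ | h)
              · exact ⟨i, by omega, h2, h3⟩
              · exact ⟨k, le_rfl, hkn, h⟩
          rw [this]
        · rintro a b ⟨i, h1, h2, rfl, rfl⟩
          have d := dist k i (by omega) h2
          exact ⟨d.1.symm, d.2.2.1.symm, d.2.1.symm, d.2.2.2.symm⟩
  obtain ⟨g, hg, hgx, hgj⟩ := main n le_rfl
  refine ⟨g, hg, hgx, fun u v hu hv => ?_⟩
  rw [hgj u v hu hv]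
  constructor
  · intro h
    clear hu hv
    induction h with
    | rel a b h =>
      rcases h with h | ⟨i, h1, h2, _⟩
      · exact Or.inr h
      · omega
    | refl a => exact Or.inl rfl
    | symm a b _ ih =>
      rcases ih with h | h
      · exact Or.inl h.symm
      · exact Or.inr (by rw [h, hg.1])
    | trans a b c _ _ ih1 ih2 =>
      rcases ih1 with rfl | rfl <;> rcases ih2 with rfl | rfl
      · exact Or.inl rfl
      · exact Or.inr rfl
      · exact Or.inr rfl
      · exact Or.inl (hg.1 _)
  · rintro (rfl | h)
    · exact Relation.EqvGen.refl _
    · exact Relation.EqvGen.rel _ _ (Or.inl h)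

end Glue

theorem pos_inj {n : ℕ} : Function.Injective (pos (n := n)) := by
  rintro (i | i) (j | j) h <;> simp only [pos, Fin.val_rev] at h
  · exact congrArg _ (Fin.ext h)
  · omega
  · omega
  · exact congrArg _ (Fin.ext (by omega))

theorem pos_lt {n : ℕ} (u : Vert n) : pos u < 2 * n := by
  rcases u with i | i <;> simp only [pos, Fin.val_rev] <;> omega

/-- The partner of a vertex. -/
def Diagram.link {n : ℕ} (D : Diagram n) (u : Vert n) : Vert n := (D.pair u).choose

theorem Diagram.rel_iff {n : ℕ} (D : Diagram n) (u v : Vert n) :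
    D.rel u v ↔ v = u ∨ v = D.link u := by
  have h := (D.pair u).choose_spec
  constructor
  · intro huv
    by_cases e : v = u
    · exact Or.inl e
    · exact Or.inr (h.2 v ⟨e, huv⟩)
  · rintro (rfl | rfl)
    · exact D.rel.refl' _
    · exact h.1.2

theorem Diagram.link_ne {n : ℕ} (D : Diagram n) (u : Vert n) : D.link u ≠ u :=
  (D.pair u).choose_spec.1.1

theorem Diagram.rel_link {n : ℕ} (D : Diagram n) (u : Vert n) : D.rel u (D.link u) :=
  (D.pair u).choose_spec.1.2

theorem Diagram.link_link {n : ℕ} (D : Diagram n) (u : Vert n) : D.link (D.link u) = u := by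
  rcases (D.rel_iff (D.link u) u).1 (D.rel.symm' (D.rel_link u)) with h | h
  · exact absurd h.symm (D.link_ne u)
  · exact h.symm

theorem Diagram.nc {n : ℕ} (D : Diagram n) : NC pos D.link :=
  ⟨D.link_link, D.link_ne, fun u v => D.planar _ _ _ _ (D.rel_link u) (D.rel_link v)⟩

/-- Two diagrams side by side along a line: first the upper one, then the lower one. -/
def dpos {n : ℕ} : Vert n ⊕ Vert n → ℕ
  | Sum.inl u => pos u
  | Sum.inr u => 2 * n + pos u

def dlink {n : ℕ} (D D' : Diagram n) : Vert n ⊕ Vert n → Vert n ⊕ Vert n :=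
  Sum.map D.link D'.link

theorem dpos_inj {n : ℕ} : Function.Injective (dpos (n := n)) := by
  rintro (u | u) (v | v) h <;> simp only [dpos] at h
  · exact congrArg _ (pos_inj h)
  · have := pos_lt u; omega
  · have := pos_lt v; omega
  · exact congrArg _ (pos_inj (by omega))

theorem dlink_nc {n : ℕ} (D D' : Diagram n) : NC dpos (dlink D D') := by
  refine ⟨?_, ?_, ?_⟩
  · rintro (u | u) <;> simp [dlink, Diagram.link_link]
  · rintro (u | u) <;> simp [dlink, Diagram.link_ne]
  · rintro (u | u) (v | v) <;> simp only [dlink, Sum.map_inl, Sum.map_inr, dpos]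
    · exact D.nc.2.2 u v
    · have := pos_lt u; have := pos_lt (D.link u); omega
    · have := pos_lt v; have := pos_lt (D.link v); omega
    · have := D'.nc.2.2 u v; omega

/-- An outer vertex of the stack, as a vertex of one of the two diagrams. -/
def dout {n : ℕ} : Vert n → Vert n ⊕ Vert n
  | Sum.inl i => Sum.inl (Sum.inl i)
  | Sum.inr i => Sum.inr (Sum.inr i)

theorem stack_iff_joined {n : ℕ} (D D' : Diagram n) (u v : Vert n) :
    stack D.rel D'.rel (outer u) (outer v) ↔
      Joined (dlink D D') (fun a b => ∃ i : Fin n,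
        a = Sum.inl (Sum.inr i) ∧ b = Sum.inr (Sum.inl i)) (dout u) (dout v) := by
  have R := Relation.EqvGen.is_equivalence (fun u v => v = dlink D D' u ∨ ∃ i : Fin n,
        u = Sum.inl (Sum.inr i) ∧ v = Sum.inr (Sum.inl i))
  constructor
  · intro h
    let σ : Stack n → Vert n ⊕ Vert n := fun x => match x with
      | Sum.inl i => Sum.inl (Sum.inl i)
      | Sum.inr (Sum.inl i) => Sum.inl (Sum.inr i)
      | Sum.inr (Sum.inr i) => Sum.inr (Sum.inr i)
    have hu : ∀ u, σ (upper u) = Sum.inl u := by rintro (i | i) <;> rfl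
    have hl : ∀ u, Joined (dlink D D') (fun a b => ∃ i : Fin n,
        a = Sum.inl (Sum.inr i) ∧ b = Sum.inr (Sum.inl i)) (σ (lower u)) (Sum.inr u) := by
      rintro (i | i)
      · exact Relation.EqvGen.rel _ _ (Or.inr ⟨i, rfl, rfl⟩)
      · exact R.refl _
    have ho : ∀ u, σ (outer u) = dout u := by rintro (i | i) <;> rfl
    have key : ∀ a b, stack D.rel D'.rel a b → Joined (dlink D D') (fun a b => ∃ i : Fin n,
        a = Sum.inl (Sum.inr i) ∧ b = Sum.inr (Sum.inl i)) (σ a) (σ b) := by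
      intro a b h
      induction h with
      | rel a b h =>
        rcases h with ⟨u, v, huv, rfl, rfl⟩ | ⟨u, v, huv, rfl, rfl⟩
        · rw [hu, hu]
          rcases (D.rel_iff u v).1 huv with rfl | rfl
          · exact R.refl _
          · exact Relation.EqvGen.rel _ _ (Or.inl rfl)
        · refine R.trans (hl u) (R.trans ?_ (R.symm (hl v)))
          rcases (D'.rel_iff u v).1 huv with rfl | rfl
          · exact R.refl _
          · exact Relation.EqvGen.rel _ _ (Or.inl rfl)
      | refl a => exact R.refl _
      | symm a b _ ih => exact R.symm ih
      | trans a b c _ _ ih1 ih2 => exact R.trans ih1 ih2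
    rw [← ho, ← ho]
    exact key _ _ h
  · intro h
    have S := (stack D.rel D'.rel).iseqv
    have ho : ∀ u : Vert n, Sum.elim upper lower (dout u) = outer u := by
      rintro (i | i) <;> rfl
    have key : ∀ a b, Joined (dlink D D') (fun a b => ∃ i : Fin n,
        a = Sum.inl (Sum.inr i) ∧ b = Sum.inr (Sum.inl i)) a b →
        stack D.rel D'.rel (Sum.elim upper lower a) (Sum.elim upper lower b) := by
      intro a b h
      induction h with
      | rel a b h =>
        rcases h with rfl | ⟨i, rfl, rfl⟩
        · rcases a with a | a
          · exact Relation.EqvGen.rel _ _ (Or.inl ⟨a, D.link a, D.rel_link a, rfl, rfl⟩)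
          · exact Relation.EqvGen.rel _ _ (Or.inr ⟨a, D'.link a, D'.rel_link a, rfl, rfl⟩)
        · exact S.refl _
      | refl a => exact S.refl _
      | symm a b _ ih => exact S.symm ih
      | trans a b c _ _ ih1 ih2 => exact S.trans ih1 ih2
    rw [← ho, ← ho]
    exact key _ _ h

theorem comp_link {n : ℕ} (D D' : Diagram n) :
    ∃ l : Vert n → Vert n, NC pos l ∧ ∀ u v, compRel D.rel D'.rel u v ↔ v = u ∨ v = l u := by
  rcases Nat.eq_zero_or_pos n with rfl | hn
  · refine ⟨id, ⟨?_, ?_, ?_⟩, ?_⟩ <;> rintro (u | u) <;> exact u.elim0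
  let x : ℕ → Vert n ⊕ Vert n := fun i => if h : i < n then Sum.inl (Sum.inr ⟨i, h⟩) else
    Sum.inl (Sum.inr ⟨0, hn⟩)
  let y : ℕ → Vert n ⊕ Vert n := fun i => if h : i < n then Sum.inr (Sum.inl ⟨i, h⟩) else
    Sum.inr (Sum.inl ⟨0, hn⟩)
  have px : ∀ i < n, dpos (x i) = 2 * n - 1 - i := by
    intro i hi
    simp only [x, hi, dif_pos, dpos, pos, Fin.val_rev]; omega
  have py : ∀ i < n, dpos (y i) = 2 * n + i := by
    intro i hi
    simp only [y, hi, dif_pos, dpos, pos]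
  obtain ⟨g, hg, hgx, hgj⟩ := exists_glued dpos dpos_inj (dlink_nc D D') (n := n) x y
    (fun i hi => by rw [px i hi, py i hi]; omega)
    (fun i hi z h1 h2 => by
      rw [px i hi] at h1
      rw [py i hi] at h2
      by_cases hz : dpos z < 2 * n
      · exact ⟨2 * n - 1 - dpos z, by omega, Or.inl (dpos_inj (by rw [px _ (by omega)]; omega))⟩
      · exact ⟨dpos z - 2 * n, by omega, Or.inr (dpos_inj (by rw [py _ (by omega)]; omega))⟩)
    (fun i hi j hj => by
      rw [px i hi, px j (by omega), py i hi, py j (by omega)]; omega)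
  have hgy : ∀ i < n, g (y i) = x i := fun i hi => by rw [← hgx i hi, hg.1]
  have hout : ∀ u, ∀ i < n, dout u ≠ x i ∧ dout u ≠ y i := by
    rintro (u | u) i hi <;> simp [x, y, hi, dout]
  have hin : ∀ z, (∀ i < n, z ≠ x i ∧ z ≠ y i) → ∃ u, dout u = z := by
    rintro ((z | z) | (z | z)) h
    · exact ⟨Sum.inl z, rfl⟩
    · exact absurd (by simp [x]) (h z z.2).1
    · exact absurd (by simp [y]) (h z z.2).2
    · exact ⟨Sum.inr z, rfl⟩
  have hg' : ∀ u, ∃ v, dout v = g (dout u) := by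
    intro u
    apply hin
    intro i hi
    constructor
    · intro h
      apply (hout u i hi).2
      rw [← hgx i hi, ← h, hg.1]
    · intro h
      apply (hout u i hi).1
      rw [← hgy i hi, ← h, hg.1]
  choose l hl using hg'
  have dinj : ∀ u v : Vert n, dout u = dout v → u = v := by
    rintro (u | u) (v | v) h <;> simp only [dout, Sum.inl.injEq, Sum.inr.injEq, reduceCtorEq] at h
    · rw [h]
    · rw [h]
  have dlt : ∀ u v : Vert n, pos u < pos v → dpos (dout u) < dpos (dout v) := by
    rintro (u | u) (v | v) h <;> simp only [pos, dpos, dout, Fin.val_rev] at h ⊢ <;> omega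
  refine ⟨l, ⟨fun u => ?_, fun u h => ?_, fun u v h => ?_⟩, fun u v => ?_⟩
  · apply dinj; rw [hl, hl, hg.1]
  · apply hg.2.1 (dout u); rw [← hl, h]
  · apply hg.2.2 (dout u) (dout v)
    rw [← hl, ← hl]
    exact ⟨dlt _ _ h.1, dlt _ _ h.2.1, dlt _ _ h.2.2⟩
  · change stack D.rel D'.rel (outer u) (outer v) ↔ _
    rw [stack_iff_joined]
    have e : (fun a b : Vert n ⊕ Vert n => ∃ i : Fin n,
        a = Sum.inl (Sum.inr i) ∧ b = Sum.inr (Sum.inl i)) =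
        fun a b => ∃ i < n, a = x i ∧ b = y i := by
      funext a b
      apply propext
      constructor
      · rintro ⟨i, rfl, rfl⟩
        exact ⟨i, i.2, by simp [x], by simp [y]⟩
      · rintro ⟨i, hi, rfl, rfl⟩
        exact ⟨⟨i, hi⟩, by simp [x, hi], by simp [y, hi]⟩
    rw [e, hgj _ _ (hout u) (hout v), ← hl]
    constructor
    · rintro (h | h)
      · exact Or.inl (dinj _ _ h)
      · exact Or.inr (dinj _ _ h)
    · rintro (rfl | rfl)
      · exact Or.inl rfl
      · exact Or.inr rfl

/-- The concatenation of two diagrams, the first one on top, with closed loops removed. -/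
def Diagram.comp {n : ℕ} (D D' : Diagram n) : Diagram n where
  rel := compRel D.rel D'.rel
  pair u := by
    obtain ⟨l, hl, h⟩ := comp_link D D'
    refine ⟨l u, ⟨hl.2.1 u, (h _ _).2 (Or.inr rfl)⟩, fun v hv => ?_⟩
    exact ((h u v).1 hv.2).resolve_left hv.1
  planar u u' v v' hu hv := by
    obtain ⟨l, hl, h⟩ := comp_link D D'
    rintro ⟨h1, h2, h3⟩
    rcases (h _ _).1 hu with rfl | rfl
    · omega
    rcases (h _ _).1 hv with rfl | rfl
    · omega
    exact hl.2.2 u v ⟨h1, h2, h3⟩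

/-! ### Associativity of concatenation, by counting two-colourings that are constant on links -/

open Classical in
def colour {n : ℕ} (r : Setoid (Vert n)) : Matrix (Fin n → Fin 2) (Fin n → Fin 2) ℕ :=
  fun s t => if ∀ u v, r u v → Sum.elim s t u = Sum.elim s t v then 1 else 0

theorem colour_mul {n : ℕ} (r r' : Setoid (Vert n)) :
    colour r * colour r' = 2 ^ loops r r' • colour (compRel r r') := by
  classical
  ext s t
  simp only [Matrix.mul_apply, Matrix.smul_apply, smul_eq_mul]
  let full : (Fin n → Fin 2) → Stack n → Fin 2 := fun m => Sum.elim s (Sum.elim m t)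
  have full_upper : ∀ m u, full m (upper u) = Sum.elim s m u := by
    rintro m (u | u) <;> rfl
  have full_lower : ∀ m u, full m (lower u) = Sum.elim m t u := by
    rintro m (u | u) <;> rfl
  have full_outer : ∀ m u, full m (outer u) = Sum.elim s t u := by
    rintro m (u | u) <;> rfl
  let P : (Fin n → Fin 2) → Prop := fun m => ∀ x y, stack r r' x y → full m x = full m y
  have hterm : ∀ m, colour r s m * colour r' m t = if P m then 1 else 0 := by
    intro m
    have : P m ↔ (∀ u v, r u v → Sum.elim s m u = Sum.elim s m v) ∧
        (∀ u v, r' u v → Sum.elim m t u = Sum.elim m t v) := by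
      constructor
      · intro h
        constructor
        · intro u v huv
          rw [← full_upper, ← full_upper]
          exact h _ _ (Relation.EqvGen.rel _ _ (Or.inl ⟨u, v, huv, rfl, rfl⟩))
        · intro u v huv
          rw [← full_lower, ← full_lower]
          exact h _ _ (Relation.EqvGen.rel _ _ (Or.inr ⟨u, v, huv, rfl, rfl⟩))
      · rintro ⟨h1, h2⟩ x y h
        induction h with
        | rel a b h =>
          rcases h with ⟨u, v, huv, rfl, rfl⟩ | ⟨u, v, huv, rfl, rfl⟩
          · rw [full_upper, full_upper, h1 u v huv]
          · rw [full_lower, full_lower, h2 u v huv]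
        | refl a => rfl
        | symm a b _ ih => exact ih.symm
        | trans a b c _ _ ih1 ih2 => exact ih1.trans ih2
    simp only [colour]
    rw [if_congr this rfl rfl, ite_and]
    split_ifs <;> rfl
  simp only [hterm]
  rw [Finset.sum_boole, Nat.cast_id]
  by_cases hst : ∀ u v, compRel r r' u v → Sum.elim s t u = Sum.elim s t v
  · rw [colour, if_pos hst, mul_one, ← Fintype.card_subtype, ← Nat.card_eq_fintype_card]
    have : Finite (ClosedLoop r r') := by unfold ClosedLoop; infer_instance
    have e : {m // P m} ≃ (ClosedLoop r r' → Fin 2) :=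
      { toFun := fun m c => Quotient.lift (full m.1) m.2 c.1
        invFun := fun h =>
          let G : Quotient (stack r r') → Fin 2 := fun c =>
            if hc : ∀ u, Quotient.mk (stack r r') (outer u) ≠ c then h ⟨c, hc⟩
            else Sum.elim s t (not_forall_not.1 hc).choose
          have hG : ∀ u, G (Quotient.mk _ (outer u)) = Sum.elim s t u := by
            intro u
            have hc : ¬ ∀ u', Quotient.mk (stack r r') (outer u') ≠
              Quotient.mk (stack r r') (outer u) := fun h => h u rfl
            simp only [G]
            rw [dif_neg hc]
            have hs := (not_forall_not.1 hc).choose_spec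
            exact hst _ _ (show stack r r' _ _ from Quotient.exact hs)
          ⟨fun i => G (Quotient.mk _ (Sum.inr (Sum.inl i))), by
            have : ∀ x, full (fun i => G (Quotient.mk _ (Sum.inr (Sum.inl i)))) x =
                G (Quotient.mk _ x) := by
              rintro (i | i | i)
              · exact (hG (Sum.inl i)).symm
              · rfl
              · exact (hG (Sum.inr i)).symm
            intro x y hxy
            rw [this, this, Quotient.sound hxy]⟩
        left_inv := by
          rintro ⟨m, hm⟩
          apply Subtype.ext
          funext i
          simp only
          split_ifs with hc
          · rfl
          · have h := (not_forall_not.1 hc).choose_spec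
            rw [← full_outer m]
            exact hm _ _ (Quotient.exact h)
        right_inv := by
          intro h
          funext ⟨c, hc⟩
          induction c using Quotient.inductionOn with
          | h x =>
            rcases x with i | i | i
            · exact absurd rfl (hc (Sum.inl i))
            · simp only [Quotient.lift_mk, full, Sum.elim_inr, Sum.elim_inl]
              rw [dif_pos hc]
            · exact absurd rfl (hc (Sum.inr i)) }
    rw [Nat.card_congr e, Nat.card_fun, Nat.card_eq_fintype_card, Fintype.card_fin]
    rfl
  · rw [colour, if_neg hst, mul_zero, Finset.card_eq_zero, Finset.filter_eq_empty_iff]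
    intro m _ hm
    apply hst
    intro u v huv
    rw [← full_outer m, ← full_outer m]
    exact hm _ _ huv

theorem colour_const {n : ℕ} (r : Setoid (Vert n)) : colour r (fun _ => 0) (fun _ => 0) = 1 := by
  rw [colour, if_pos]
  rintro (u | u) (v | v) _ <;> rfl

theorem colour_inj {n : ℕ} {r r' : Setoid (Vert n)} (h : colour r = colour r') : r = r' := by
  classical
  have key : ∀ r r' : Setoid (Vert n), colour r = colour r' → ∀ u v, r' u v → r u v := by
    intro r r' h u v huv
    let S : Vert n → Fin 2 := fun w => if r u w then 1 else 0
    have hS : Sum.elim (S ∘ Sum.inl) (S ∘ Sum.inr) = S := Sum.elim_comp_inl_inr S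
    have h1 : colour r (S ∘ Sum.inl) (S ∘ Sum.inr) = 1 := by
      rw [colour, if_pos]
      intro a b hab
      rw [hS]
      have : r u a ↔ r u b := ⟨fun h => r.trans' h hab, fun h => r.trans' h (r.symm' hab)⟩
      simp only [S, this]
    rw [h, colour, hS] at h1
    have h2 : ∀ a b, r' a b → S a = S b := by
      by_contra hc
      rw [if_neg hc] at h1
      exact zero_ne_one h1
    have h3 := h2 u v huv
    by_contra hc
    simp [S, hc] at h3
  ext u v
  exact ⟨key r' r h.symm u v, key r r' h u v⟩

theorem colour_smul_inj {n : ℕ} {r r' : Setoid (Vert n)} {a b : ℕ}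
    (h : 2 ^ a • colour r = 2 ^ b • colour r') : r = r' ∧ a = b := by
  have h0 := congrFun (congrFun h (fun _ => 0)) (fun _ => 0)
  simp only [Matrix.smul_apply, colour_const, smul_eq_mul, mul_one] at h0
  have hab : a = b := Nat.pow_right_injective le_rfl h0
  subst hab
  refine ⟨colour_inj ?_, rfl⟩
  ext s t
  have := congrFun (congrFun h s) t
  simpa using this

theorem comp_assoc_aux {n : ℕ} (r s t : Setoid (Vert n)) :
    compRel (compRel r s) t = compRel r (compRel s t) ∧
      loops r s + loops (compRel r s) t = loops s t + loops r (compRel s t) := by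
  have h := mul_assoc (colour r) (colour s) (colour t)
  rw [colour_mul, colour_mul, smul_mul_assoc, mul_smul_comm, colour_mul, colour_mul, smul_smul,
    smul_smul, ← pow_add, ← pow_add] at h
  exact colour_smul_inj h

/-- The diagram all of whose links are straight. -/
def Diagram.id (n : ℕ) : Diagram n where
  rel := Setoid.ker (Sum.elim (fun i => i) (fun i => i))
  pair := by
    rintro (i | i)
    · refine ⟨Sum.inr i, ⟨by simp, rfl⟩, ?_⟩
      rintro (j | j) ⟨h1, h2⟩
      · exact absurd (congrArg _ (show j = i from h2.symm)) h1
      · exact congrArg _ (show j = i from h2.symm)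
    · refine ⟨Sum.inl i, ⟨by simp, rfl⟩, ?_⟩
      rintro (j | j) ⟨h1, h2⟩
      · exact congrArg _ (show j = i from h2.symm)
      · exact absurd (congrArg _ (show j = i from h2.symm)) h1
  planar := by
    rintro (i | i) (i' | i') (j | j) (j' | j') h1 h2 <;>
      (have h1 : i = i' := h1; have h2 : j = j' := h2; subst h1 h2
       simp only [pos, Fin.val_rev]; omega)

theorem colour_id (n : ℕ) : colour (Diagram.id n).rel = 1 := by
  classical
  ext s t
  rw [colour, Matrix.one_apply]
  congr 1
  apply propext
  constructor
  · intro h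
    funext i
    exact h (Sum.inl i) (Sum.inr i) rfl
  · rintro rfl (i | i) (j | j) h <;> exact congrArg s h

theorem id_comp_aux {n : ℕ} (r : Setoid (Vert n)) :
    compRel (Diagram.id n).rel r = r ∧ loops (Diagram.id n).rel r = 0 := by
  have h := colour_mul (Diagram.id n).rel r
  rw [colour_id, one_mul, ← one_smul ℕ (colour r), ← pow_zero 2] at h
  have := colour_smul_inj h
  exact ⟨this.1.symm, this.2.symm⟩

theorem comp_id_aux {n : ℕ} (r : Setoid (Vert n)) :
    compRel r (Diagram.id n).rel = r ∧ loops r (Diagram.id n).rel = 0 := by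
  have h := colour_mul r (Diagram.id n).rel
  rw [colour_id, mul_one, ← one_smul ℕ (colour r), ← pow_zero 2] at h
  have := colour_smul_inj h
  exact ⟨this.1.symm, this.2.symm⟩

/-! ### The Temperley-Lieb algebra -/

/-- The Temperley-Lieb algebra: the complex vector space with basis the `n`-diagrams. -/
def TL (_q : ℂ) (n : ℕ) : Type := Diagram n →₀ ℂ

section Algebra

variable {q : ℂ} {n : ℕ}

instance : AddCommGroup (TL q n) := inferInstanceAs (AddCommGroup (Diagram n →₀ ℂ))
instance : Module ℂ (TL q n) := inferInstanceAs (Module ℂ (Diagram n →₀ ℂ))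

/-- A diagram as an element of the Temperley-Lieb algebra. -/
def diag (q : ℂ) {n : ℕ} (D : Diagram n) : TL q n := Finsupp.single D 1

/-- Extension of a function on diagrams to a linear map. -/
def linExt (q : ℂ) {n : ℕ} {M : Type*} [AddCommGroup M] [Module ℂ M] (f : Diagram n → M) :
    TL q n →ₗ[ℂ] M :=
  Finsupp.linearCombination ℂ f

@[simp]
theorem linExt_diag {M : Type*} [AddCommGroup M] [Module ℂ M] (f : Diagram n → M)
    (D : Diagram n) : linExt q f (diag q D) = f D :=
  (Finsupp.linearCombination_single ℂ 1 D).trans (one_smul ℂ (f D))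

theorem TL.hom_ext {M : Type*} [AddCommGroup M] [Module ℂ M] {f g : TL q n →ₗ[ℂ] M}
    (h : ∀ D, f (diag q D) = g (diag q D)) : f = g :=
  Finsupp.lhom_ext' fun D => LinearMap.ext_ring (h D)

theorem TL.induction {P : TL q n → Prop} (add : ∀ x y, P x → P y → P (x + y))
    (smul : ∀ (c : ℂ) (D : Diagram n), P (c • diag q D)) (x : TL q n) : P x := by
  have hz : P 0 := by simpa using smul 0 (Diagram.id n)
  refine Finsupp.induction_linear (motive := P) x hz (fun f g => add f g) fun D c => ?_
  have h : (Finsupp.single D c : TL q n) = c • diag q D :=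
    (Finsupp.smul_single_one D c).symm
  rw [h]
  exact smul c D

/-- Multiplication: `D * D' = β ^ (number of closed loops) • (D on top of D')` with
`β = -q - q⁻¹`. -/
def mulLin (q : ℂ) (n : ℕ) : TL q n →ₗ[ℂ] TL q n →ₗ[ℂ] TL q n :=
  linExt q fun D => linExt q fun D' => (-q - q⁻¹) ^ loops D.rel D'.rel • diag q (D.comp D')

instance : Mul (TL q n) := ⟨fun x y => mulLin q n x y⟩
instance : One (TL q n) := ⟨diag q (Diagram.id n)⟩

theorem TL.mul_def (x y : TL q n) : x * y = mulLin q n x y := rfl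
theorem TL.one_def : (1 : TL q n) = diag q (Diagram.id n) := rfl

theorem diag_mul_diag (D D' : Diagram n) : diag q D * diag q D' =
    (-q - q⁻¹) ^ loops D.rel D'.rel • diag q (D.comp D') := by
  simp [TL.mul_def, mulLin]

theorem TL.assoc (x y z : TL q n) : x * y * z = x * (y * z) := by
  have h : (mulLin q n).compr₂ (mulLin q n) =
      ((LinearMap.llcomp ℂ (TL q n) (TL q n) (TL q n)).comp (mulLin q n)).compl₂ (mulLin q n) := by
    refine TL.hom_ext fun D => TL.hom_ext fun D' => TL.hom_ext fun D'' => ?_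
    simp only [LinearMap.compr₂_apply, LinearMap.compl₂_apply, LinearMap.comp_apply,
      LinearMap.llcomp_apply, ← TL.mul_def, diag_mul_diag]
    simp only [TL.mul_def, map_smul, LinearMap.smul_apply]
    simp only [← TL.mul_def, diag_mul_diag, smul_smul, ← pow_add]
    obtain ⟨h1, h2⟩ := comp_assoc_aux D.rel D'.rel D''.rel
    have h3 : (D.comp D').comp D'' = D.comp (D'.comp D'') := Diagram.ext h1
    rw [h3]
    congr 2
  exact congrArg (fun f => f x y z) h

instance : Ring (TL q n) where
  __ := (inferInstance : AddCommGroup (TL q n))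
  mul_assoc := TL.assoc
  left_distrib x y z := by simp [TL.mul_def]
  right_distrib x y z := by simp [TL.mul_def]
  zero_mul x := by simp [TL.mul_def]
  mul_zero x := by simp [TL.mul_def]
  one_mul x := by
    have : mulLin q n 1 = LinearMap.id := by
      refine TL.hom_ext fun D => ?_
      obtain ⟨h1, h2⟩ := id_comp_aux D.rel
      have h3 : (Diagram.id n).comp D = D := Diagram.ext h1
      rw [← TL.mul_def, TL.one_def, diag_mul_diag, h2, h3]
      simp
    rw [TL.mul_def, this]; rfl
  mul_one x := by
    have : (mulLin q n).flip 1 = LinearMap.id := by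
      refine TL.hom_ext fun D => ?_
      obtain ⟨h1, h2⟩ := comp_id_aux D.rel
      have h3 : D.comp (Diagram.id n) = D := Diagram.ext h1
      rw [LinearMap.flip_apply, ← TL.mul_def, TL.one_def, diag_mul_diag, h2, h3]
      simp
    exact congrArg (fun f => f x) this

instance : Algebra ℂ (TL q n) :=
  Algebra.ofModule (fun a x y => by simp [TL.mul_def]) (fun a x y => by simp [TL.mul_def])

end Algebra

/-! ### Horizontal composition -/

/-- A vertex of the diagram with `a + b` vertices on each line, as a vertex of its left part (the
first `a` vertices of each line) or of its right part. -/
def splitVert {a b : ℕ} : Vert (a + b) → Vert a ⊕ Vert b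
  | Sum.inl i => Sum.map Sum.inl Sum.inl (finSumFinEquiv.symm i)
  | Sum.inr i => Sum.map Sum.inr Sum.inr (finSumFinEquiv.symm i)

/-- Two partitions side by side. -/
def juxtaRel {a b : ℕ} (r : Setoid (Vert a)) (s : Setoid (Vert b)) : Setoid (Vert (a + b)) :=
  Setoid.ker fun u => Sum.map (Quotient.mk r) (Quotient.mk s) (splitVert u)

def leftVert {a b : ℕ} : Vert a → Vert (a + b) := Sum.map (Fin.castAdd b) (Fin.castAdd b)
def rightVert {a b : ℕ} : Vert b → Vert (a + b) := Sum.map (Fin.natAdd a) (Fin.natAdd a)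

theorem splitVert_left {a b : ℕ} (u : Vert a) :
    splitVert (leftVert u : Vert (a + b)) = Sum.inl u := by
  rcases u with u | u <;> simp [splitVert, leftVert]

theorem splitVert_right {a b : ℕ} (u : Vert b) :
    splitVert (rightVert u : Vert (a + b)) = Sum.inr u := by
  rcases u with u | u <;> simp [splitVert, rightVert]

theorem vert_cases {a b : ℕ} (w : Vert (a + b)) :
    (∃ u, w = leftVert u) ∨ (∃ u, w = rightVert u) := by
  rcases w with i | i
  · refine Fin.addCases (fun j => ?_) (fun j => ?_) i
    · exact Or.inl ⟨Sum.inl j, rfl⟩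
    · exact Or.inr ⟨Sum.inl j, rfl⟩
  · refine Fin.addCases (fun j => ?_) (fun j => ?_) i
    · exact Or.inl ⟨Sum.inr j, rfl⟩
    · exact Or.inr ⟨Sum.inr j, rfl⟩

section

variable {a b : ℕ} (r : Setoid (Vert a)) (s : Setoid (Vert b))

theorem juxta_ll (u v : Vert a) : juxtaRel r s (leftVert u) (leftVert v) ↔ r u v := by
  change Sum.map _ _ _ = Sum.map _ _ _ ↔ _
  rw [splitVert_left, splitVert_left, Sum.map_inl, Sum.map_inl, Sum.inl.injEq]
  exact Quotient.eq (r := r)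

theorem juxta_rr (u v : Vert b) : juxtaRel r s (rightVert u) (rightVert v) ↔ s u v := by
  change Sum.map _ _ _ = Sum.map _ _ _ ↔ _
  rw [splitVert_right, splitVert_right, Sum.map_inr, Sum.map_inr, Sum.inr.injEq]
  exact Quotient.eq (r := s)

theorem juxta_lr (u : Vert a) (v : Vert b) : ¬ juxtaRel r s (leftVert u) (rightVert v) := by
  change ¬ (Sum.map _ _ _ = Sum.map _ _ _)
  rw [splitVert_left, splitVert_right, Sum.map_inl, Sum.map_inr]
  exact Sum.inl_ne_inr

theorem juxta_rl (u : Vert b) (v : Vert a) : ¬ juxtaRel r s (rightVert u) (leftVert v) := by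
  change ¬ (Sum.map _ _ _ = Sum.map _ _ _)
  rw [splitVert_left, splitVert_right, Sum.map_inl, Sum.map_inr]
  exact Sum.inr_ne_inl

end

theorem leftVert_inj {a b : ℕ} : Function.Injective (leftVert : Vert a → Vert (a + b)) := by
  intro u v h
  have := congrArg splitVert h
  rwa [splitVert_left, splitVert_left, Sum.inl.injEq] at this

theorem rightVert_inj {a b : ℕ} : Function.Injective (rightVert : Vert b → Vert (a + b)) := by
  intro u v h
  have := congrArg splitVert h
  rwa [splitVert_right, splitVert_right, Sum.inr.injEq] at this

/-- The position on the boundary of the left part. -/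
theorem pos_left {a b : ℕ} (u : Vert a) : pos (leftVert u : Vert (a + b)) =
    if pos u < a then pos u else pos u + 2 * b := by
  rcases u with u | u
  · simp [pos, leftVert]
  · have h : ¬ pos (Sum.inr u : Vert a) < a := by simp [pos]
    rw [if_neg h]
    simp only [pos, leftVert, Sum.map_inr, Fin.val_rev, Fin.val_castAdd]
    omega

theorem pos_right {a b : ℕ} (u : Vert b) : pos (rightVert u : Vert (a + b)) = a + pos u := by
  rcases u with u | u
  · simp [pos, rightVert]
  · simp only [pos, rightVert, Sum.map_inr, Fin.val_rev, Fin.val_natAdd]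
    omega

/-- The horizontal composition of two diagrams, the first one on the left. -/
def Diagram.juxta {a b : ℕ} (D : Diagram a) (D' : Diagram b) : Diagram (a + b) where
  rel := juxtaRel D.rel D'.rel
  pair w := by
    rcases vert_cases w with ⟨u, rfl⟩ | ⟨u, rfl⟩
    · obtain ⟨v, ⟨h1, h2⟩, h3⟩ := D.pair u
      refine ⟨leftVert v, ⟨fun h => h1 (leftVert_inj h), (juxta_ll _ _ _ _).2 h2⟩, ?_⟩
      rintro w ⟨h4, h5⟩
      rcases vert_cases w with ⟨z, rfl⟩ | ⟨z, rfl⟩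
      · exact congrArg _ (h3 z ⟨fun h => h4 (congrArg _ h), (juxta_ll _ _ _ _).1 h5⟩)
      · exact absurd h5 (juxta_lr _ _ _ _)
    · obtain ⟨v, ⟨h1, h2⟩, h3⟩ := D'.pair u
      refine ⟨rightVert v, ⟨fun h => h1 (rightVert_inj h), (juxta_rr _ _ _ _).2 h2⟩, ?_⟩
      rintro w ⟨h4, h5⟩
      rcases vert_cases w with ⟨z, rfl⟩ | ⟨z, rfl⟩
      · exact absurd h5 (juxta_rl _ _ _ _)
      · exact congrArg _ (h3 z ⟨fun h => h4 (congrArg _ h), (juxta_rr _ _ _ _).1 h5⟩)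
  planar w w' z z' hw hz := by
    rcases vert_cases w with ⟨u, rfl⟩ | ⟨u, rfl⟩ <;>
    rcases vert_cases w' with ⟨u', rfl⟩ | ⟨u', rfl⟩ <;>
    rcases vert_cases z with ⟨v, rfl⟩ | ⟨v, rfl⟩ <;>
    rcases vert_cases z' with ⟨v', rfl⟩ | ⟨v', rfl⟩ <;>
    first
    | exact absurd hw (juxta_lr _ _ _ _)
    | exact absurd hw (juxta_rl _ _ _ _)
    | exact absurd hz (juxta_lr _ _ _ _)
    | exact absurd hz (juxta_rl _ _ _ _)
    | skip
    · have := D.planar u u' v v' ((juxta_ll _ _ _ _).1 hw) ((juxta_ll _ _ _ _).1 hz)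
      simp only [pos_left]
      split_ifs <;> omega
    · simp only [pos_left, pos_right]
      have := pos_lt v; have := pos_lt v'
      split_ifs <;> omega
    · simp only [pos_left, pos_right]
      have := pos_lt u; have := pos_lt u'
      split_ifs <;> omega
    · have := D'.planar u u' v v' ((juxta_rr _ _ _ _).1 hw) ((juxta_rr _ _ _ _).1 hz)
      simp only [pos_right]
      omega

theorem colour_juxta {a b : ℕ} (r : Setoid (Vert a)) (s : Setoid (Vert b))
    (x y : Fin (a + b) → Fin 2) : colour (juxtaRel r s) x y =
      colour r (fun i => x (Fin.castAdd b i)) (fun i => y (Fin.castAdd b i)) *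
      colour s (fun i => x (Fin.natAdd a i)) (fun i => y (Fin.natAdd a i)) := by
  classical
  have hl : ∀ u : Vert a, Sum.elim (fun i => x (Fin.castAdd b i)) (fun i => y (Fin.castAdd b i)) u
      = Sum.elim x y (leftVert u) := by rintro (u | u) <;> rfl
  have hr : ∀ u : Vert b, Sum.elim (fun i => x (Fin.natAdd a i)) (fun i => y (Fin.natAdd a i)) u
      = Sum.elim x y (rightVert u) := by rintro (u | u) <;> rfl
  simp only [colour, hl, hr]
  rw [ite_zero_mul_ite_zero, mul_one]
  refine if_congr ?_ rfl rfl
  constructor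
  · intro h
    exact ⟨fun u v huv => h _ _ ((juxta_ll _ _ _ _).2 huv),
      fun u v huv => h _ _ ((juxta_rr _ _ _ _).2 huv)⟩
  · rintro ⟨h1, h2⟩ w z hwz
    rcases vert_cases w with ⟨u, rfl⟩ | ⟨u, rfl⟩ <;> rcases vert_cases z with ⟨v, rfl⟩ | ⟨v, rfl⟩
    · exact h1 _ _ ((juxta_ll _ _ _ _).1 hwz)
    · exact absurd hwz (juxta_lr _ _ _ _)
    · exact absurd hwz (juxta_rl _ _ _ _)
    · exact h2 _ _ ((juxta_rr _ _ _ _).1 hwz)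

theorem juxta_comp_aux {a b : ℕ} (r r' : Setoid (Vert a)) (s s' : Setoid (Vert b)) :
    compRel (juxtaRel r s) (juxtaRel r' s') = juxtaRel (compRel r r') (compRel s s') ∧
      loops (juxtaRel r s) (juxtaRel r' s') = loops r r' + loops s s' := by
  apply colour_smul_inj
  rw [← colour_mul]
  ext x y
  have h1 := congrFun (congrFun (colour_mul r r') fun i => x (Fin.castAdd b i))
    fun i => y (Fin.castAdd b i)
  have h2 := congrFun (congrFun (colour_mul s s') fun i => x (Fin.natAdd a i))
    fun i => y (Fin.natAdd a i)
  simp only [Matrix.mul_apply, Matrix.smul_apply, smul_eq_mul] at h1 h2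
  simp only [Matrix.mul_apply, Matrix.smul_apply, smul_eq_mul, colour_juxta]
  rw [pow_add, mul_mul_mul_comm, ← h1, ← h2, Finset.sum_mul_sum, ← Finset.sum_product',
    Finset.univ_product_univ, ← (Fin.appendEquiv a b).sum_comp]
  refine Finset.sum_congr rfl fun p _ => ?_
  simp [Fin.appendEquiv]
  ring

theorem juxta_id (a b : ℕ) : (Diagram.id a).juxta (Diagram.id b) = Diagram.id (a + b) := by
  apply Diagram.ext
  apply colour_inj
  ext x y
  change colour (juxtaRel _ _) x y = _
  rw [colour_juxta, colour_id, colour_id, colour_id, Matrix.one_apply, Matrix.one_apply,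
    Matrix.one_apply, ite_zero_mul_ite_zero, mul_one]
  refine if_congr ?_ rfl rfl
  constructor
  · rintro ⟨h1, h2⟩
    funext i
    exact Fin.addCases (fun j => congrFun h1 j) (fun j => congrFun h2 j) i
  · rintro rfl
    exact ⟨rfl, rfl⟩

/-- The inclusion `TL_a ⊗ TL_b → TL_{a+b}` by horizontal composition. -/
def tlTensor (q : ℂ) (a b : ℕ) : TL q a ⊗[ℂ] TL q b →ₐ[ℂ] TL q (a + b) :=
  Algebra.TensorProduct.algHomOfLinearMapTensorProduct
    (TensorProduct.lift (linExt q fun D => linExt q fun D' => diag q (D.juxta D')))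
    (by
      intro x x' y y'
      let J : TL q a →ₗ[ℂ] TL q b →ₗ[ℂ] TL q (a + b) :=
        linExt q fun D => linExt q fun D' => diag q (D.juxta D')
      change J (x * x') (y * y') = J x y * J x' y'
      have hd : ∀ D D', J (diag q D) (diag q D') = diag q (D.juxta D') := by
        intro D D'; simp [J]
      have key : ∀ D D' E E', J (diag q D * diag q D') (diag q E * diag q E') =
          J (diag q D) (diag q E) * J (diag q D') (diag q E') := by
        intro D D' E E'
        obtain ⟨h1, h2⟩ := juxta_comp_aux D.rel D'.rel E.rel E'.rel
        have h3 : (D.juxta E).comp (D'.juxta E') = (D.comp D').juxta (E.comp E') :=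
          Diagram.ext h1
        have h4 : loops (D.juxta E).rel (D'.juxta E').rel = loops D.rel D'.rel +
          loops E.rel E'.rel := h2
        simp only [diag_mul_diag, map_smul, LinearMap.smul_apply, hd, h3, h4, smul_smul,
          ← pow_add]
        rw [Nat.add_comm (loops E.rel E'.rel)]
      induction x using TL.induction with
      | add x₁ x₂ h1 h2 => simp only [add_mul, map_add, LinearMap.add_apply, h1, h2]
      | smul c D =>
      induction x' using TL.induction with
      | add x₁ x₂ h1 h2 => simp only [mul_add, map_add, LinearMap.add_apply, h1, h2]
      | smul c' D' =>
      induction y using TL.induction with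
      | add x₁ x₂ h1 h2 => simp only [add_mul, map_add, h1, h2]
      | smul d E =>
      induction y' using TL.induction with
      | add x₁ x₂ h1 h2 => simp only [mul_add, map_add, h1, h2]
      | smul d' E' =>
        simp only [smul_mul_assoc, mul_smul_comm, map_smul, LinearMap.smul_apply, key]
        rw [smul_comm d c'])
    (by
      change (linExt q fun D => linExt q fun D' => diag q (D.juxta D'))
        (diag q (Diagram.id a)) (diag q (Diagram.id b)) = _
      simp [juxta_id, TL.one_def])

/-! ### The trivial representation -/

theorem eq_id_of_through {n : ℕ} (D : Diagram n)
    (h : ∀ i j : Fin n, D.rel (Sum.inl i) (Sum.inl j) → i = j) : D = Diagram.id n := by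
  have h1 : ∀ i : Fin n, ∃ j : Fin n, D.link (Sum.inl i) = Sum.inr j := by
    intro i
    rcases hj : D.link (Sum.inl i) with j | j
    · exfalso
      have h2 := D.rel_link (Sum.inl i)
      rw [hj] at h2
      rw [← h i j h2] at hj
      exact D.link_ne _ hj
    · exact ⟨j, rfl⟩
  choose p hp using h1
  have inj : Function.Injective p := by
    intro i j hij
    have : D.link (Sum.inl i) = D.link (Sum.inl j) := by rw [hp, hp, hij]
    have h3 := congrArg D.link this
    rw [D.link_link, D.link_link] at h3
    exact Sum.inl_injective h3
  have mono : StrictMono p := by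
    intro i j hij
    have h2 := D.nc.2.2 (Sum.inl i) (Sum.inl j)
    rw [hp, hp] at h2
    simp only [pos, Fin.val_rev] at h2
    have h3 : p i ≠ p j := fun h => hij.ne (inj h)
    have h4 : (p i : ℕ) ≠ p j := fun h => h3 (Fin.ext h)
    rw [Fin.lt_def] at hij ⊢
    omega
  have hid : p = id := (StrictMono.range_inj mono strictMono_id).1 (by
    rw [(Finite.injective_iff_surjective.1 inj).range_eq, Set.range_id])
  subst hid
  have hq : ∀ i : Fin n, D.link (Sum.inr i) = Sum.inl i := by
    intro i
    have := congrArg D.link (hp i)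
    rw [D.link_link] at this
    exact this.symm
  apply Diagram.ext
  ext u v
  rw [D.rel_iff]
  change _ ↔ Sum.elim _ _ u = Sum.elim _ _ v
  rcases u with u | u <;> rcases v with v | v <;> simp [hp, hq, eq_comm]

theorem comp_eq_id_iff {n : ℕ} (D D' : Diagram n) :
    D.comp D' = Diagram.id n ↔ D = Diagram.id n ∧ D' = Diagram.id n := by
  constructor
  · intro h
    have hD : D = Diagram.id n := by
      apply eq_id_of_through
      intro i j hij
      have h1 : (D.comp D').rel (Sum.inl i) (Sum.inl j) :=
        Relation.EqvGen.rel _ _ (Or.inl ⟨_, _, hij, rfl, rfl⟩)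
      rw [h] at h1
      exact h1
    subst hD
    exact ⟨rfl, (Diagram.ext (id_comp_aux D'.rel).1.symm).trans h⟩
  · rintro ⟨rfl, rfl⟩
    exact Diagram.ext (id_comp_aux _).1

open Classical in
/-- The trivial character of `TL_n`: every diagram other than the identity, in particular every
`e_i`, acts by `0`. -/
def triv (q : ℂ) (n : ℕ) : TL q n →ₐ[ℂ] ℂ :=
  AlgHom.ofLinearMap (linExt q fun D => if D = Diagram.id n then 1 else 0)
    (by simp [TL.one_def])
    (by
      intro x y
      have key : ∀ D D' : Diagram n,
          linExt q (fun D => if D = Diagram.id n then (1 : ℂ) else 0) (diag q D * diag q D') =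
          linExt q (fun D => if D = Diagram.id n then (1 : ℂ) else 0) (diag q D) *
          linExt q (fun D => if D = Diagram.id n then (1 : ℂ) else 0) (diag q D') := by
        intro D D'
        rw [diag_mul_diag, map_smul, linExt_diag, linExt_diag, linExt_diag, smul_eq_mul,
          ite_zero_mul_ite_zero, mul_one]
        by_cases h : D = Diagram.id n ∧ D' = Diagram.id n
        · rw [if_pos ((comp_eq_id_iff D D').2 h), if_pos h, h.1, h.2, (id_comp_aux _).2]
          simp
        · rw [if_neg (fun h' => h ((comp_eq_id_iff D D').1 h')), if_neg h, mul_zero]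
      induction x using TL.induction with
      | add x₁ x₂ h1 h2 => simp only [add_mul, map_add, h1, h2]
      | smul c D =>
      induction y using TL.induction with
      | add x₁ x₂ h1 h2 => simp only [mul_add, map_add, h1, h2]
      | smul c' D' =>
        simp only [smul_mul_assoc, mul_smul_comm, map_smul, smul_eq_mul, key]
        ring)

/-! ### Special diagrams -/

/-- The diagram `e_i` (here `i` is counted from `0`): the vertices `i` and `i + 1` are linked on
both lines, and all other links are straight. -/
def Diagram.gen {n : ℕ} (i : ℕ) (hi : i + 1 < n) : Diagram n where
  rel := Setoid.ker fun u : Vert n => match u with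
    | Sum.inl j => if j.val = i ∨ j.val = i + 1 then n else j.val
    | Sum.inr j => if j.val = i ∨ j.val = i + 1 then n + 1 else j.val
  pair := by
    have h0 : i < n := by omega
    rintro (j | j)
    · by_cases h1 : j.val = i
      · refine ⟨Sum.inl ⟨i + 1, hi⟩, ⟨?_, ?_⟩, ?_⟩
        · simp [Fin.ext_iff, h1]
        · simp [Setoid.ker_def, h1]
        · rintro (k | k) ⟨h2, h3⟩ <;> simp only [Setoid.ker_def, ne_eq, Sum.inl.injEq, Fin.ext_iff, reduceCtorEq] at * <;> split_ifs at h3 <;> omega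
      by_cases h1' : j.val = i + 1
      · refine ⟨Sum.inl ⟨i, h0⟩, ⟨?_, ?_⟩, ?_⟩
        · simp [Fin.ext_iff, h1']
        · simp [Setoid.ker_def, h1']
        · rintro (k | k) ⟨h2, h3⟩ <;> simp only [Setoid.ker_def, ne_eq, Sum.inl.injEq, Fin.ext_iff, reduceCtorEq] at * <;> split_ifs at h3 <;> omega
      · refine ⟨Sum.inr j, ⟨?_, ?_⟩, ?_⟩
        · simp
        · simp [Setoid.ker_def, h1, h1']
        · rintro (k | k) ⟨h2, h3⟩ <;> simp only [Setoid.ker_def, ne_eq, Sum.inl.injEq, Sum.inr.injEq, Fin.ext_iff, reduceCtorEq] at * <;> split_ifs at h3 <;> omega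
    · by_cases h1 : j.val = i
      · refine ⟨Sum.inr ⟨i + 1, hi⟩, ⟨?_, ?_⟩, ?_⟩
        · simp [Fin.ext_iff, h1]
        · simp [Setoid.ker_def, h1]
        · rintro (k | k) ⟨h2, h3⟩ <;> simp only [Setoid.ker_def, ne_eq, Sum.inr.injEq, Fin.ext_iff, reduceCtorEq] at * <;> split_ifs at h3 <;> omega
      by_cases h1' : j.val = i + 1
      · refine ⟨Sum.inr ⟨i, h0⟩, ⟨?_, ?_⟩, ?_⟩
        · simp [Fin.ext_iff, h1']
        · simp [Setoid.ker_def, h1']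
        · rintro (k | k) ⟨h2, h3⟩ <;> simp only [Setoid.ker_def, ne_eq, Sum.inr.injEq, Fin.ext_iff, reduceCtorEq] at * <;> split_ifs at h3 <;> omega
      · refine ⟨Sum.inl j, ⟨?_, ?_⟩, ?_⟩
        · simp
        · simp [Setoid.ker_def, h1, h1']
        · rintro (k | k) ⟨h2, h3⟩ <;> simp only [Setoid.ker_def, ne_eq, Sum.inl.injEq, Sum.inr.injEq, Fin.ext_iff, reduceCtorEq] at * <;> split_ifs at h3 <;> omega
  planar := by
    rintro (u | u) (u' | u') (v | v) (v' | v') h1 h2 <;>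
      simp only [Setoid.ker_def] at h1 h2 <;>
      simp only [pos, Fin.val_rev] <;>
      split_ifs at h1 <;> split_ifs at h2 <;> omega

/-- The diagram with `n` nested links on the top line and `n` nested links on the bottom line. -/
def Diagram.nested (n : ℕ) : Diagram (n + n) where
  rel := Setoid.ker fun u : Vert (n + n) => match u with
    | Sum.inl j => (true, min j.val j.rev.val)
    | Sum.inr j => (false, min j.val j.rev.val)
  pair := by
    rintro (j | j)
    · refine ⟨Sum.inl j.rev, ⟨?_, ?_⟩, ?_⟩
      · simp only [ne_eq, Sum.inl.injEq, Fin.ext_iff, Fin.val_rev]; omega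
      · simp only [Setoid.ker_def, Fin.rev_rev, min_comm]
      · rintro (k | k) ⟨h2, h3⟩ <;> simp only [Setoid.ker_def, ne_eq, Sum.inl.injEq, Sum.inr.injEq, Fin.ext_iff,
          Fin.val_rev, reduceCtorEq, Prod.mk.injEq, true_and, false_and] at * <;> omega
    · refine ⟨Sum.inr j.rev, ⟨?_, ?_⟩, ?_⟩
      · simp only [ne_eq, Sum.inr.injEq, Fin.ext_iff, Fin.val_rev]; omega
      · simp only [Setoid.ker_def, Fin.rev_rev, min_comm]
      · rintro (k | k) ⟨h2, h3⟩ <;> simp only [Setoid.ker_def, ne_eq, Sum.inl.injEq, Sum.inr.injEq, Fin.ext_iff,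
          Fin.val_rev, reduceCtorEq, Prod.mk.injEq, true_and, false_and] at * <;> omega
  planar := by
    rintro (u | u) (u' | u') (v | v) (v' | v') h1 h2 <;>
      simp only [Setoid.ker_def, Prod.mk.injEq, true_and, Fin.val_rev, reduceCtorEq, false_and] at h1 h2 <;>
      simp only [pos, Fin.val_rev] <;> omega

theorem triv_gen (q : ℂ) {n : ℕ} (i : ℕ) (hi : i + 1 < n) :
    triv q n (diag q (Diagram.gen i hi)) = 0 := by
  have h : Diagram.gen i hi ≠ Diagram.id n := by
    intro h
    have h1 : (Diagram.gen i hi).rel (Sum.inl ⟨i, by omega⟩) (Sum.inl ⟨i + 1, hi⟩) := by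
      change (if i = i ∨ i = i + 1 then n else i) = if i + 1 = i ∨ i + 1 = i + 1 then n else i + 1
      simp
    rw [h] at h1
    have h2 : (⟨i, by omega⟩ : Fin n) = ⟨i + 1, hi⟩ := h1
    simp at h2
  change linExt q _ _ = _
  rw [linExt_diag, if_neg h]

/-! ### Induced modules -/

section Ind

variable {A B V : Type} [Ring A] [Algebra ℂ A] [Ring B] [Algebra ℂ B]
  [AddCommGroup V] [Module ℂ V]

/-- The relations `b f(a) ⊗ v = b ⊗ a v` that define `B ⊗_A V`. -/
def indRel (f : A →ₐ[ℂ] B) (ρ : A →ₐ[ℂ] Module.End ℂ V) : Submodule B (B ⊗[ℂ] V) :=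
  Submodule.span B {x | ∃ (b : B) (a : A) (v : V), x = (b * f a) ⊗ₜ[ℂ] v - b ⊗ₜ[ℂ] (ρ a v)}

/-- The induced `B`-module `B ⊗_A V` of an `A`-module `V` along `f : A → B`. -/
abbrev Ind (f : A →ₐ[ℂ] B) (ρ : A →ₐ[ℂ] Module.End ℂ V) : Type :=
  (B ⊗[ℂ] V) ⧸ indRel f ρ

end Ind

/-- The one-dimensional module `ℂ_triv` of `TL_a ⊗ TL_b`. -/
def trivRep (q : ℂ) (a b : ℕ) : TL q a ⊗[ℂ] TL q b →ₐ[ℂ] Module.End ℂ ℂ :=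
  (Algebra.lmul ℂ ℂ).comp
    (Algebra.TensorProduct.lift (triv q a) (triv q b) fun _ _ => Commute.all _ _)

/-- The induced module of `ℂ_triv` from `TL_a ⊗ TL_b` to `TL_{a+b}`. -/
abbrev IndTriv (q : ℂ) (a b : ℕ) : Type := Ind (tlTensor q a b) (trivRep q a b)

/-- The element `x ⊗ c` of the induced module. -/
def indMk (q : ℂ) (a b : ℕ) (x : TL q (a + b)) (c : ℂ) : IndTriv q a b :=
  Submodule.Quotient.mk (x ⊗ₜ[ℂ] c)

/-- The linear map that sends a diagram `D` to the class of the diagram which is `D` beside `n`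
vertical lines, on top of the diagram with `n` nested links on each line. -/
def bend (q : ℂ) (n : ℕ) : TL q n →ₗ[ℂ] IndTriv q n n :=
  linExt q fun D => indMk q n n (diag q (D.juxta (Diagram.id n)) * diag q (Diagram.nested n)) 1

/-! ### Tensor powers and the spin representation -/

/-- The space `ℂ²`. -/
abbrev V2 : Type := Fin 2 → ℂ

def vPlus : V2 := ![1, 0]
def vMinus : V2 := ![0, 1]

/-- The `n`-th tensor power of `ℂ²`. -/
abbrev TP (n : ℕ) : Type := ⨂[ℂ]^n V2

/-- The standard basis vector labelled by `s`, where `0` stands for `v₊` and `1` for `v₋`. -/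
def stdVec {n : ℕ} (s : Fin n → Fin 2) : TP n :=
  PiTensorProduct.tprod ℂ fun i => if s i = 0 then vPlus else vMinus

/-- The linear form `ε` on `ℂ² ⊗ ℂ²` with `ε(v₊ ⊗ v₋) = -q` and `ε(v₋ ⊗ v₊) = 1`, evaluated on
`v ⊗ w`. -/
def eps (q : ℂ) (v w : V2) : ℂ := -q * (v 0 * w 1) + v 1 * w 0

/-- The matrix entries of `ε` and of `δ(1) = v₊ ⊗ v₋ - q⁻¹ v₋ ⊗ v₊`. -/
def epsCoeff (q : ℂ) (a b : Fin 2) : ℂ :=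
  if a = 0 ∧ b = 1 then -q else if a = 1 ∧ b = 0 then 1 else 0

def deltaCoeff (q : ℂ) (a b : Fin 2) : ℂ :=
  if a = 0 ∧ b = 1 then 1 else if a = 1 ∧ b = 0 then -q⁻¹ else 0

open Classical in
/-- The matrix entry of a diagram: each link of the bottom line contributes `ε`, each link of the
top line `δ`, and each link between the lines the identity of `ℂ²`. -/
def spinCoeff (q : ℂ) {n : ℕ} (D : Diagram n) (s t : Fin n → Fin 2) : ℂ :=
  (∏ i, ∏ j, if i < j ∧ D.rel (Sum.inr i) (Sum.inr j) then epsCoeff q (t i) (t j) else 1) *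
  (∏ i, ∏ j, if i < j ∧ D.rel (Sum.inl i) (Sum.inl j) then deltaCoeff q (s i) (s j) else 1) *
  (∏ i, ∏ j, if D.rel (Sum.inl i) (Sum.inr j) then (if s i = t j then 1 else 0) else 1)

/-- The action of diagrams on the tensor power (bottom to top). -/
def spin (q : ℂ) (n : ℕ) : TL q n →ₗ[ℂ] Module.End ℂ (TP n) :=
  linExt q fun D => (Basis.piTensorProduct fun _ : Fin n => Pi.basisFun ℂ (Fin 2)).constr ℂ
    fun t => ∑ s, spinCoeff q D s t • stdVec s

/-! ### The quantum group -/

/-- `q` is nonzero and not a root of unity. -/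
structure IsGeneric (q : ℂ) : Prop where
  ne_zero : q ≠ 0
  pow_ne_one : ∀ k : ℕ, 0 < k → q ^ k ≠ 1

inductive UqGen : Type
  | E | F | K | Kinv

open UqGen in
/-- The defining relations of `U_q(sl₂)`. -/
inductive UqRel (q : ℂ) : FreeAlgebra ℂ UqGen → FreeAlgebra ℂ UqGen → Prop
  | KKinv : UqRel q (FreeAlgebra.ι ℂ K * FreeAlgebra.ι ℂ Kinv) 1
  | KinvK : UqRel q (FreeAlgebra.ι ℂ Kinv * FreeAlgebra.ι ℂ K) 1
  | KE : UqRel q (FreeAlgebra.ι ℂ K * FreeAlgebra.ι ℂ E)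
      (q ^ 2 • (FreeAlgebra.ι ℂ E * FreeAlgebra.ι ℂ K))
  | KF : UqRel q (FreeAlgebra.ι ℂ K * FreeAlgebra.ι ℂ F)
      ((q ^ 2)⁻¹ • (FreeAlgebra.ι ℂ F * FreeAlgebra.ι ℂ K))
  | EF : UqRel q (FreeAlgebra.ι ℂ E * FreeAlgebra.ι ℂ F - FreeAlgebra.ι ℂ F * FreeAlgebra.ι ℂ E)
      ((q - q⁻¹)⁻¹ • (FreeAlgebra.ι ℂ K - FreeAlgebra.ι ℂ Kinv))

/-- The quantum group `U_q(sl₂)`. -/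
def Uq (q : ℂ) : Type := RingQuot (UqRel q)

namespace Uq

variable {q : ℂ}

instance : Ring (Uq q) := inferInstanceAs (Ring (RingQuot (UqRel q)))
instance : Algebra ℂ (Uq q) := inferInstanceAs (Algebra ℂ (RingQuot (UqRel q)))

/-- The generators of `U_q(sl₂)`. -/
def gen (q : ℂ) (x : UqGen) : Uq q := RingQuot.mkAlgHom ℂ (UqRel q) (FreeAlgebra.ι ℂ x)

def E (q : ℂ) : Uq q := gen q UqGen.E
def F (q : ℂ) : Uq q := gen q UqGen.F
def K (q : ℂ) : Uq q := gen q UqGen.K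
def Kinv (q : ℂ) : Uq q := gen q UqGen.Kinv

theorem K_mul_Kinv : K q * Kinv q = 1 := by
  have h := RingQuot.mkAlgHom_rel ℂ (UqRel.KKinv (q := q))
  rwa [map_mul, map_one] at h

theorem Kinv_mul_K : Kinv q * K q = 1 := by
  have h := RingQuot.mkAlgHom_rel ℂ (UqRel.KinvK (q := q))
  rwa [map_mul, map_one] at h

theorem K_mul_E : K q * E q = q ^ 2 • (E q * K q) := by
  have h := RingQuot.mkAlgHom_rel ℂ (UqRel.KE (q := q))
  rwa [map_mul, map_smul, map_mul] at h

theorem K_mul_F : K q * F q = (q ^ 2)⁻¹ • (F q * K q) := by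
  have h := RingQuot.mkAlgHom_rel ℂ (UqRel.KF (q := q))
  rwa [map_mul, map_smul, map_mul] at h

theorem E_mul_F : E q * F q - F q * E q = (q - q⁻¹)⁻¹ • (K q - Kinv q) := by
  have h := RingQuot.mkAlgHom_rel ℂ (UqRel.EF (q := q))
  rwa [map_sub, map_mul, map_mul, map_smul, map_sub] at h

theorem F_mul_Kinv (hq : IsGeneric q) : Kinv q * F q = q ^ 2 • (F q * Kinv q) := by
  have h2 : q ^ 2 ≠ 0 := pow_ne_zero 2 hq.ne_zero
  have h : F q * Kinv q = (q ^ 2)⁻¹ • (Kinv q * F q) := by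
    calc F q * Kinv q = Kinv q * (K q * F q) * Kinv q := by
          rw [← mul_assoc, Kinv_mul_K, one_mul]
      _ = _ := by
          rw [K_mul_F, mul_smul_comm, smul_mul_assoc, mul_assoc, mul_assoc, K_mul_Kinv, mul_one]
  rw [h, smul_smul, mul_inv_cancel₀ h2, one_smul]

/-- The algebra map out of `U_q(sl₂)` with prescribed values on the generators. -/
def lift {B : Type} [Ring B] [Algebra ℂ B] (e f k k' : B) (h1 : k * k' = 1) (h2 : k' * k = 1)
    (h3 : k * e = q ^ 2 • (e * k)) (h4 : k * f = (q ^ 2)⁻¹ • (f * k))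
    (h5 : e * f - f * e = (q - q⁻¹)⁻¹ • (k - k')) : Uq q →ₐ[ℂ] B :=
  RingQuot.liftAlgHom ℂ ⟨FreeAlgebra.lift ℂ fun x => match x with
    | UqGen.E => e
    | UqGen.F => f
    | UqGen.K => k
    | UqGen.Kinv => k', by
      intro x y h
      cases h <;> simp only [map_mul, map_one, map_smul, map_sub, FreeAlgebra.lift_ι_apply] <;>
        assumption⟩

/-- The comultiplication `Δ(K) = K ⊗ K`, `Δ(E) = E ⊗ 1 + K⁻¹ ⊗ E`, `Δ(F) = F ⊗ K + 1 ⊗ F`. -/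
def comul (hq : IsGeneric q) : Uq q →ₐ[ℂ] Uq q ⊗[ℂ] Uq q :=
  lift (E q ⊗ₜ 1 + Kinv q ⊗ₜ E q) (F q ⊗ₜ K q + 1 ⊗ₜ F q) (K q ⊗ₜ K q) (Kinv q ⊗ₜ Kinv q)
    (by simp [K_mul_Kinv, Algebra.TensorProduct.one_def])
    (by simp [Kinv_mul_K, Algebra.TensorProduct.one_def])
    (by simp [mul_add, add_mul, K_mul_E, K_mul_Kinv, Kinv_mul_K, TensorProduct.smul_tmul'])
    (by simp [mul_add, add_mul, K_mul_F, TensorProduct.smul_tmul'])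
    (by
      have h2 : q ^ 2 ≠ 0 := pow_ne_zero 2 hq.ne_zero
      have h := E_mul_F (q := q)
      have h' : E q * F q = F q * E q + (q - q⁻¹)⁻¹ • (K q - Kinv q) := by rw [← h]; abel
      simp only [mul_add, add_mul, Algebra.TensorProduct.tmul_mul_tmul, one_mul, mul_one,
        F_mul_Kinv hq, K_mul_E, h', TensorProduct.add_tmul, TensorProduct.tmul_add,
        TensorProduct.smul_tmul', TensorProduct.tmul_smul, TensorProduct.sub_tmul,
        TensorProduct.tmul_sub, smul_sub]
      abel)

/-- The counit. -/
def counit (q : ℂ) : Uq q →ₐ[ℂ] ℂ :=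
  lift 0 0 1 1 (by simp) (by simp) (by simp) (by simp) (by simp)

/-- The antipode `S(K) = K⁻¹`, `S(E) = -KE`, `S(F) = -FK⁻¹`, an anti-homomorphism. -/
def antipode (hq : IsGeneric q) : Uq q →ₐ[ℂ] (Uq q)ᵐᵒᵖ :=
  lift (MulOpposite.op (-(K q * E q))) (MulOpposite.op (-(F q * Kinv q)))
    (MulOpposite.op (Kinv q)) (MulOpposite.op (K q))
    (by rw [← MulOpposite.op_mul, K_mul_Kinv, MulOpposite.op_one])
    (by rw [← MulOpposite.op_mul, Kinv_mul_K, MulOpposite.op_one])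
    (by
      rw [← MulOpposite.op_mul, ← MulOpposite.op_mul, ← MulOpposite.op_smul]
      congr 1
      rw [mul_neg, ← mul_assoc, Kinv_mul_K, one_mul, K_mul_E, neg_mul, smul_mul_assoc, mul_assoc,
        K_mul_Kinv, mul_one, smul_neg])
    (by
      have h2 : q ^ 2 ≠ 0 := pow_ne_zero 2 hq.ne_zero
      rw [← MulOpposite.op_mul, ← MulOpposite.op_mul, ← MulOpposite.op_smul]
      congr 1
      rw [mul_neg, ← mul_assoc, F_mul_Kinv hq, smul_mul_assoc, smul_neg, smul_smul,
        inv_mul_cancel₀ h2, one_smul, neg_mul])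
    (by
      have h2 : q ^ 2 ≠ 0 := pow_ne_zero 2 hq.ne_zero
      rw [← MulOpposite.op_mul, ← MulOpposite.op_mul, ← MulOpposite.op_sub,
        ← MulOpposite.op_sub, ← MulOpposite.op_smul]
      congr 1
      have h1 : F q * Kinv q * (K q * E q) = F q * E q := by
        rw [mul_assoc, ← mul_assoc (Kinv q), Kinv_mul_K, one_mul]
      have h3 : K q * E q * (F q * Kinv q) = E q * F q := by
        rw [K_mul_E, smul_mul_assoc, mul_assoc, ← mul_assoc (K q), K_mul_F, smul_mul_assoc,
          mul_smul_comm, smul_smul, mul_inv_cancel₀ h2, one_smul, mul_assoc (F q), K_mul_Kinv,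
          mul_one]
      rw [neg_mul_neg, neg_mul_neg, h1, h3, ← neg_sub (E q * F q), E_mul_F, ← smul_neg, neg_sub])

end Uq

/-- The action of `U_q(sl₂)` on `ℂ²`. -/
def vecRep {q : ℂ} (hq : IsGeneric q) : Uq q →ₐ[ℂ] Module.End ℂ V2 :=
  (Matrix.toLinAlgEquiv' : Matrix (Fin 2) (Fin 2) ℂ ≃ₐ[ℂ] _).toAlgHom.comp
    (Uq.lift !![0, 1; 0, 0] !![0, 0; 1, 0] !![q, 0; 0, q⁻¹] !![q⁻¹, 0; 0, q]
      (by simp [Matrix.one_fin_two, hq.ne_zero])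
      (by simp [Matrix.one_fin_two, hq.ne_zero])
      (by have := hq.ne_zero; simp; field_simp)
      (by have := hq.ne_zero; simp; field_simp)
      (by
        have h0 := hq.ne_zero
        have h1 : q - q⁻¹ ≠ 0 := by
          intro h
          apply hq.pow_ne_one 2 (by norm_num)
          field_simp at h
          linear_combination h
        have h2 : q⁻¹ - q ≠ 0 := fun h => h1 (by linear_combination -h)
        ext i j
        fin_cases i <;> fin_cases j <;> simp [h1]
        rw [← neg_sub q q⁻¹, mul_neg, inv_mul_cancel₀ h1]))

/-- `(ℂ²)^{⊗m} ⊗ ℂ² = (ℂ²)^{⊗(m+1)}`. -/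
def tpSucc (m : ℕ) : TP m ⊗[ℂ] V2 ≃ₗ[ℂ] TP (m + 1) :=
  (TensorProduct.congr (LinearEquiv.refl ℂ (TP m))
    (PiTensorProduct.subsingletonEquiv (R := ℂ) (s := fun _ : Fin 1 => V2) 0).symm).trans
    (TensorPower.mulEquiv (R := ℂ) (M := V2) (n := m) (m := 1))

/-- The action of `U_q(sl₂)` on the tensor powers of `ℂ²` through the comultiplication. -/
def tensorRep {q : ℂ} (hq : IsGeneric q) : (m : ℕ) → Uq q →ₐ[ℂ] Module.End ℂ (TP m)
  | 0 => (Algebra.ofId ℂ _).comp (Uq.counit q)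
  | m + 1 => ((tpSucc m).conjAlgEquiv ℂ).toAlgHom.comp
      ((Module.endTensorEndAlgHom (R := ℂ) (S := ℂ) (A := ℂ)).comp
        ((Algebra.TensorProduct.map (tensorRep hq m) (vecRep hq)).comp (Uq.comul hq)))

/-- The action of `U_q(sl₂)` on `End((ℂ²)^{⊗n})`: `u` sends `T` to the sum of the
`u₁ ∘ T ∘ S(u₂)`, where `Δ(u)` is the sum of the `u₁ ⊗ u₂`. -/
def endAct {q : ℂ} (hq : IsGeneric q) (n : ℕ) :
    Uq q →ₗ[ℂ] Module.End ℂ (Module.End ℂ (TP n)) :=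
  (TensorProduct.lift (LinearMap.mk₂ ℂ
    (fun a b => LinearMap.mulLeft ℂ (tensorRep hq n a) ∘ₗ
      LinearMap.mulRight ℂ (tensorRep hq n (Uq.antipode hq b).unop))
    (fun a a' b => by ext; simp [add_mul]) (fun c a b => by ext; simp)
    (fun a b b' => by ext; simp [mul_add]) (fun c a b => by ext; simp))) ∘ₗ
  (Uq.comul hq).toLinearMap

/-- The endomorphisms of `(ℂ²)^{⊗n}` that commute with `U_q(sl₂)`. -/
def endU {q : ℂ} (hq : IsGeneric q) (n : ℕ) : Submodule ℂ (Module.End ℂ (TP n)) where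
  carrier := {T | ∀ u, T * tensorRep hq n u = tensorRep hq n u * T}
  add_mem' := fun h1 h2 u => by rw [add_mul, mul_add, h1 u, h2 u]
  zero_mem' := fun u => by rw [zero_mul, mul_zero]
  smul_mem' := fun c T h u => by rw [smul_mul_assoc, mul_smul_comm, h u]

/-- The invariants of `U_q(sl₂)` in `(ℂ²)^{⊗m}`. -/
def invariants {q : ℂ} (hq : IsGeneric q) (m : ℕ) : Submodule ℂ (TP m) where
  carrier := {x | ∀ u, tensorRep hq m u x = Uq.counit q u • x}
  add_mem' := fun h1 h2 u => by rw [map_add, smul_add, h1 u, h2 u]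
  zero_mem' := fun u => by rw [map_zero, smul_zero]
  smul_mem' := fun c x h u => by rw [map_smul, h u, smul_comm]

/-! ### The isomorphism `End((ℂ²)^{⊗n}) ≅ (ℂ²)^{⊗2n}` -/

/-- `w ⊗ α ↦ (v ↦ α(v) w)`. -/
def phi1 (n : ℕ) : TP n ⊗[ℂ] Module.Dual ℂ (TP n) ≃ₗ[ℂ] Module.End ℂ (TP n) :=
  (TensorProduct.comm ℂ _ _).trans (dualTensorHomEquiv ℂ (TP n) (TP n))

/-- `α₁ ⊗ ⋯ ⊗ αₙ ↦ (v₁ ⊗ ⋯ ⊗ vₙ ↦ α₁(vₙ) ⋯ αₙ(v₁))`. -/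
def phi2 (n : ℕ) : (⨂[ℂ]^n (Module.Dual ℂ V2)) ≃ₗ[ℂ] Module.Dual ℂ (TP n) :=
  (PiTensorProduct.reindex ℂ (fun _ : Fin n => Module.Dual ℂ V2) Fin.revPerm).trans
    PiTensorProduct.dualDistribEquiv

/-- `v⁺ ↦ v₋`, `v⁻ ↦ -q⁻¹ v₊`, where `v⁺, v⁻` is the dual basis. -/
def phi3 {q : ℂ} (hq : IsGeneric q) : Module.Dual ℂ V2 ≃ₗ[ℂ] V2 where
  toFun α := α vPlus • vMinus + α vMinus • (-q⁻¹ • vPlus)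
  map_add' α β := by simp [add_smul]; abel
  map_smul' c α := by simp [mul_smul]
  invFun w := w 1 • LinearMap.proj 0 + (-q * w 0) • LinearMap.proj 1
  left_inv α := by
    have h0 := hq.ne_zero
    refine (Pi.basisFun ℂ (Fin 2)).ext fun i => ?_
    have e0 : (Pi.single 0 1 : V2) = vPlus := by ext i; fin_cases i <;> simp [vPlus]
    have e1 : (Pi.single 1 1 : V2) = vMinus := by ext i; fin_cases i <;> simp [vMinus]
    fin_cases i
    · simp [e0]
      simp [vPlus, vMinus]
    · simp [e1]
      simp [vPlus, vMinus]
      field_simp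
  right_inv w := by
    have h0 := hq.ne_zero
    ext i
    fin_cases i
    · simp [vPlus, vMinus]
      field_simp
    · simp [vPlus, vMinus]

/-- The composite `End((ℂ²)^{⊗n}) → (ℂ²)^{⊗n} ⊗ ((ℂ²)^{⊗n})* → (ℂ²)^{⊗n} ⊗ ((ℂ²)*)^{⊗n} →
(ℂ²)^{⊗2n}`. -/
def phi {q : ℂ} (hq : IsGeneric q) (n : ℕ) : Module.End ℂ (TP n) ≃ₗ[ℂ] TP (n + n) :=
  (phi1 n).symm.trans <|
    (TensorProduct.congr (LinearEquiv.refl ℂ (TP n)) (phi2 n).symm).trans <|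
      (TensorProduct.congr (LinearEquiv.refl ℂ (TP n))
        (PiTensorProduct.congr fun _ => phi3 hq)).trans <|
        TensorPower.mulEquiv (R := ℂ) (M := V2)

end TLDiag

end

open TLDiag

open scoped TensorProduct

noncomputable section

namespace TLDiag

/-- The matrices of a cap and a cup that satisfy the zigzag identities, with value `β` of a
closed loop. -/
structure Duality (δ ε : Fin 2 → Fin 2 → ℂ) (β : ℂ) : Prop where
  ne_zero : β ≠ 0
  eps_delta : ∀ a c, ∑ b, ε a b * δ b c = if a = c then 1 else 0
  delta_eps : ∀ a c, ∑ b, δ a b * ε b c = if a = c then 1 else 0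
  loop : ∑ a, ∑ b, ε a b * δ a b = β

/-- The weight of a colouring of the points on a line: each arc of the matching `f` contributes
`δ`, evaluated at its end points from left to right. -/
def lineWeight (δ : Fin 2 → Fin 2 → ℂ) {X : Type*} [Fintype X] (p : X → ℕ) (f : X → X)
    (c : X → Fin 2) : ℂ :=
  ∏ u, if p u < p (f u) then δ (c u) (c (f u)) else 1

section Contract

variable {δ ε : Fin 2 → Fin 2 → ℂ} {β : ℂ} {X : Type*} [Fintype X] [DecidableEq X] {p : X → ℕ}

set_option maxHeartbeats 1000000 in
theorem lineWeight_reconnect (hd : Duality δ ε β) (hp : Function.Injective p) {f : X → X}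
    (hf : NC p f) {x y : X} (hxy : p x < p y)
    (hin : ∀ z, p x < p z → p z < p y → p x < p (f z) ∧ p (f z) < p y) (hne : f x ≠ y)
    (c : X → Fin 2) :
    β * ∑ a, ∑ b, ε a b * lineWeight δ p f (Function.update (Function.update c x a) y b) =
      ∑ a, ∑ b, ε a b *
        lineWeight δ p (reconnect f x y) (Function.update (Function.update c x a) y b) := by
  obtain ⟨h1, h2, h3⟩ := hf
  have hyx : y ≠ x := fun h => by simp [h] at hxy
  have inj : ∀ a b, f a = f b → a = b := fun a b h => by rw [← h1 a, h, h1]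
  set s := f x with hs
  set t := f y with ht
  have hsx : s ≠ x := h2 x
  have hty : t ≠ y := h2 y
  have hst : s ≠ t := fun h => hyx (inj _ _ h).symm
  have htx : t ≠ x := fun h => hne (by rw [hs, ← h, ht, h1])
  have fs : f s = x := h1 x
  have ft : f t = y := h1 y
  have Gx : reconnect f x y x = y := by unfold reconnect; grind
  have Gy : reconnect f x y y = x := by unfold reconnect; grind
  have Gs : reconnect f x y s = t := by unfold reconnect; grind
  have Gt : reconnect f x y t = s := by unfold reconnect; grind
  have G : ∀ w, w ≠ x → w ≠ y → w ≠ s → w ≠ t → reconnect f x y w = f w := by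
    unfold reconnect; grind
  let T : Finset X := {x, y, s, t}
  let R : ℂ := ∏ u ∈ Tᶜ, if p u < p (f u) then δ (c u) (c (f u)) else 1
  let A : (X → X) → (X → Fin 2) → X → ℂ :=
    fun g c u => if p u < p (g u) then δ (c u) (c (g u)) else 1
  have hA : ∀ (g : X → X) (a b : Fin 2), (∀ u ∈ Tᶜ, g u = f u) →
      lineWeight δ p g (Function.update (Function.update c x a) y b) =
      (A g (Function.update (Function.update c x a) y b) x *
        (A g (Function.update (Function.update c x a) y b) y *
        (A g (Function.update (Function.update c x a) y b) s *
          A g (Function.update (Function.update c x a) y b) t))) * R := by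
    intro g a b hg
    rw [lineWeight, ← Finset.prod_mul_prod_compl T]
    congr 1
    · rw [Finset.prod_insert, Finset.prod_insert, Finset.prod_insert, Finset.prod_singleton]
      · simpa using hst
      · simp only [Finset.mem_insert, Finset.mem_singleton]; tauto
      · simp only [Finset.mem_insert, Finset.mem_singleton]; tauto
    · refine Finset.prod_congr rfl fun u hu => ?_
      rw [hg u hu]
      simp only [T, Finset.mem_compl, Finset.mem_insert, Finset.mem_singleton, not_or] at hu
      have e1 : f u ≠ x := fun h => hu.2.2.1 (by rw [hs, ← h, h1])
      have e2 : f u ≠ y := fun h => hu.2.2.2 (by rw [ht, ← h, h1])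
      simp [Function.update_of_ne, hu.1, hu.2.1, e1, e2]
  have hf' : ∀ u ∈ Tᶜ, f u = f u := fun _ _ => rfl
  have hg' : ∀ u ∈ Tᶜ, reconnect f x y u = f u := by
    intro u hu
    simp only [T, Finset.mem_compl, Finset.mem_insert, Finset.mem_singleton, not_or] at hu
    exact G u hu.1 hu.2.1 hu.2.2.1 hu.2.2.2
  simp only [hA f _ _ hf', hA _ _ _ hg', A, Gx, Gy, Gs, Gt, ← hs, ← ht, fs, ft]
  simp only [Function.update_self, Function.update_of_ne hyx.symm, Function.update_of_ne hne,
    Function.update_of_ne hty, Function.update_of_ne htx, Function.update_of_ne hsx]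
  simp only [if_pos hxy, if_neg hxy.not_gt]
  have n1 : ∀ a b, a ≠ b → p a ≠ p b := fun a b h h' => h (hp h')
  have m1 := n1 _ _ hsx
  have m2 := n1 _ _ hty
  have m3 := n1 _ _ hst
  have m4 := n1 _ _ htx
  have m5 := n1 _ _ hne
  have k1 := hin s
  have k2 := hin t
  rw [fs] at k1
  rw [ft] at k2
  have a1 : p s < p x ∨ p y < p s := by omega
  have a2 : p t < p x ∨ p y < p t := by omega
  clear k1 k2
  have cases : (p s < p x ∧ p y < p t) ∨ (p t < p s ∧ p s < p x) ∨ (p y < p t ∧ p t < p s) := by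
    rcases a1 with a1 | a1 <;> rcases a2 with a2 | a2
    · have := h3 s t
      rw [fs, ft] at this
      omega
    · exact Or.inl ⟨a1, a2⟩
    · have := h3 t x
      rw [← hs, ft] at this
      omega
    · have := h3 x y
      rw [← hs, ← ht] at this
      omega
  have e1 := hd.eps_delta
  have e2 := hd.delta_eps
  have e3 := hd.loop
  have i1 : ∀ a c, ε a 0 * δ 0 c + ε a 1 * δ 1 c = if a = c then 1 else 0 := fun a c => by
    rw [← e1, Fin.sum_univ_two]
  have i2 : ∀ a c, δ a 0 * ε 0 c + δ a 1 * ε 1 c = if a = c then 1 else 0 := fun a c => by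
    rw [← e2, Fin.sum_univ_two]
  have lhs : ∀ W : ℂ, (∑ a, ∑ b, ε a b * ((δ a b * W) * R)) = β * (W * R) := by
    intro W
    rw [← e3, Finset.sum_mul]
    refine Finset.sum_congr rfl fun a _ => ?_
    rw [Finset.sum_mul]
    exact Finset.sum_congr rfl fun b _ => by ring
  simp only [one_mul]
  rw [lhs]
  congr 1
  generalize c s = cs
  generalize c t = ct
  rcases cases with ⟨q1, q2⟩ | ⟨q1, q2⟩ | ⟨q1, q2⟩
  · have r1 : ¬ p x < p s := by omega
    have r2 : ¬ p t < p y := by omega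
    have r3 : p s < p t := by omega
    have r4 : ¬ p t < p s := by omega
    simp only [q1, q2, r1, r2, r3, r4, if_true, if_false, one_mul, mul_one]
    simp only [Fin.sum_univ_two]
    have j0 := i2 cs 0
    have j1 := i2 cs 1
    have : (if cs = 0 then 1 else 0) * δ 0 ct + (if cs = 1 then 1 else 0) * δ 1 ct = δ cs ct := by
      fin_cases cs <;> simp
    rw [← this, ← j0, ← j1]; ring
  · have r1 : ¬ p x < p s := by omega
    have r2 : ¬ p y < p t := by omega
    have r3 : p t < p y := by omega
    have r4 : ¬ p s < p t := by omega
    simp only [q1, q2, r1, r2, r3, r4, if_true, if_false, one_mul]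
    simp only [Fin.sum_univ_two]
    have j0 := i2 cs 0
    have j1 := i2 cs 1
    have : (if cs = 0 then 1 else 0) * δ ct 0 + (if cs = 1 then 1 else 0) * δ ct 1 = δ ct cs := by
      fin_cases cs <;> simp
    rw [← this, ← j0, ← j1]; ring
  · have r1 : p x < p s := by omega
    have r2 : ¬ p s < p x := by omega
    have r3 : ¬ p t < p y := by omega
    have r4 : ¬ p s < p t := by omega
    simp only [q1, q2, r1, r2, r3, r4, if_true, if_false, one_mul]
    simp only [Fin.sum_univ_two]
    have j0 := i1 0 ct
    have j1 := i1 1 ct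
    have : (if 0 = ct then 1 else 0) * δ 0 cs + (if 1 = ct then 1 else 0) * δ 1 cs = δ ct cs := by
      fin_cases ct <;> simp
    rw [← this, ← j0, ← j1]; ring

theorem sum_sum_update {ι κ : Type*} [Fintype ι] [DecidableEq ι] [Fintype κ] [DecidableEq κ]
    (k : ι) (G : (ι → κ) → ℂ) :
    ∑ b, ∑ a, G (Function.update b k a) = Fintype.card κ * ∑ b, G b := by
  let e : (ι → κ) × κ ≃ (ι → κ) × κ := Function.Involutive.toPerm
    (fun z => (Function.update z.1 k z.2, z.1 k)) (fun z => by simp)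
  have h := e.sum_comp fun z => G z.1
  rw [Fintype.sum_prod_type, Fintype.sum_prod_type] at h
  simp only [Finset.sum_const, Finset.card_univ, nsmul_eq_mul, ← Finset.mul_sum] at h
  exact h

theorem sum_eq_of_sum_update_eq {n : ℕ} (k : Fin n)
    {A B : (Fin n → Fin 2) → (Fin n → Fin 2) → ℂ}
    (h : ∀ b t, ∑ a, ∑ a', A (Function.update b k a) (Function.update t k a') =
      ∑ a, ∑ a', B (Function.update b k a) (Function.update t k a')) :
    ∑ b, ∑ t, A b t = ∑ b, ∑ t, B b t := by
  have key : ∀ A : (Fin n → Fin 2) → (Fin n → Fin 2) → ℂ, ∑ b, ∑ t, ∑ a, ∑ a',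
      A (Function.update b k a) (Function.update t k a') = 2 * (2 * ∑ b, ∑ t, A b t) := by
    intro A
    have h1 : ∀ b, ∑ t, ∑ a, ∑ a', A (Function.update b k a) (Function.update t k a') =
        ∑ a, 2 * ∑ t, A (Function.update b k a) t := by
      intro b
      rw [Finset.sum_comm]
      refine Finset.sum_congr rfl fun a _ => ?_
      have := sum_sum_update k (A (Function.update b k a))
      simpa using this
    simp only [h1]
    have := sum_sum_update k (fun b => 2 * ∑ t, A b t)
    simp only [Fintype.card_fin, Nat.cast_ofNat] at this
    rw [this, ← Finset.mul_sum]
  have h2 := key A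
  simp only [h] at h2
  rw [key B] at h2
  linear_combination -(1 / 4 : ℂ) * h2

end Contract

/-- The matrix entry of a diagram for a general cup `δ` and cap `ε`. -/
def diagramCoeff (δ ε : Fin 2 → Fin 2 → ℂ) {n : ℕ} (D : Diagram n) (s t : Fin n → Fin 2) : ℂ :=
  open Classical in
  (∏ i, ∏ j, if i < j ∧ D.rel (Sum.inr i) (Sum.inr j) then ε (t i) (t j) else 1) *
  (∏ i, ∏ j, if i < j ∧ D.rel (Sum.inl i) (Sum.inl j) then δ (s i) (s j) else 1) *
  (∏ i, ∏ j, if D.rel (Sum.inl i) (Sum.inr j) then (if s i = t j then 1 else 0) else 1)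

section Arcs

variable {X : Type*} {p : X → ℕ} {f : X → X}

theorem NC.lt_iff (hp : Function.Injective p) (hf : NC p f) (u : X) :
    p (f u) < p (f (f u)) ↔ ¬ p u < p (f u) := by
  rw [hf.1]
  have : p (f u) ≠ p u := fun h => hf.2.1 u (hp h)
  omega

theorem prod_eq_prod_arcs [Fintype X] (hp : Function.Injective p) (hf : NC p f) (h : X → ℂ) :
    ∏ u, h u = ∏ u, if p u < p (f u) then h u * h (f u) else 1 := by
  let e : X ≃ X := Function.Involutive.toPerm f hf.1
  have h1 : ∏ u, (if p u < p (f u) then h (f u) else 1) =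
      ∏ u, (if p u < p (f u) then 1 else h u) := by
    rw [← e.prod_comp]
    refine Finset.prod_congr rfl fun u _ => ?_
    change (if p (f u) < p (f (f u)) then h (f (f u)) else 1) = _
    rw [if_congr (hf.lt_iff hp u) rfl rfl, hf.1, ite_not]
  have h2 : ∀ u, (if p u < p (f u) then h u * h (f u) else 1) =
      (if p u < p (f u) then h u else 1) * (if p u < p (f u) then h (f u) else 1) := by
    intro u; split_ifs <;> simp
  simp only [h2]
  rw [Finset.prod_mul_distrib, h1, ← Finset.prod_mul_distrib]
  refine Finset.prod_congr rfl fun u _ => ?_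
  split_ifs <;> simp

/-- A colouring of the points is a choice of two colours for each arc. -/
def colouringEquiv (hp : Function.Injective p) (hf : NC p f) :
    (X → Fin 2) ≃ ({u // p u < p (f u)} → Fin 2 × Fin 2) where
  toFun c u := (c u, c (f u))
  invFun h u := if hu : p u < p (f u) then (h ⟨u, hu⟩).1 else
    (h ⟨f u, (hf.lt_iff hp u).2 hu⟩).2
  left_inv c := by
    funext u
    simp only [hf.1]
    split_ifs <;> rfl
  right_inv h := by
    funext ⟨u, hu⟩
    have h1 : ¬ p (f u) < p (f (f u)) := by rw [hf.lt_iff hp]; simpa using hu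
    simp only [hu, dif_pos, h1, dif_neg, not_false_eq_true]
    ext
    · rfl
    · simp only [hf.1]

theorem sum_prod_arcs [Fintype X] [DecidableEq X] (hp : Function.Injective p) (hf : NC p f)
    (F : X → Fin 2 → Fin 2 → ℂ) :
    ∑ c : X → Fin 2, ∏ u, (if p u < p (f u) then F u (c u) (c (f u)) else 1) =
      ∏ u, if p u < p (f u) then ∑ a, ∑ b, F u a b else 1 := by
  have h1 : ∀ G : X → ℂ, ∏ u, (if p u < p (f u) then G u else 1) =
      ∏ u : {u // p u < p (f u)}, G u := by
    intro G
    rw [← Finset.prod_filter]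
    exact Finset.prod_subtype _ (by simp) _
  simp only [h1]
  rw [← (colouringEquiv hp hf).symm.sum_comp]
  simp only [← Fintype.sum_prod_type', Finset.prod_univ_sum]
  rw [Fintype.piFinset_univ]
  refine Finset.sum_congr rfl fun h _ => Finset.prod_congr rfl fun u _ => ?_
  have h2 := congrFun ((colouringEquiv hp hf).apply_symm_apply h) u
  rw [← h2]
  rfl

end Arcs

section Coeff

variable {δ ε : Fin 2 → Fin 2 → ℂ} {β : ℂ} {n : ℕ}

/-- The contribution of a link to the matrix entry. -/
def linkCoeff (δ ε : Fin 2 → Fin 2 → ℂ) : Vert n → Vert n → Fin 2 → Fin 2 → ℂ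
  | Sum.inl _, Sum.inl _, a, b => δ a b
  | Sum.inl _, Sum.inr _, a, b => if a = b then 1 else 0
  | Sum.inr _, Sum.inl _, _, _ => 1
  | Sum.inr _, Sum.inr _, a, b => ε b a

theorem diagramCoeff_eq_prod (D : Diagram n) (s t : Fin n → Fin 2) :
    diagramCoeff δ ε D s t = ∏ u, if pos u < pos (D.link u) then
      linkCoeff δ ε u (D.link u) (Sum.elim s t u) (Sum.elim s t (D.link u)) else 1 := by
  classical
  have h : ∀ u : Vert n, (if pos u < pos (D.link u) then
      linkCoeff δ ε u (D.link u) (Sum.elim s t u) (Sum.elim s t (D.link u)) else 1) =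
      ∏ v, if pos u < pos v ∧ D.rel u v then
        linkCoeff δ ε u v (Sum.elim s t u) (Sum.elim s t v) else 1 := by
    intro u
    rw [Finset.prod_eq_single (D.link u)]
    · simp [D.rel_link]
    · intro v _ hv
      rw [if_neg]
      rintro ⟨h1, h2⟩
      rcases (D.rel_iff u v).1 h2 with rfl | h3
      · omega
      · exact hv h3
    · simp
  simp only [h, Fintype.prod_sum_type, Finset.prod_mul_distrib]
  have e1 : ∀ i j : Fin n, pos (Sum.inl i) < pos (Sum.inl j) ↔ i < j := fun i j => Iff.rfl
  have e2 : ∀ i j : Fin n, pos (Sum.inr i) < pos (Sum.inr j) ↔ j < i := fun i j => by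
    simp only [pos, Fin.val_rev, Fin.lt_def]; omega
  have e3 : ∀ i j : Fin n, pos (Sum.inl i) < pos (Sum.inr j) := fun i j => by
    simp only [pos]; omega
  have e4 : ∀ i j : Fin n, ¬ pos (Sum.inr i) < pos (Sum.inl j) := fun i j => by
    simp only [pos]; omega
  simp only [e1, e2, e3, e4, linkCoeff, true_and, false_and, if_false, Finset.prod_const_one,
    Sum.elim_inl, Sum.elim_inr, diagramCoeff]
  rw [Finset.prod_comm (f := fun i j : Fin n =>
    if j < i ∧ D.rel (Sum.inr i) (Sum.inr j) then ε (t j) (t i) else 1)]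
  have e5 : ∀ i j : Fin n, D.rel (Sum.inr i) (Sum.inr j) ↔ D.rel (Sum.inr j) (Sum.inr i) :=
    fun i j => ⟨D.rel.symm', D.rel.symm'⟩
  simp only [fun i j => propext (e5 i j)]
  ring_nf
  congr!

/-- Lowering the bottom vertices. -/
theorem diagramCoeff_eq_sum (hd : Duality δ ε β) (D : Diagram n) (s t : Fin n → Fin 2) :
    diagramCoeff δ ε D s t =
      ∑ b : Fin n → Fin 2, lineWeight δ pos D.link (Sum.elim s b) * ∏ j, ε (b j) (t j) := by
  classical
  let lw : Vert n → Fin 2 → Fin 2 → ℂ := fun u a b => match u with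
    | Sum.inl _ => if a = b then 1 else 0
    | Sum.inr _ => ε a b
  have h1 : ∑ c : Vert n → Fin 2, lineWeight δ pos D.link c * ∏ u, lw u (c u) (Sum.elim s t u) =
      ∑ b : Fin n → Fin 2, lineWeight δ pos D.link (Sum.elim s b) * ∏ j, ε (b j) (t j) := by
    rw [← (Equiv.sumArrowEquivProdArrow (Fin n) (Fin n) (Fin 2)).symm.sum_comp,
      Fintype.sum_prod_type, Finset.sum_eq_single s]
    · refine Finset.sum_congr rfl fun b _ => ?_
      simp [Fintype.prod_sum_type, lw, Equiv.sumArrowEquivProdArrow]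
    · intro s' _ hs
      refine Finset.sum_eq_zero fun b _ => ?_
      obtain ⟨i, hi⟩ := Function.ne_iff.1 hs
      rw [Finset.prod_eq_zero (Finset.mem_univ (Sum.inl i)), mul_zero]
      simp [lw, Equiv.sumArrowEquivProdArrow, hi]
    · simp
  rw [← h1, diagramCoeff_eq_prod]
  have h2 : ∀ c : Vert n → Fin 2, lineWeight δ pos D.link c * ∏ u, lw u (c u) (Sum.elim s t u) =
      ∏ u, if pos u < pos (D.link u) then δ (c u) (c (D.link u)) *
        (lw u (c u) (Sum.elim s t u) * lw (D.link u) (c (D.link u)) (Sum.elim s t (D.link u)))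
        else 1 := by
    intro c
    rw [prod_eq_prod_arcs pos_inj D.nc, lineWeight, ← Finset.prod_mul_distrib]
    refine Finset.prod_congr rfl fun u _ => ?_
    split_ifs <;> simp
  simp only [h2]
  rw [sum_prod_arcs pos_inj D.nc (fun u a b => δ a b *
    (lw u a (Sum.elim s t u) * lw (D.link u) b (Sum.elim s t (D.link u))))]
  refine Finset.prod_congr rfl fun u _ => ?_
  refine if_ctx_congr Iff.rfl (fun hu => ?_) fun _ => rfl
  generalize Sum.elim s t u = a at *
  generalize D.link u = v at *
  generalize Sum.elim s t v = b at *
  rcases u with i | i <;> rcases v with j | j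
  · simp [lw, linkCoeff]
  · simp only [lw, linkCoeff]
    rw [← hd.delta_eps]
    simp
  · exfalso
    simp only [pos] at hu
    omega
  · simp only [lw, linkCoeff]
    have : ∀ x, ∑ y, δ x y * (ε x a * ε y b) = if x = b then ε x a else 0 := by
      intro x
      have := hd.delta_eps x b
      calc _ = ε x a * ∑ y, δ x y * ε y b := by
            rw [Finset.mul_sum]; exact Finset.sum_congr rfl fun y _ => by ring
        _ = _ := by rw [this]; split_ifs <;> simp
    simp [this]

theorem diagramCoeff_delta_eq_colour (D : Diagram n) (s t : Fin n → Fin 2) :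
    diagramCoeff (fun a b => if a = b then 1 else 0) (fun a b => if a = b then 1 else 0) D s t =
      (colour D.rel s t : ℂ) := by
  classical
  rw [diagramCoeff_eq_prod, colour]
  have h : ∀ u : Vert n, (if pos u < pos (D.link u) then
      linkCoeff (fun a b => if a = b then 1 else 0) (fun a b => if a = b then 1 else 0) u
        (D.link u) (Sum.elim s t u) (Sum.elim s t (D.link u)) else (1 : ℂ)) =
      if pos u < pos (D.link u) → Sum.elim s t u = Sum.elim s t (D.link u) then 1 else 0 := by
    intro u
    by_cases hu : pos u < pos (D.link u)
    · simp only [hu, if_true, true_imp_iff]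
      generalize Sum.elim s t u = a at *
      generalize D.link u = v at *
      generalize Sum.elim s t v = b at *
      rcases u with i | i <;> rcases v with j | j
      · rfl
      · rfl
      · exfalso
        simp only [pos] at hu
        omega
      · simp only [linkCoeff, eq_comm]
    · simp [hu]
  simp only [h]
  rw [Finset.prod_ite_zero, Finset.prod_const_one]
  have key : (∀ u ∈ Finset.univ, pos u < pos (D.link u) →
      Sum.elim s t u = Sum.elim s t (D.link u)) ↔
      ∀ u v, D.rel u v → Sum.elim s t u = Sum.elim s t v := by
    refine ⟨fun h u v huv => ?_, fun h u _ _ => h _ _ (D.rel_link u)⟩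
    rcases (D.rel_iff u v).1 huv with rfl | rfl
    · rfl
    · by_cases hu : pos u < pos (D.link u)
      · exact h u (Finset.mem_univ _) hu
      · have h2 := h (D.link u) (Finset.mem_univ _) ((D.nc.lt_iff pos_inj u).2 hu)
        rw [D.link_link] at h2
        exact h2.symm
  by_cases hc : ∀ u v, D.rel u v → Sum.elim s t u = Sum.elim s t v
  · rw [if_pos (key.2 hc), if_pos hc, Nat.cast_one]
  · rw [if_neg (fun h => hc (key.1 h)), if_neg hc, Nat.cast_zero]

end Coeff

/-- The diagram with a given non-crossing partner map. -/
def Diagram.ofLink {n : ℕ} (l : Vert n → Vert n) (hl : NC pos l) : Diagram n where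
  rel :=
    { r := fun u v => v = u ∨ v = l u
      iseqv :=
        { refl := fun _ => Or.inl rfl
          symm := by
            rintro u v (rfl | rfl)
            · exact Or.inl rfl
            · exact Or.inr (hl.1 u).symm
          trans := by
            rintro u v w (rfl | rfl) (rfl | rfl)
            · exact Or.inl rfl
            · exact Or.inr rfl
            · exact Or.inr rfl
            · exact Or.inl (hl.1 u) } }
  pair u := ⟨l u, ⟨hl.2.1 u, Or.inr rfl⟩, fun _ hv => hv.2.resolve_left hv.1⟩
  planar u u' v v' hu hv := by
    rintro ⟨h1, h2, h3⟩
    rcases hu with rfl | rfl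
    · omega
    rcases hv with rfl | rfl
    · omega
    exact hl.2.2 u v ⟨h1, h2, h3⟩

theorem Diagram.link_eq_of_rel {n : ℕ} (D : Diagram n) {u v : Vert n} (hne : v ≠ u)
    (h : D.rel u v) : D.link u = v :=
  (((D.rel_iff u v).1 h).resolve_left hne).symm

theorem Diagram.link_ofLink {n : ℕ} (l : Vert n → Vert n) (hl : NC pos l) :
    (Diagram.ofLink l hl).link = l :=
  funext fun u => Diagram.link_eq_of_rel _ (hl.2.1 u) (Or.inr rfl)

section Stack

variable {δ ε : Fin 2 → Fin 2 → ℂ} {β : ℂ} {n : ℕ}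

/-- A colouring of the vertices of two diagrams. -/
def stackColour (s b t u : Fin n → Fin 2) : Vert n ⊕ Vert n → Fin 2 :=
  Sum.elim (Sum.elim s b) (Sum.elim t u)

/-- The contraction of the middle lines of a matching of the vertices of two diagrams. -/
def contraction (δ ε : Fin 2 → Fin 2 → ℂ) (g : Vert n ⊕ Vert n → Vert n ⊕ Vert n)
    (s u : Fin n → Fin 2) : ℂ :=
  ∑ b, ∑ t, (∏ i, ε (b i) (t i)) * lineWeight δ dpos g (stackColour s b t u)

theorem contraction_reconnect (hd : Duality δ ε β) {g : Vert n ⊕ Vert n → Vert n ⊕ Vert n}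
    (hg : NC dpos g) (k : Fin n)
    (hin : ∀ z : Vert n ⊕ Vert n, dpos (Sum.inl (Sum.inr k) : Vert n ⊕ Vert n) < dpos z →
      dpos z < dpos (Sum.inr (Sum.inl k) : Vert n ⊕ Vert n) →
      dpos (Sum.inl (Sum.inr k) : Vert n ⊕ Vert n) < dpos (g z) ∧
        dpos (g z) < dpos (Sum.inr (Sum.inl k) : Vert n ⊕ Vert n))
    (hne : g (Sum.inl (Sum.inr k)) ≠ Sum.inr (Sum.inl k)) (s u : Fin n → Fin 2) :
    β * contraction δ ε g s u =
      contraction δ ε (reconnect g (Sum.inl (Sum.inr k)) (Sum.inr (Sum.inl k))) s u := by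
  simp only [contraction, Finset.mul_sum]
  refine sum_eq_of_sum_update_eq k fun b t => ?_
  have h := lineWeight_reconnect hd dpos_inj hg
    (x := Sum.inl (Sum.inr k)) (y := Sum.inr (Sum.inl k))
    (by simp only [dpos, pos, Fin.val_rev]; omega) hin hne (stackColour s b t u)
  have h1 : ∀ a a', stackColour s (Function.update b k a) (Function.update t k a') u =
      Function.update (Function.update (stackColour s b t u) (Sum.inl (Sum.inr k)) a)
        (Sum.inr (Sum.inl k)) a' := by
    intro a a'
    funext z
    rcases z with (z | z) | (z | z)
    · rw [Function.update_of_ne (by simp), Function.update_of_ne (by simp)]; rfl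
    · rw [Function.update_of_ne (by simp)]
      by_cases hz : z = k
      · subst hz
        rw [Function.update_self]
        exact Function.update_self ..
      · rw [Function.update_of_ne (by simpa using hz)]
        exact Function.update_of_ne hz _ _
    · by_cases hz : z = k
      · subst hz
        rw [Function.update_self]
        exact Function.update_self ..
      · rw [Function.update_of_ne (by simpa using hz), Function.update_of_ne (by simp)]
        exact Function.update_of_ne hz _ _
    · rw [Function.update_of_ne (by simp), Function.update_of_ne (by simp)]; rfl
  have h2 : ∀ a a', (∏ i, ε (Function.update b k a i) (Function.update t k a' i)) =
      ε a a' * ∏ i ∈ Finset.univ.erase k, ε (b i) (t i) := by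
    intro a a'
    rw [← Finset.mul_prod_erase _ _ (Finset.mem_univ k)]
    congr 1
    · simp
    · refine Finset.prod_congr rfl fun i hi => ?_
      simp [Finset.ne_of_mem_erase hi]
  simp only [h1, h2]
  have h3 : ∀ G : Fin 2 → Fin 2 → ℂ, ∑ a, ∑ a',
      (ε a a' * ∏ i ∈ Finset.univ.erase k, ε (b i) (t i)) * G a a' =
      (∏ i ∈ Finset.univ.erase k, ε (b i) (t i)) * ∑ a, ∑ a', ε a a' * G a a' := by
    intro G
    rw [Finset.mul_sum]
    refine Finset.sum_congr rfl fun a _ => ?_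
    rw [Finset.mul_sum]
    exact Finset.sum_congr rfl fun a' _ => by ring
  rw [h3, ← h, ← mul_left_comm, ← h3, Finset.mul_sum]
  exact Finset.sum_congr rfl fun a _ => by rw [Finset.mul_sum]

theorem exists_contracted {f : Vert n ⊕ Vert n → Vert n ⊕ Vert n} (hf : NC dpos f) (k : ℕ)
    (hk : k ≤ n) :
    ∃ g : Vert n ⊕ Vert n → Vert n ⊕ Vert n, NC dpos g ∧
      (∀ i : Fin n, i.val < k → g (Sum.inl (Sum.inr i)) = Sum.inr (Sum.inl i)) ∧
      ∃ e : ℕ, ∀ δ ε β, Duality δ ε β → ∀ s u,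
        β ^ k * contraction δ ε f s u = β ^ e * contraction δ ε g s u := by
  induction k with
  | zero => exact ⟨f, hf, by simp, 0, fun _ _ _ _ _ _ => rfl⟩
  | succ k ih =>
    obtain ⟨g, hg, hgx, e, he⟩ := ih (by omega)
    let κ : Fin n := ⟨k, hk⟩
    by_cases hne : g (Sum.inl (Sum.inr κ)) = Sum.inr (Sum.inl κ)
    · refine ⟨g, hg, fun i hi => ?_, e + 1, fun δ ε β hd s u => ?_⟩
      · rcases Nat.lt_succ_iff_lt_or_eq.1 hi with h | h
        · exact hgx i h
        · rwa [show i = κ from Fin.ext h]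
      · rw [pow_succ', pow_succ', mul_assoc, he δ ε β hd, mul_assoc]
    · have hgy : ∀ i : Fin n, i.val < k → g (Sum.inr (Sum.inl i)) = Sum.inl (Sum.inr i) :=
        fun i hi => by rw [← hgx i hi, hg.1]
      have hin : ∀ z : Vert n ⊕ Vert n, dpos (Sum.inl (Sum.inr κ) : Vert n ⊕ Vert n) < dpos z →
          dpos z < dpos (Sum.inr (Sum.inl κ) : Vert n ⊕ Vert n) →
          dpos (Sum.inl (Sum.inr κ) : Vert n ⊕ Vert n) < dpos (g z) ∧
            dpos (g z) < dpos (Sum.inr (Sum.inl κ) : Vert n ⊕ Vert n) := by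
        have hκ : (κ : ℕ) = k := rfl
        rintro ((z | z) | (z | z)) h1 h2 <;> simp only [dpos, pos, Fin.val_rev] at h1 h2
        · omega
        · rw [hgx z (by omega)]
          simp only [dpos, pos, Fin.val_rev]
          omega
        · rw [hgy z (by omega)]
          simp only [dpos, pos, Fin.val_rev]
          omega
        · omega
      refine ⟨reconnect g (Sum.inl (Sum.inr κ)) (Sum.inr (Sum.inl κ)),
        nc_reconnect dpos dpos_inj hg (by simp only [dpos, pos, Fin.val_rev]; omega) hin,
        fun i hi => ?_, e, fun δ ε β hd s u => ?_⟩
      · rcases Nat.lt_succ_iff_lt_or_eq.1 hi with h | h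
        · have e0 : i ≠ κ := fun h' => by rw [h'] at h; exact lt_irrefl _ h
          have e1 := hgx i h
          have e2 : (Sum.inl (Sum.inr i) : Vert n ⊕ Vert n) ≠ g (Sum.inl (Sum.inr κ)) := by
            intro h'
            rw [h', hg.1] at e1
            exact absurd e1 (by simp)
          have e3 : (Sum.inl (Sum.inr i) : Vert n ⊕ Vert n) ≠ g (Sum.inr (Sum.inl κ)) := by
            intro h'
            rw [h', hg.1] at e1
            exact e0 (by simpa using e1.symm)
          simp [reconnect, hne, e0, e1, e2, e3]
        · rw [show i = κ from Fin.ext h]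
          simp [reconnect, hne]
      · rw [pow_succ', mul_assoc, he δ ε β hd, mul_left_comm,
          contraction_reconnect hd hg κ hin hne]

theorem contraction_of_closed (hd : Duality δ ε β) {g : Vert n ⊕ Vert n → Vert n ⊕ Vert n}
    (hgx : ∀ i : Fin n, g (Sum.inl (Sum.inr i)) = Sum.inr (Sum.inl i))
    (hgy : ∀ i : Fin n, g (Sum.inr (Sum.inl i)) = Sum.inl (Sum.inr i)) {l : Vert n → Vert n}
    (hl : ∀ u, dout (l u) = g (dout u)) (s u : Fin n → Fin 2) :
    contraction δ ε g s u = β ^ n * lineWeight δ pos l (Sum.elim s u) := by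
  have dlt : ∀ u v : Vert n, dpos (dout u) < dpos (dout v) ↔ pos u < pos v := by
    rintro (u | u) (v | v) <;> simp only [pos, dpos, dout, Fin.val_rev] <;> omega
  have hc : ∀ (b t : Fin n → Fin 2) v, stackColour s b t u (dout v) = Sum.elim s u v := by
    rintro b t (v | v) <;> rfl
  have h1 : ∀ b t : Fin n → Fin 2, lineWeight δ dpos g (stackColour s b t u) =
      (∏ i, δ (b i) (t i)) * lineWeight δ pos l (Sum.elim s u) := by
    intro b t
    have q1 : ∀ i : Fin n, dpos (Sum.inl (Sum.inr i) : Vert n ⊕ Vert n) <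
        dpos (Sum.inr (Sum.inl i) : Vert n ⊕ Vert n) := by
      intro i; simp only [dpos, pos, Fin.val_rev]; omega
    have q2 : ∀ v, (if dpos (dout v) < dpos (g (dout v)) then
        δ (stackColour s b t u (dout v)) (stackColour s b t u (g (dout v))) else 1) =
        if pos v < pos (l v) then δ (Sum.elim s u v) (Sum.elim s u (l v)) else 1 := by
      intro v
      rw [← hl, if_congr (dlt _ _) rfl rfl, hc, hc]
    let F : Vert n ⊕ Vert n → ℂ := fun z => if dpos z < dpos (g z) then
      δ (stackColour s b t u z) (stackColour s b t u (g z)) else 1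
    let G : Vert n → ℂ := fun v => if pos v < pos (l v) then
      δ (Sum.elim s u v) (Sum.elim s u (l v)) else 1
    have q3 : ∀ v, F (dout v) = G v := q2
    have q4 : ∀ i : Fin n, F (Sum.inl (Sum.inr i)) = δ (b i) (t i) := by
      intro i
      simp only [F, hgx, q1, if_true]
      rfl
    have q5 : ∀ i : Fin n, F (Sum.inr (Sum.inl i)) = 1 := by
      intro i
      simp only [F, hgy, (q1 i).not_gt, if_false]
    have q6 : ∀ i : Fin n, F (Sum.inl (Sum.inl i)) = G (Sum.inl i) := fun i => q3 (Sum.inl i)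
    have q7 : ∀ i : Fin n, F (Sum.inr (Sum.inr i)) = G (Sum.inr i) := fun i => q3 (Sum.inr i)
    change ∏ z, F z = _ * ∏ v, G v
    simp only [Fintype.prod_sum_type, q4, q5, q6, q7, Finset.prod_const_one, one_mul]
    ring
  have h2 : ∑ b : Fin n → Fin 2, ∑ t : Fin n → Fin 2, ∏ i, (ε (b i) (t i) * δ (b i) (t i)) =
      β ^ n := by
    have h3 : ∀ b : Fin n → Fin 2, ∑ t : Fin n → Fin 2, ∏ i, (ε (b i) (t i) * δ (b i) (t i)) =
        ∏ i, ∑ t, ε (b i) t * δ (b i) t := by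
      intro b
      rw [Finset.prod_univ_sum, Fintype.piFinset_univ]
    simp only [h3]
    have h4 := (Finset.prod_univ_sum (fun _ : Fin n => (Finset.univ : Finset (Fin 2)))
      (fun _ b => ∑ t, ε b t * δ b t)).symm
    rw [Fintype.piFinset_univ] at h4
    rw [h4, hd.loop, Finset.prod_const, Finset.card_univ, Fintype.card_fin]
  rw [contraction, ← h2, Finset.sum_mul]
  refine Finset.sum_congr rfl fun b _ => ?_
  rw [Finset.sum_mul]
  refine Finset.sum_congr rfl fun t _ => ?_
  rw [h1, Finset.prod_mul_distrib]
  ring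

theorem exists_sum_diagramCoeff (D D' : Diagram n) :
    ∃ (D'' : Diagram n) (e : ℕ), ∀ δ ε β, Duality δ ε β → ∀ s u,
      ∑ t, diagramCoeff δ ε D s t * diagramCoeff δ ε D' t u = β ^ e * diagramCoeff δ ε D'' s u := by
  obtain ⟨g, hg, hgx, e, he⟩ := exists_contracted (dlink_nc D D') n le_rfl
  replace hgx : ∀ i : Fin n, g (Sum.inl (Sum.inr i)) = Sum.inr (Sum.inl i) := fun i => hgx i i.2
  have hgy : ∀ i : Fin n, g (Sum.inr (Sum.inl i)) = Sum.inl (Sum.inr i) :=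
    fun i => by rw [← hgx, hg.1]
  have hex : ∀ u : Vert n, ∃ v : Vert n, dout v = g (dout u) := by
    intro u
    rcases h : g (dout u) with (z | z) | (z | z)
    · exact ⟨Sum.inl z, rfl⟩
    · have h1 := congrArg g h
      rw [hg.1, hgx] at h1
      rcases u with u | u <;> simp [dout] at h1
    · have h1 := congrArg g h
      rw [hg.1, hgy] at h1
      rcases u with u | u <;> simp [dout] at h1
    · exact ⟨Sum.inr z, rfl⟩
  choose l hl using hex
  have dinj : ∀ u v : Vert n, dout u = dout v → u = v := by
    rintro (u | u) (v | v) h <;> simp only [dout, Sum.inl.injEq, Sum.inr.injEq, reduceCtorEq] at h <;> rw [h]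
  have dlt : ∀ u v : Vert n, pos u < pos v → dpos (dout u) < dpos (dout v) := by
    rintro (u | u) (v | v) h <;> simp only [pos, dpos, dout, Fin.val_rev] at h ⊢ <;> omega
  have hnc : NC pos l := by
    refine ⟨fun u => ?_, fun u h => ?_, fun u v h => ?_⟩
    · apply dinj; rw [hl, hl, hg.1]
    · apply hg.2.1 (dout u); rw [← hl, h]
    · apply hg.2.2 (dout u) (dout v)
      rw [← hl, ← hl]
      exact ⟨dlt _ _ h.1, dlt _ _ h.2.1, dlt _ _ h.2.2⟩
  refine ⟨Diagram.ofLink l hnc, e, fun δ ε β hd s u => ?_⟩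
  have hw : ∀ s b t b' : Fin n → Fin 2, lineWeight δ pos D.link (Sum.elim s b) *
      lineWeight δ pos D'.link (Sum.elim t b') =
      lineWeight δ dpos (dlink D D') (stackColour s b t b') := by
    intro s b t b'
    rw [lineWeight, lineWeight, lineWeight, Fintype.prod_sum_type (α₁ := Vert n)]
    congr 1
    refine Finset.prod_congr rfl fun v _ => ?_
    simp [dlink, dpos, stackColour]
  have hcon : ∀ s b', contraction δ ε (dlink D D') s b' =
      β ^ e * lineWeight δ pos l (Sum.elim s b') := by
    intro s b'
    apply mul_left_cancel₀ (pow_ne_zero n hd.ne_zero)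
    rw [he δ ε β hd, contraction_of_closed hd hgx hgy hl]
    ring
  simp only [diagramCoeff_eq_sum hd, Diagram.link_ofLink]
  rw [Finset.mul_sum]
  have h1 : ∀ b', β ^ e * (lineWeight δ pos l (Sum.elim s b') * ∏ j, ε (b' j) (u j)) =
      contraction δ ε (dlink D D') s b' * ∏ j, ε (b' j) (u j) := by
    intro b'; rw [hcon]; ring
  simp only [h1, contraction, ← hw, Finset.sum_mul_sum]
  simp only [Finset.sum_mul]
  rw [Finset.sum_congr rfl fun t _ => Finset.sum_comm, Finset.sum_comm]
  refine Finset.sum_congr rfl fun b' _ => ?_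
  rw [Finset.sum_comm]
  refine Finset.sum_congr rfl fun b _ => Finset.sum_congr rfl fun t _ => ?_
  ring

theorem duality_colour : Duality (fun a b => if a = b then 1 else 0)
    (fun a b => if a = b then 1 else 0) 2 where
  ne_zero := two_ne_zero
  eps_delta a c := by simp
  delta_eps a c := by simp
  loop := by simp

/-- Matrix entries are multiplicative up to a factor for each closed loop. -/
theorem sum_diagramCoeff (hd : Duality δ ε β) (D D' : Diagram n) (s u : Fin n → Fin 2) :
    ∑ t, diagramCoeff δ ε D s t * diagramCoeff δ ε D' t u =
      β ^ loops D.rel D'.rel * diagramCoeff δ ε (D.comp D') s u := by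
  obtain ⟨D'', e, h⟩ := exists_sum_diagramCoeff D D'
  have h1 : 2 ^ loops D.rel D'.rel • colour (compRel D.rel D'.rel) = 2 ^ e • colour D''.rel := by
    rw [← colour_mul]
    ext s u
    have h2 := h _ _ _ duality_colour s u
    simp only [diagramCoeff_delta_eq_colour] at h2
    rw [Matrix.mul_apply, Matrix.smul_apply, smul_eq_mul]
    exact_mod_cast h2
  obtain ⟨h3, rfl⟩ := colour_smul_inj h1
  rw [h δ ε β hd, show D'' = D.comp D' from Diagram.ext h3.symm]

end Stack

section Coordinates

variable {q : ℂ} {m n : ℕ}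

/-- The standard basis of the tensor power. -/
def stdBasis (m : ℕ) : Module.Basis (Fin m → Fin 2) ℂ (TP m) :=
  Basis.piTensorProduct fun _ : Fin m => Pi.basisFun ℂ (Fin 2)

/-- The coordinates in the standard basis. -/
def coord (m : ℕ) : TP m ≃ₗ[ℂ] ((Fin m → Fin 2) → ℂ) := (stdBasis m).equivFun

theorem basisFun_eq (a : Fin 2) :
    Pi.basisFun ℂ (Fin 2) a = if a = 0 then vPlus else vMinus := by
  fin_cases a <;> ext i <;> fin_cases i <;> simp [vPlus, vMinus]

theorem stdBasis_apply (s : Fin m → Fin 2) : stdBasis m s = stdVec s := by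
  rw [stdBasis, Basis.piTensorProduct_apply, stdVec]
  simp only [basisFun_eq]

theorem coord_tprod (w : Fin m → V2) (s : Fin m → Fin 2) :
    coord m (PiTensorProduct.tprod ℂ w) s = ∏ i, w i (s i) := by
  change (stdBasis m).repr _ s = _
  rw [stdBasis, Basis.piTensorProduct_repr_tprod_apply]
  simp

theorem coord_stdVec (s t : Fin m → Fin 2) :
    coord m (stdVec t) s = if s = t then 1 else 0 := by
  rw [← stdBasis_apply]
  change (stdBasis m).repr _ s = _
  rw [Module.Basis.repr_self, Finsupp.single_apply]
  simp only [eq_comm]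

theorem sum_coord_smul (x : TP m) : ∑ s, coord m x s • stdVec s = x := by
  simp only [← stdBasis_apply]
  exact (stdBasis m).sum_equivFun x

theorem coord_ext {x y : TP m} (h : ∀ s, coord m x s = coord m y s) : x = y :=
  (coord m).injective (funext h)

theorem end_ext {S T : Module.End ℂ (TP m)} (h : ∀ t, S (stdVec t) = T (stdVec t)) : S = T :=
  (stdBasis m).ext fun t => by rw [stdBasis_apply, h]

theorem spin_stdVec (D : Diagram n) (t : Fin n → Fin 2) :
    spin q n (diag q D) (stdVec t) = ∑ s, spinCoeff q D s t • stdVec s := by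
  rw [spin, linExt_diag, ← stdBasis_apply]
  exact (stdBasis n).constr_basis ℂ _ t

theorem coord_spin_stdVec (D : Diagram n) (s t : Fin n → Fin 2) :
    coord n (spin q n (diag q D) (stdVec t)) s = spinCoeff q D s t := by
  rw [spin_stdVec]
  simp only [map_sum, map_smul, Finset.sum_apply, Pi.smul_apply, coord_stdVec, smul_eq_mul]
  simp

theorem coord_end (T : Module.End ℂ (TP n)) (x : TP n) (s : Fin n → Fin 2) :
    coord n (T x) s = ∑ t, coord n (T (stdVec t)) s * coord n x t := by
  conv_lhs => rw [← sum_coord_smul x]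
  simp only [map_sum, map_smul, Finset.sum_apply, Pi.smul_apply, smul_eq_mul, mul_comm]

theorem coord_spin (D : Diagram n) (x : TP n) (s : Fin n → Fin 2) :
    coord n (spin q n (diag q D) x) s = ∑ t, spinCoeff q D s t * coord n x t := by
  rw [coord_end]
  simp only [coord_spin_stdVec]

theorem IsGeneric.loop_ne_zero (hq : IsGeneric q) : -q - q⁻¹ ≠ 0 := by
  have h0 := hq.ne_zero
  intro h
  apply hq.pow_ne_one 4 (by norm_num)
  field_simp at h
  have h1 : q ^ 2 = -1 := by linear_combination -h
  calc q ^ 4 = (q ^ 2) ^ 2 := by ring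
    _ = 1 := by rw [h1]; norm_num

theorem duality_spin (hq : IsGeneric q) : Duality (deltaCoeff q) (epsCoeff q) (-q - q⁻¹) where
  ne_zero := hq.loop_ne_zero
  eps_delta a c := by
    have h0 := hq.ne_zero
    fin_cases a <;> fin_cases c <;> simp [epsCoeff, deltaCoeff, h0]
  delta_eps a c := by
    have h0 := hq.ne_zero
    fin_cases a <;> fin_cases c <;> simp [epsCoeff, deltaCoeff, h0]
  loop := by simp [epsCoeff, deltaCoeff]; ring

theorem spinCoeff_eq (D : Diagram n) :
    spinCoeff q D = diagramCoeff (deltaCoeff q) (epsCoeff q) D := rfl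

theorem spin_mul (hq : IsGeneric q) (x y : TL q n) :
    spin q n (x * y) = spin q n x * spin q n y := by
  induction x using TL.induction with
  | add x₁ x₂ h1 h2 => simp only [add_mul, map_add, h1, h2]
  | smul c D =>
  induction y using TL.induction with
  | add x₁ x₂ h1 h2 => simp only [mul_add, map_add, h1, h2]
  | smul c' D' =>
    simp only [smul_mul_assoc, mul_smul_comm, map_smul]
    congr 2
    refine end_ext fun t => coord_ext fun s => ?_
    rw [diag_mul_diag, map_smul, LinearMap.smul_apply, map_smul, Pi.smul_apply,
      coord_spin_stdVec, Module.End.mul_apply, coord_spin]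
    simp only [coord_spin_stdVec, spinCoeff_eq]
    rw [sum_diagramCoeff (duality_spin hq), smul_eq_mul]

theorem diagramCoeff_id (δ ε : Fin 2 → Fin 2 → ℂ) (s t : Fin n → Fin 2) :
    diagramCoeff δ ε (Diagram.id n) s t = if s = t then 1 else 0 := by
  classical
  have h1 : ∀ i j : Fin n, (Diagram.id n).rel (Sum.inl i) (Sum.inl j) ↔ i = j :=
    fun i j => Iff.rfl
  have h2 : ∀ i j : Fin n, (Diagram.id n).rel (Sum.inr i) (Sum.inr j) ↔ i = j :=
    fun i j => Iff.rfl
  have h3 : ∀ i j : Fin n, (Diagram.id n).rel (Sum.inl i) (Sum.inr j) ↔ i = j :=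
    fun i j => Iff.rfl
  have h4 : ∀ i j : Fin n, ¬ (i < j ∧ i = j) := fun i j h => h.1.ne h.2
  simp only [diagramCoeff, h1, h2, h3, h4, if_false, Finset.prod_const_one, one_mul]
  rw [Finset.prod_congr rfl fun i _ => Finset.prod_ite_eq Finset.univ i _]
  simp only [Finset.mem_univ, if_true]
  rw [Finset.prod_ite_zero, Finset.prod_const_one]
  simp [funext_iff]

theorem spin_one : spin q n 1 = 1 := by
  refine end_ext fun t => coord_ext fun s => ?_
  rw [TL.one_def, coord_spin_stdVec, spinCoeff_eq, diagramCoeff_id, Module.End.one_apply,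
    coord_stdVec]

theorem diagramCoeff_juxta (δ ε : Fin 2 → Fin 2 → ℂ) {a b : ℕ} (D : Diagram a) (D' : Diagram b)
    (s t : Fin (a + b) → Fin 2) :
    diagramCoeff δ ε (D.juxta D') s t =
      diagramCoeff δ ε D (fun i => s (Fin.castAdd b i)) (fun i => t (Fin.castAdd b i)) *
      diagramCoeff δ ε D' (fun i => s (Fin.natAdd a i)) (fun i => t (Fin.natAdd a i)) := by
  classical
  have ll : ∀ u v : Vert a, (D.juxta D').rel (leftVert u) (leftVert v) ↔ D.rel u v :=
    juxta_ll _ _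
  have rr : ∀ u v : Vert b, (D.juxta D').rel (rightVert u) (rightVert v) ↔ D'.rel u v :=
    juxta_rr _ _
  have lr : ∀ (u : Vert a) (v : Vert b), ¬ (D.juxta D').rel (leftVert u) (rightVert v) :=
    juxta_lr _ _
  have rl : ∀ (u : Vert b) (v : Vert a), ¬ (D.juxta D').rel (rightVert u) (leftVert v) :=
    juxta_rl _ _
  simp only [Sum.forall, leftVert, rightVert, Sum.map_inl, Sum.map_inr] at ll rr lr rl
  have c1 : ∀ i j : Fin a, Fin.castAdd b i < Fin.castAdd b j ↔ i < j := fun i j => Iff.rfl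
  have c2 : ∀ i j : Fin b, Fin.natAdd a i < Fin.natAdd a j ↔ i < j := fun i j => by simp
  simp only [diagramCoeff, Fin.prod_univ_add, ll, rr, lr, rl,
    c1, c2, and_false, if_false,
    Finset.prod_const_one, mul_one, one_mul]
  ring

end Coordinates

section Gen

variable {q : ℂ} {n : ℕ}

theorem prod_eq_mul_mul_prod (i j : Fin n) (hij : i ≠ j) (f : Fin n → ℂ) :
    ∏ k, f k = f i * f j * ∏ k ∈ {i, j}ᶜ, f k := by
  rw [← Finset.prod_mul_prod_compl {i, j}, Finset.prod_pair hij]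

theorem diagramCoeff_gen (δ ε : Fin 2 → Fin 2 → ℂ) (i : ℕ) (hi : i + 1 < n)
    (s t : Fin n → Fin 2) :
    diagramCoeff δ ε (Diagram.gen i hi) s t =
      ε (t ⟨i, by omega⟩) (t ⟨i + 1, hi⟩) * δ (s ⟨i, by omega⟩) (s ⟨i + 1, hi⟩) *
      ∏ k ∈ ({⟨i, by omega⟩, ⟨i + 1, hi⟩} : Finset (Fin n))ᶜ, if s k = t k then 1 else 0 := by
  classical
  set x : Fin n := ⟨i, by omega⟩ with hx
  set y : Fin n := ⟨i + 1, hi⟩ with hy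
  have hxy : x ≠ y := by simp [hx, hy]
  have h1 : ∀ j k : Fin n, (j < k ∧ (Diagram.gen i hi).rel (Sum.inl j) (Sum.inl k)) ↔
      j = x ∧ k = y := by
    intro j k
    change (_ ∧ (ite _ _ _ : ℕ) = ite _ _ _) ↔ _
    simp only [Fin.ext_iff, hx, hy, Fin.lt_def]
    split_ifs <;> omega
  have h2 : ∀ j k : Fin n, (j < k ∧ (Diagram.gen i hi).rel (Sum.inr j) (Sum.inr k)) ↔
      j = x ∧ k = y := by
    intro j k
    change (_ ∧ (ite _ _ _ : ℕ) = ite _ _ _) ↔ _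
    simp only [Fin.ext_iff, hx, hy, Fin.lt_def]
    split_ifs <;> omega
  have h3 : ∀ j k : Fin n, (Diagram.gen i hi).rel (Sum.inl j) (Sum.inr k) ↔
      (k = j ∧ j ∈ ({x, y} : Finset (Fin n))ᶜ) := by
    intro j k
    change (ite _ _ _ : ℕ) = ite _ _ _ ↔ _
    simp only [Finset.mem_compl, Finset.mem_insert, Finset.mem_singleton, Fin.ext_iff, hx, hy]
    split_ifs <;> omega
  have h4 : ∀ f : Fin n → Fin n → ℂ, (∏ j, ∏ k, if j = x ∧ k = y then f j k else 1) = f x y := by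
    intro f
    rw [Finset.prod_eq_single x, Finset.prod_eq_single y] <;> simp +contextual
  simp only [diagramCoeff, h1, h2, h3]
  rw [h4 (fun j k => ε (t j) (t k)), h4 (fun j k => δ (s j) (s k))]
  congr 1
  rw [← Finset.prod_subset (Finset.subset_univ ({x, y} : Finset (Fin n))ᶜ)]
  · refine Finset.prod_congr rfl fun j hj => ?_
    simp only [hj, and_true, Finset.prod_ite_eq', Finset.mem_univ, if_true]
  · intro j _ hj
    simp only [hj, and_false, if_false, Finset.prod_const_one]

theorem spin_gen (i : ℕ) (hi : i + 1 < n) (w : Fin n → V2) :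
    spin q n (diag q (Diagram.gen i hi)) (PiTensorProduct.tprod ℂ w) =
      eps q (w ⟨i, by omega⟩) (w ⟨i + 1, hi⟩) •
        (PiTensorProduct.tprod ℂ
            (Function.update (Function.update w ⟨i, by omega⟩ vPlus) ⟨i + 1, hi⟩ vMinus) -
          q⁻¹ • PiTensorProduct.tprod ℂ
            (Function.update (Function.update w ⟨i, by omega⟩ vMinus) ⟨i + 1, hi⟩ vPlus)) := by
  refine coord_ext fun s => ?_
  simp only [map_smul, map_sub, Pi.smul_apply, Pi.sub_apply, coord_spin, coord_tprod, spinCoeff_eq,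
    diagramCoeff_gen, smul_eq_mul]
  set x : Fin n := ⟨i, by omega⟩ with hx
  set y : Fin n := ⟨i + 1, hi⟩ with hy
  have hxy : x ≠ y := by simp [hx, hy]
  set R := ∏ k ∈ ({x, y} : Finset (Fin n))ᶜ, w k (s k) with hR
  have h1 : ∀ v v' : V2, ∏ k, Function.update (Function.update w x v) y v' k (s k) =
      v (s x) * v' (s y) * R := by
    intro v v'
    rw [prod_eq_mul_mul_prod x y hxy]
    congr 1
    · simp [hxy]
    · refine Finset.prod_congr rfl fun k hk => ?_
      simp only [Finset.mem_compl, Finset.mem_insert, Finset.mem_singleton, not_or] at hk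
      rw [Function.update_of_ne hk.2, Function.update_of_ne hk.1]
  have h2 : ∀ a b : Fin 2, ∑ t : Fin n → Fin 2, (if t x = a then 1 else 0) *
      (if t y = b then 1 else 0) * (∏ k ∈ ({x, y} : Finset (Fin n))ᶜ,
        if s k = t k then (1 : ℂ) else 0) * ∏ k, w k (t k) = w x a * w y b * R := by
    intro a b
    let H : Fin n → Fin 2 → ℂ := fun k c => (if k = x then (if c = a then 1 else 0) else
      if k = y then (if c = b then 1 else 0) else if s k = c then 1 else 0) * w k c
    have h3 : ∀ t : Fin n → Fin 2, (if t x = a then 1 else 0) *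
        (if t y = b then 1 else 0) * (∏ k ∈ ({x, y} : Finset (Fin n))ᶜ,
        if s k = t k then (1 : ℂ) else 0) * ∏ k, w k (t k) = ∏ k, H k (t k) := by
      intro t
      rw [Finset.prod_mul_distrib]
      congr 1
      rw [prod_eq_mul_mul_prod x y hxy, if_pos rfl, if_neg hxy.symm, if_pos rfl]
      congr 1
      refine Finset.prod_congr rfl fun k hk => ?_
      simp only [Finset.mem_compl, Finset.mem_insert, Finset.mem_singleton, not_or] at hk
      rw [if_neg hk.1, if_neg hk.2]
    rw [Finset.sum_congr rfl fun t _ => h3 t]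
    have h4 := (Finset.prod_univ_sum (fun _ : Fin n => (Finset.univ : Finset (Fin 2))) H).symm
    rw [Fintype.piFinset_univ] at h4
    rw [h4, prod_eq_mul_mul_prod x y hxy]
    congr 1
    · simp only [H, if_true, if_neg hxy.symm, ite_mul, one_mul, zero_mul, Finset.sum_ite_eq',
        Finset.mem_univ]
    · refine Finset.prod_congr rfl fun k hk => ?_
      simp only [Finset.mem_compl, Finset.mem_insert, Finset.mem_singleton, not_or] at hk
      simp only [H, if_neg hk.1, if_neg hk.2, ite_mul, one_mul, zero_mul, Finset.sum_ite_eq,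
        Finset.mem_univ, if_true]
  have h5 : ∀ a b : Fin 2, epsCoeff q a b = -q * ((if a = 0 then 1 else 0) *
      (if b = 1 then 1 else 0)) + (if a = 1 then 1 else 0) * (if b = 0 then 1 else 0) := by
    intro a b
    fin_cases a <;> fin_cases b <;> simp [epsCoeff]
  have h6 : ∀ a b : Fin 2, deltaCoeff q a b = vPlus a * vMinus b - q⁻¹ * (vMinus a * vPlus b) := by
    intro a b
    fin_cases a <;> fin_cases b <;> simp [deltaCoeff, vPlus, vMinus]
  rw [h1, h1, eps, h6]
  have h7 := h2 0 1
  have h8 := h2 1 0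
  calc _ = (vPlus (s x) * vMinus (s y) - q⁻¹ * (vMinus (s x) * vPlus (s y))) *
      (-q * (w x 0 * w y 1 * R) + w x 1 * w y 0 * R) := by
        rw [← h7, ← h8, Finset.mul_sum, ← Finset.sum_add_distrib, Finset.mul_sum]
        refine Finset.sum_congr rfl fun t _ => ?_
        rw [h5]
        ring
    _ = _ := by ring

end Gen

section Phi

variable {q : ℂ} {m n : ℕ}

theorem mulEquiv_tprod (a : Fin m → V2) (b : Fin n → V2) :
    TensorPower.mulEquiv (R := ℂ) (PiTensorProduct.tprod ℂ a ⊗ₜ PiTensorProduct.tprod ℂ b) =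
      PiTensorProduct.tprod ℂ (Fin.append a b) :=
  TensorPower.tprod_mul_tprod ℂ a b

theorem coord_mulEquiv (x : TP m) (y : TP n) (s : Fin m → Fin 2) (u : Fin n → Fin 2) :
    coord (m + n) (TensorPower.mulEquiv (R := ℂ) (x ⊗ₜ y)) (Fin.append s u) =
      coord m x s * coord n y u := by
  induction x using PiTensorProduct.induction_on with
  | add x x' h h' => simp only [TensorProduct.add_tmul, map_add, Pi.add_apply, h, h', add_mul]
  | smul_tprod r a =>
  induction y using PiTensorProduct.induction_on with
  | add y y' h h' => simp only [TensorProduct.tmul_add, map_add, Pi.add_apply, h, h', mul_add]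
  | smul_tprod r' b =>
    simp only [TensorProduct.tmul_smul, ← TensorProduct.smul_tmul', map_smul, Pi.smul_apply,
      mulEquiv_tprod, coord_tprod, Fin.prod_univ_add, Fin.append_left, Fin.append_right,
      smul_eq_mul]
    ring

theorem phi2_tprod_stdVec (α : Fin n → Module.Dual ℂ V2) (t : Fin n → Fin 2) :
    phi2 n (PiTensorProduct.tprod ℂ α) (stdVec t) =
      ∏ j : Fin n, α j (if t j.rev = 0 then vPlus else vMinus) := by
  rw [phi2, LinearEquiv.trans_apply, PiTensorProduct.reindex_tprod, stdVec]
  refine (PiTensorProduct.dualDistrib_apply (R := ℂ) _ _).trans ?_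
  rw [← Equiv.prod_comp Fin.revPerm]
  simp

theorem phi1_tmul (w : TP n) (f : Module.Dual ℂ (TP n)) (x : TP n) :
    phi1 n (w ⊗ₜ f) x = f x • w := by
  rw [phi1, LinearEquiv.trans_apply, TensorProduct.comm_tmul]
  rfl

theorem phi3_apply (hq : IsGeneric q) (α : Module.Dual ℂ V2) (a : Fin 2) :
    phi3 hq α a = ∑ c : Fin 2, α (if c = 0 then vPlus else vMinus) * deltaCoeff q c a := by
  change (α vPlus • vMinus + α vMinus • (-q⁻¹ • vPlus)) a = _
  rw [Fin.sum_univ_two]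
  fin_cases a <;> simp [deltaCoeff, vPlus, vMinus]

theorem coord_phi (hq : IsGeneric q) (T : Module.End ℂ (TP n)) (s u : Fin n → Fin 2) :
    coord (n + n) (phi hq n T) (Fin.append s u) =
      ∑ t, coord n (T (stdVec t)) s * ∏ j : Fin n, deltaCoeff q (t j.rev) (u j) := by
  obtain ⟨z, rfl⟩ := (phi1 n).surjective T
  obtain ⟨z, rfl⟩ := (TensorProduct.congr (LinearEquiv.refl ℂ (TP n)) (phi2 n)).surjective z
  induction z using TensorProduct.induction_on with
  | zero => simp
  | add x y hx hy =>
    simp only [map_add, Pi.add_apply, LinearMap.add_apply, hx, hy, add_mul,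
      Finset.sum_add_distrib]
  | tmul w y =>
  induction y using PiTensorProduct.induction_on with
  | add x y hx hy =>
    simp only [TensorProduct.tmul_add, map_add, Pi.add_apply, LinearMap.add_apply, hx, hy, add_mul,
      Finset.sum_add_distrib]
  | smul_tprod r α =>
    simp only [TensorProduct.tmul_smul, map_smul, Pi.smul_apply, LinearMap.smul_apply, smul_eq_mul,
      mul_assoc, ← Finset.mul_sum]
    congr 1
    rw [TensorProduct.congr_tmul, LinearEquiv.refl_apply]
    simp only [phi1_tmul, phi2_tprod_stdVec, map_smul, Pi.smul_apply, smul_eq_mul]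
    simp only [phi, LinearEquiv.trans_apply, LinearEquiv.symm_apply_apply, TensorProduct.congr_tmul,
      LinearEquiv.refl_apply, PiTensorProduct.congr_tprod, coord_mulEquiv, coord_tprod, phi3_apply]
    rw [Finset.prod_univ_sum, Fintype.piFinset_univ, Finset.mul_sum]
    rw [← (Equiv.arrowCongr Fin.revPerm (Equiv.refl (Fin 2))).sum_comp]
    refine Finset.sum_congr rfl fun t _ => ?_
    rw [Finset.prod_mul_distrib]
    simp only [Equiv.arrowCongr_apply, Function.comp_apply, Fin.revPerm_symm, Fin.revPerm_apply,
      Equiv.refl_apply]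
    ring

end Phi

section Bend

variable {q : ℂ} {n : ℕ}

theorem rev_castAdd_eq (i : Fin n) : (Fin.castAdd n i).rev = Fin.natAdd n i.rev := by
  ext; simp [Fin.val_rev]; omega

theorem rev_natAdd_eq (i : Fin n) : (Fin.natAdd n i).rev = Fin.castAdd n i.rev := by
  ext; simp [Fin.val_rev]; omega

theorem nested_rel_top (i j : Fin (n + n)) :
    (Diagram.nested n).rel (Sum.inl i) (Sum.inl j) ↔ j = i ∨ j = i.rev := by
  change (true, min i.val i.rev.val) = (true, min j.val j.rev.val) ↔ _
  simp only [Prod.mk.injEq, true_and, Fin.ext_iff, Fin.val_rev]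
  omega

theorem nested_rel_bot (i j : Fin (n + n)) :
    (Diagram.nested n).rel (Sum.inr i) (Sum.inr j) ↔ j = i ∨ j = i.rev := by
  change (false, min i.val i.rev.val) = (false, min j.val j.rev.val) ↔ _
  simp only [Prod.mk.injEq, true_and, Fin.ext_iff, Fin.val_rev]
  omega

theorem nested_rel_through (i j : Fin (n + n)) :
    ¬ (Diagram.nested n).rel (Sum.inl i) (Sum.inr j) := by
  change ¬ (true, min i.val i.rev.val) = (false, min j.val j.rev.val)
  simp

theorem diagramCoeff_nested (δ ε : Fin 2 → Fin 2 → ℂ) (s t : Fin (n + n) → Fin 2) :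
    diagramCoeff δ ε (Diagram.nested n) s t =
      (∏ i : Fin n, ε (t (Fin.castAdd n i)) (t (Fin.natAdd n i.rev))) *
      ∏ i : Fin n, δ (s (Fin.castAdd n i)) (s (Fin.natAdd n i.rev)) := by
  classical
  have h1 : ∀ f : Fin (n + n) → Fin (n + n) → ℂ,
      (∏ i, ∏ j, if i < j ∧ (j = i ∨ j = i.rev) then f i j else 1) =
      ∏ i : Fin n, f (Fin.castAdd n i) (Fin.natAdd n i.rev) := by
    intro f
    have h2 : ∀ i : Fin (n + n), (∏ j, if i < j ∧ (j = i ∨ j = i.rev) then f i j else 1) =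
        if i < i.rev then f i i.rev else 1 := by
      intro i
      rw [Finset.prod_eq_single i.rev]
      · simp
      · intro j _ hj
        rw [if_neg]
        rintro ⟨h, rfl | h'⟩
        · exact lt_irrefl _ h
        · exact hj h'
      · simp
    simp only [h2, Fin.prod_univ_add, rev_castAdd_eq, rev_natAdd_eq]
    have h3 : ∀ i j : Fin n, Fin.castAdd n i < Fin.natAdd n j := by
      intro i j; simp only [Fin.lt_def, Fin.val_castAdd, Fin.val_natAdd]; omega
    simp only [h3, (h3 _ _).not_gt, if_true, if_false, Finset.prod_const_one, mul_one]
  simp only [diagramCoeff, nested_rel_top, nested_rel_bot, nested_rel_through, if_false,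
    Finset.prod_const_one, mul_one]
  rw [h1 (fun i j => ε (t i) (t j)), h1 (fun i j => δ (s i) (s j))]

/-- The vector `v₋ ⊗ ⋯ ⊗ v₋ ⊗ v₊ ⊗ ⋯ ⊗ v₊`. -/
abbrev extremalColour (n : ℕ) : Fin (n + n) → Fin 2 :=
  Fin.append (fun _ : Fin n => 1) (fun _ : Fin n => 0)

theorem spin_bend (hq : IsGeneric q) (D : Diagram n) :
    spin q (n + n) (diag q (D.juxta (Diagram.id n)) * diag q (Diagram.nested n))
      (stdVec (extremalColour n)) = phi hq n (spin q n (diag q D)) := by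
  refine coord_ext fun r => ?_
  obtain ⟨⟨s, u⟩, rfl⟩ := (Fin.appendEquiv n n).surjective r
  change coord _ _ (Fin.append s u) = coord _ _ (Fin.append s u)
  rw [coord_phi, spin_mul hq, Module.End.mul_apply, coord_spin]
  simp only [coord_spin_stdVec, spinCoeff_eq, diagramCoeff_juxta, diagramCoeff_id,
    diagramCoeff_nested, Fin.append_left, Fin.append_right]
  rw [← (Fin.appendEquiv n n).sum_comp, Fintype.sum_prod_type]
  refine Finset.sum_congr rfl fun t _ => ?_
  rw [Finset.sum_eq_single u]
  · simp only [Fin.appendEquiv, Equiv.coe_fn_mk, Fin.append_left, Fin.append_right, if_true,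
      mul_one]
    congr 1
    have h1 : epsCoeff q 1 0 = 1 := by simp [epsCoeff]
    rw [h1, Finset.prod_const_one, one_mul, ← Equiv.prod_comp Fin.revPerm]
    simp
  · intro u' _ hu
    simp only [Fin.appendEquiv, Equiv.coe_fn_mk, Fin.append_right]
    rw [if_neg (fun h => hu h.symm)]
    simp
  · simp

theorem juxta_id_rel_left {D : Diagram n} {u v : Vert n} (h : D.rel u v) :
    (D.juxta (Diagram.id n)).rel (leftVert u) (leftVert v) :=
  (juxta_ll _ _ _ _).2 h

theorem juxta_id_rel_right (D : Diagram n) (i : Fin n) :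
    (D.juxta (Diagram.id n)).rel (Sum.inl (Fin.natAdd n i)) (Sum.inr (Fin.natAdd n i)) :=
  (juxta_rr D.rel (Diagram.id n).rel (Sum.inl i) (Sum.inr i)).2 rfl

/-- The top vertex to which a vertex of `D` is bent. -/
def bentVert : Vert n → Vert (n + n)
  | Sum.inl i => Sum.inl (Fin.castAdd n i)
  | Sum.inr i => Sum.inl (Fin.natAdd n i.rev)

theorem bentVert_injective : Function.Injective (bentVert (n := n)) := by
  rintro (i | i) (j | j) h <;>
    simp only [bentVert, Sum.inl.injEq, Fin.ext_iff, Fin.val_castAdd, Fin.val_natAdd,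
      Fin.val_rev] at h
  · exact congrArg _ (Fin.ext h)
  · omega
  · omega
  · exact congrArg _ (Fin.ext (by omega))

theorem stack_bentVert (D : Diagram n) (u : Vert n) :
    stack (D.juxta (Diagram.id n)).rel (Diagram.nested n).rel (upper (leftVert u))
      (outer (bentVert u)) := by
  rcases u with i | i
  · exact Setoid.refl' _ _
  · refine Setoid.trans' _ (y := Sum.inr (Sum.inl (Fin.natAdd n i.rev))) ?_ ?_
    · refine Relation.EqvGen.rel _ _ (Or.inr ⟨Sum.inl (Fin.castAdd n i),
        Sum.inl (Fin.natAdd n i.rev), ?_, rfl, rfl⟩)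
      rw [nested_rel_top]
      exact Or.inr (rev_castAdd_eq i).symm
    · refine Setoid.symm' _ (Relation.EqvGen.rel _ _ (Or.inl ⟨_, _,
        juxta_id_rel_right D i.rev, rfl, rfl⟩))

theorem comp_nested_rel {D : Diagram n} {u v : Vert n} (h : D.rel u v) :
    ((D.juxta (Diagram.id n)).comp (Diagram.nested n)).rel (bentVert u) (bentVert v) :=
  Setoid.trans' (stack _ _) (Setoid.symm' _ (stack_bentVert D u))
    (Setoid.trans' _ (Relation.EqvGen.rel _ _ (Or.inl ⟨_, _, juxta_id_rel_left h, rfl, rfl⟩))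
      (stack_bentVert D v))

theorem comp_nested_injective : Function.Injective fun D : Diagram n =>
    (D.juxta (Diagram.id n)).comp (Diagram.nested n) := by
  have key : ∀ D D' : Diagram n, (D.juxta (Diagram.id n)).comp (Diagram.nested n) =
      (D'.juxta (Diagram.id n)).comp (Diagram.nested n) → ∀ u v, D.rel u v → D'.rel u v := by
    intro D D' h u v huv
    by_cases hne : v = u
    · rw [hne]
    have h1 := comp_nested_rel huv
    rw [h] at h1
    have h2 := comp_nested_rel (D'.rel_link u)
    have h3 := Diagram.link_eq_of_rel _ (bentVert_injective.ne hne) h1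
    have h4 := Diagram.link_eq_of_rel _ (bentVert_injective.ne (D'.link_ne u)) h2
    rw [show v = D'.link u from bentVert_injective (h3.symm.trans h4)]
    exact D'.rel_link u
  intro D D' h
  apply Diagram.ext
  ext u v
  exact ⟨key D D' h u v, key D' D h.symm u v⟩

theorem loops_juxta_id_nested (D : Diagram n) :
    loops (D.juxta (Diagram.id n)).rel (Diagram.nested n).rel = 0 := by
  have : IsEmpty (ClosedLoop (D.juxta (Diagram.id n)).rel (Diagram.nested n).rel) := by
    refine ⟨fun ⟨c, hc⟩ => ?_⟩
    induction c using Quotient.inductionOn with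
    | h x =>
    rcases x with i | i | i
    · exact hc (Sum.inl i) rfl
    · induction i using Fin.addCases with
      | left j =>
        exact hc (bentVert (Sum.inr j))
          (Quotient.sound (Setoid.symm' _ (stack_bentVert D (Sum.inr j))))
      | right j =>
        exact hc (Sum.inl (Fin.natAdd n j)) (Quotient.sound
          (Relation.EqvGen.rel _ _ (Or.inl ⟨_, _, juxta_id_rel_right D j, rfl, rfl⟩)))
    · exact hc (Sum.inr i) rfl
  exact Nat.card_of_isEmpty

theorem juxta_id_mul_nested (D : Diagram n) :
    diag q (D.juxta (Diagram.id n)) * diag q (Diagram.nested n) =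
      diag q ((D.juxta (Diagram.id n)).comp (Diagram.nested n)) := by
  rw [diag_mul_diag, loops_juxta_id_nested, pow_zero, one_smul]

theorem bend_diag (D : Diagram n) : bend q n (diag q D) =
    indMk q n n (diag q ((D.juxta (Diagram.id n)).comp (Diagram.nested n))) 1 := by
  rw [bend, linExt_diag, juxta_id_mul_nested]

end Bend

section Matchings

variable {X : Type*} {p : X → ℕ} {f g : X → X}

theorem NC.rotate {a b : ℕ} (hpb : ∀ x, p x < a + b) (hf : NC p f) :
    NC (fun x => if p x < a then p x + b else p x - a) f := by
  refine ⟨hf.1, hf.2.1, fun u v => ?_⟩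
  have h1 := hf.2.2 u v
  have h2 := hf.2.2 v (f u)
  have h3 := hf.2.2 (f u) (f v)
  have h4 := hf.2.2 (f v) u
  rw [hf.1] at h2 h4
  rw [hf.1, hf.1] at h3
  have b1 := hpb u
  have b2 := hpb v
  have b3 := hpb (f u)
  have b4 := hpb (f v)
  dsimp only
  split_ifs <;> omega

/-- A non-crossing matching is determined by the left end points of its arcs. -/
theorem NC.eq_of_openers (hp : Function.Injective p) (hf : NC p f) (hg : NC p g)
    (h : ∀ x, p x < p (f x) ↔ p x < p (g x)) : f = g := by
  have step : ∀ f g : X → X, NC p f → NC p g → (∀ x, p x < p (f x) ↔ p x < p (g x)) →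
      ∀ y, p (f y) < p y → (∀ w, p w < p y → p (f w) < p w → f w = g w) →
      ¬ p (f y) < p (g y) := by
    intro f g hf hg h y hy ih hlt
    have n1 : ∀ a b, a ≠ b → p a ≠ p b := fun a b h h' => h (hp h')
    have hgy : p (g y) < p y := by
      have h1 := n1 _ _ (hg.2.1 y)
      have h2 := h y
      omega
    have hz : p (g y) < p (f (g y)) := by
      rw [h (g y), hg.1]; exact hgy
    have hwy : f (g y) ≠ y := by
      intro e
      have : f y = g y := by rw [← e, hf.1, e]
      rw [this] at hlt
      exact lt_irrefl _ hlt
    have hw : p (f (g y)) < p y := by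
      have h1 := hf.2.2 (f y) (g y)
      rw [hf.1] at h1
      have h2 := n1 _ _ hwy
      omega
    have h3 := ih (f (g y)) hw (by rw [hf.1]; exact hz)
    rw [hf.1] at h3
    have h4 := congrArg g h3
    rw [hg.1, hg.1] at h4
    exact hwy h4.symm
  have closers : ∀ k, ∀ y, p y = k → p (f y) < p y → f y = g y := by
    intro k
    induction k using Nat.strong_induction_on with
    | _ k ih =>
      intro y hk hy
      have h1 := step f g hf hg h y hy fun w hw hw' => ih (p w) (by omega) w rfl hw'
      have hgy : p (g y) < p y := by
        have h1 : p (g y) ≠ p y := fun e => hg.2.1 y (hp e)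
        have h2 := h y
        omega
      have h2 := step g f hg hf (fun x => (h x).symm) y hgy fun w hw hw' =>
        (ih (p w) (by omega) w rfl (by
          have h1 : p (f w) ≠ p w := fun e => hf.2.1 w (hp e)
          have h2 := h w
          omega)).symm
      exact hp (by omega)
  funext x
  by_cases hx : p (f x) < p x
  · exact closers _ x rfl hx
  · have hx' : p (f (f x)) < p (f x) := by
      rw [hf.1]
      have : p (f x) ≠ p x := fun e => hf.2.1 x (hp e)
      omega
    have h1 := closers _ (f x) rfl hx'
    rw [hf.1] at h1
    conv_rhs => rw [h1]
    rw [hg.1]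

end Matchings

section Diagrams

variable {n m : ℕ}

theorem Diagram.eq_of_link_eq {D D' : Diagram n} (h : D.link = D'.link) : D = D' := by
  apply Diagram.ext
  ext u v
  rw [D.rel_iff, D'.rel_iff, h]

theorem Diagram.eq_of_le {D D' : Diagram n} (h : ∀ u v, D.rel u v → D'.rel u v) : D = D' :=
  Diagram.eq_of_link_eq (funext fun u =>
    (D'.link_eq_of_rel (D.link_ne u) (h _ _ (D.rel_link u))).symm)

theorem exists_bottom_link {D : Diagram n} (hD : D ≠ Diagram.id n) :
    ∃ i j, i < j ∧ D.rel (Sum.inr i) (Sum.inr j) := by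
  by_contra hc
  push Not at hc
  apply hD
  have h1 : ∀ i : Fin n, ∃ j : Fin n, D.link (Sum.inr i) = Sum.inl j := by
    intro i
    rcases hj : D.link (Sum.inr i) with j | j
    · exact ⟨j, rfl⟩
    · exfalso
      have h2 := D.rel_link (Sum.inr i)
      have h3 := D.link_ne (Sum.inr i)
      rw [hj] at h2 h3
      rcases lt_trichotomy i j with h | h | h
      · exact hc i j h h2
      · exact h3 (by rw [h])
      · exact hc j i h (D.rel.symm' h2)
  choose p hp using h1
  have inj : Function.Injective p := by
    intro i j hij
    have h2 : D.link (Sum.inr i) = D.link (Sum.inr j) := by rw [hp, hp, hij]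
    have h3 := congrArg D.link h2
    rw [D.link_link, D.link_link] at h3
    exact Sum.inr_injective h3
  apply eq_id_of_through
  intro i j hij
  obtain ⟨k, rfl⟩ := (Finite.injective_iff_surjective.1 inj) i
  have h2 : D.link (Sum.inl (p k)) = Sum.inr k := by rw [← hp, D.link_link]
  rcases (D.rel_iff _ _).1 hij with h | h
  · exact (Sum.inl_injective h).symm
  · rw [h2] at h; cases h

theorem exists_adjacent_link (D : Diagram m) (d : ℕ) : ∀ i j : Fin m, i < j → j.val - i.val ≤ d →
    D.rel (Sum.inr i) (Sum.inr j) → ∃ k l : Fin m, l.val = k.val + 1 ∧ i ≤ k ∧ l ≤ j ∧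
      D.rel (Sum.inr k) (Sum.inr l) := by
  induction d with
  | zero => intro i j hij hd; rw [Fin.lt_def] at hij; omega
  | succ d ih =>
    intro i j hij hd h
    rw [Fin.lt_def] at hij
    by_cases h1 : j.val = i.val + 1
    · exact ⟨i, j, h1, le_rfl, le_rfl, h⟩
    let i' : Fin m := ⟨i + 1, by omega⟩
    have hi' : (i' : ℕ) = i + 1 := rfl
    have n1 : D.link (Sum.inr i') ≠ Sum.inr i := by
      intro e
      have e1 := congrArg D.link e
      rw [D.link_link, D.link_eq_of_rel (fun e => by
        rw [Sum.inr_injective e] at hij; omega) h] at e1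
      have := congrArg Fin.val (Sum.inr_injective e1)
      omega
    have n2 : D.link (Sum.inr i') ≠ Sum.inr j := by
      intro e
      have e1 := congrArg D.link e
      rw [D.link_link, D.link_eq_of_rel (fun e => by
        rw [Sum.inr_injective e] at hij; omega) (D.rel.symm' h)] at e1
      have := congrArg Fin.val (Sum.inr_injective e1)
      omega
    have n3 := D.link_ne (Sum.inr i')
    have h2 := D.rel_link (Sum.inr i')
    have c1 := D.planar _ _ _ _ (D.rel.symm' h) h2
    have c2 := D.planar _ _ _ _ (D.rel.symm' h2) (D.rel.symm' h)
    generalize D.link (Sum.inr i') = w at *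
    rcases w with k | k
    · simp only [pos, Fin.val_rev] at c1 c2
      omega
    · simp only [ne_eq, Sum.inr.injEq, Fin.ext_iff] at n1 n2 n3
      simp only [pos, Fin.val_rev] at c1 c2
      have hk : i' < k ∧ k < j := by
        constructor <;> rw [Fin.lt_def] <;> omega
      obtain ⟨k', l', e1, e2, e3, e4⟩ := ih i' k hk.1 (by have := hk.2; rw [Fin.lt_def] at this; omega) h2
      refine ⟨k', l', e1, le_trans ?_ e2, e3.trans hk.2.le, e4⟩
      rw [Fin.le_def]; omega

/-- Capping two linked bottom vertices does not change a diagram. -/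
theorem comp_eq_self {D E : Diagram m} {x y : Fin m} (hxy : x ≠ y)
    (hD : D.rel (Sum.inr x) (Sum.inr y)) (hE : E.rel (Sum.inr x) (Sum.inr y))
    (hs : ∀ k, k ≠ x → k ≠ y → E.rel (Sum.inl k) (Sum.inr k)) : D.comp E = D := by
  symm
  refine Diagram.eq_of_le fun u v huv => ?_
  change stack D.rel E.rel (outer u) (outer v)
  have up : ∀ u v, D.rel u v → stack D.rel E.rel (upper u) (upper v) := fun u v h =>
    Relation.EqvGen.rel _ _ (Or.inl ⟨u, v, h, rfl, rfl⟩)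
  have low : ∀ u v, E.rel u v → stack D.rel E.rel (lower u) (lower v) := fun u v h =>
    Relation.EqvGen.rel _ _ (Or.inr ⟨u, v, h, rfl, rfl⟩)
  have h1 : ∀ u, u ≠ Sum.inr x → u ≠ Sum.inr y → stack D.rel E.rel (upper u) (outer u) := by
    rintro (k | k) hx hy
    · exact Setoid.refl' _ _
    · exact low _ _ (hs k (fun h => hx (by rw [h])) (fun h => hy (by rw [h])))
  have lx : D.link (Sum.inr x) = Sum.inr y :=
    D.link_eq_of_rel (fun h => hxy (Sum.inr_injective h).symm) hD
  have ly : D.link (Sum.inr y) = Sum.inr x := by rw [← lx, D.link_link]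
  by_cases hux : u = Sum.inr x
  · subst hux
    rcases (D.rel_iff _ _).1 huv with rfl | rfl
    · exact Setoid.refl' _ _
    · rw [lx]; exact low _ _ hE
  by_cases huy : u = Sum.inr y
  · subst huy
    rcases (D.rel_iff _ _).1 huv with rfl | rfl
    · exact Setoid.refl' _ _
    · rw [ly]; exact Setoid.symm' _ (low _ _ hE)
  have hvx : v ≠ Sum.inr x := by
    rintro rfl
    rcases (D.rel_iff _ _).1 huv with h | h
    · exact hux h.symm
    · exact huy (by rw [← lx, h, D.link_link])
  have hvy : v ≠ Sum.inr y := by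
    rintro rfl
    rcases (D.rel_iff _ _).1 huv with h | h
    · exact huy h.symm
    · exact hux (by rw [← ly, h, D.link_link])
  exact Setoid.trans' _ (Setoid.symm' _ (h1 u hux huy))
    (Setoid.trans' _ (up u v huv) (h1 v hvx hvy))

theorem gen_rel_bottom (i : ℕ) (hi : i + 1 < n) :
    (Diagram.gen i hi).rel (Sum.inr ⟨i, by omega⟩) (Sum.inr ⟨i + 1, hi⟩) := by
  change (ite _ _ _ : ℕ) = ite _ _ _
  simp

theorem gen_rel_straight (i : ℕ) (hi : i + 1 < n) (k : Fin n) (h1 : k.val ≠ i)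
    (h2 : k.val ≠ i + 1) : (Diagram.gen i hi).rel (Sum.inl k) (Sum.inr k) := by
  change (ite _ _ _ : ℕ) = ite _ _ _
  simp [h1, h2]

end Diagrams

section Induced

variable {q : ℂ} {n : ℕ}

theorem spin_juxta_extremal (D D' : Diagram n) :
    spin q (n + n) (tlTensor q n n (diag q D ⊗ₜ diag q D')) (stdVec (extremalColour n)) =
      (triv q n (diag q D) * triv q n (diag q D')) • stdVec (extremalColour n) := by
  classical
  have h1 : tlTensor q n n (diag q D ⊗ₜ diag q D') = diag q (D.juxta D') := by
    change (linExt q fun D => linExt q fun D' => diag q (D.juxta D')) (diag q D) (diag q D') = _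
    simp
  have h2 : ∀ D : Diagram n, triv q n (diag q D) = if D = Diagram.id n then 1 else 0 := by
    intro D
    refine (linExt_diag _ D).trans ?_
    congr
  have h3 : ∀ (D : Diagram n) (s : Fin n → Fin 2) (a : Fin 2),
      diagramCoeff (deltaCoeff q) (epsCoeff q) D s (fun _ => a) =
        if D = Diagram.id n then (if s = fun _ => a then 1 else 0) else 0 := by
    intro D s a
    by_cases hD : D = Diagram.id n
    · rw [if_pos hD, hD, diagramCoeff_id]
    · rw [if_neg hD]
      obtain ⟨i, j, hij, hr⟩ := exists_bottom_link hD
      have h4 : epsCoeff q a a = 0 := by fin_cases a <;> simp [epsCoeff]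
      rw [diagramCoeff, Finset.prod_eq_zero (Finset.mem_univ i), zero_mul, zero_mul]
      rw [Finset.prod_eq_zero (Finset.mem_univ j)]
      rw [if_pos ⟨hij, hr⟩, h4]
  refine coord_ext fun r => ?_
  obtain ⟨⟨s, u⟩, rfl⟩ := (Fin.appendEquiv n n).surjective r
  change coord _ _ (Fin.append s u) = coord _ _ (Fin.append s u)
  rw [h1, coord_spin_stdVec, spinCoeff_eq, diagramCoeff_juxta, map_smul, Pi.smul_apply,
    coord_stdVec, smul_eq_mul, h2, h2]
  simp only [extremalColour, Fin.append_left, Fin.append_right, h3]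
  have h5 : Fin.append s u = Fin.append (fun _ => 1) (fun _ => 0) ↔
      (s = fun _ => 1) ∧ u = fun _ => 0 := by
    constructor
    · intro h
      exact ⟨funext fun i => by simpa using congrFun h (Fin.castAdd n i),
        funext fun i => by
          have := congrFun h (Fin.natAdd n i)
          rwa [Fin.append_right, Fin.append_right] at this⟩
    · rintro ⟨rfl, rfl⟩; rfl
  simp only [h5]
  split_ifs <;> simp_all

theorem spin_tlTensor (a : TL q n ⊗[ℂ] TL q n) (c : ℂ) :
    c • spin q (n + n) (tlTensor q n n a) (stdVec (extremalColour n)) =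
      trivRep q n n a c • stdVec (extremalColour n) := by
  induction a using TensorProduct.induction_on with
  | zero => simp
  | add a b ha hb => simp only [map_add, LinearMap.add_apply, smul_add, ha, hb, add_smul]
  | tmul x y =>
    induction x using TL.induction with
    | add x x' h h' =>
      simp only [TensorProduct.add_tmul, map_add, LinearMap.add_apply, smul_add, h, h', add_smul]
    | smul d D =>
    induction y using TL.induction with
    | add x x' h h' =>
      simp only [TensorProduct.tmul_add, map_add, LinearMap.add_apply, smul_add, h, h', add_smul]
    | smul d' D' =>
      have h1 : trivRep q n n (diag q D ⊗ₜ diag q D') c =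
          triv q n (diag q D) * triv q n (diag q D') * c := by
        simp [trivRep]
      simp only [TensorProduct.tmul_smul, ← TensorProduct.smul_tmul', map_smul,
        LinearMap.smul_apply, spin_juxta_extremal, h1, smul_smul, smul_eq_mul]
      congr 1
      ring

/-- The action on the extremal vector. -/
def actExtremal (q : ℂ) (n : ℕ) : TL q (n + n) ⊗[ℂ] ℂ →ₗ[ℂ] TP (n + n) :=
  (LinearMap.applyₗ (stdVec (extremalColour n)) ∘ₗ spin q (n + n)) ∘ₗ
    (TensorProduct.rid ℂ (TL q (n + n))).toLinearMap

theorem actExtremal_tmul (x : TL q (n + n)) (c : ℂ) :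
    actExtremal q n (x ⊗ₜ c) = c • spin q (n + n) x (stdVec (extremalColour n)) := by
  simp [actExtremal]

theorem actExtremal_smul (hq : IsGeneric q) (y : TL q (n + n)) (z : TL q (n + n) ⊗[ℂ] ℂ) :
    actExtremal q n (y • z) = spin q (n + n) y (actExtremal q n z) := by
  induction z using TensorProduct.induction_on with
  | zero => simp
  | add a b ha hb => simp only [smul_add, map_add, ha, hb]
  | tmul x c =>
    rw [TensorProduct.smul_tmul', actExtremal_tmul, actExtremal_tmul, smul_eq_mul, spin_mul hq,
      map_smul, Module.End.mul_apply]

theorem actExtremal_eq_zero (hq : IsGeneric q) {z : TL q (n + n) ⊗[ℂ] ℂ}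
    (hz : z ∈ indRel (tlTensor q n n) (trivRep q n n)) : actExtremal q n z = 0 := by
  induction hz using Submodule.span_induction with
  | mem z h =>
    obtain ⟨b, a, v, rfl⟩ := h
    rw [map_sub, actExtremal_tmul, actExtremal_tmul, spin_mul hq, Module.End.mul_apply, ← map_smul,
      spin_tlTensor, map_smul, sub_self]
  | zero => exact map_zero _
  | add x y _ _ hx hy => rw [map_add, hx, hy, add_zero]
  | smul y z _ hz => rw [actExtremal_smul hq, hz, map_zero]

/-- The embedding of the induced module into the tensor power. -/
def indEmbed (hq : IsGeneric q) (n : ℕ) : IndTriv q n n →ₗ[ℂ] TP (n + n) :=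
  (((indRel (tlTensor q n n) (trivRep q n n)).restrictScalars ℂ).liftQ (actExtremal q n)
    fun _ hz => actExtremal_eq_zero hq hz) ∘ₗ
  (Submodule.Quotient.restrictScalarsEquiv ℂ
    (indRel (tlTensor q n n) (trivRep q n n))).symm.toLinearMap

theorem indEmbed_indMk (hq : IsGeneric q) (x : TL q (n + n)) (c : ℂ) :
    indEmbed hq n (indMk q n n x c) =
      c • spin q (n + n) x (stdVec (extremalColour n)) :=
  actExtremal_tmul x c

/-- The class of `x ⊗ 1`. -/
def indMkLin (q : ℂ) (n : ℕ) : TL q (n + n) →ₗ[ℂ] IndTriv q n n where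
  toFun x := indMk q n n x 1
  map_add' x y := by simp [indMk, TensorProduct.add_tmul]
  map_smul' c x := by
    simp only [indMk, ← TensorProduct.smul_tmul', RingHom.id_apply]
    rfl

theorem indMkLin_apply (x : TL q (n + n)) : indMkLin q n x = indMk q n n x 1 := rfl

theorem indMkLin_surjective : Function.Surjective (indMkLin q n) := by
  intro z
  obtain ⟨t, rfl⟩ := Submodule.Quotient.mk_surjective _ z
  obtain ⟨x, rfl⟩ := (TensorProduct.rid ℂ (TL q (n + n))).symm.surjective t
  exact ⟨x, rfl⟩

theorem indMkLin_mul (x : TL q (n + n)) (a : TL q n ⊗[ℂ] TL q n) :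
    indMkLin q n (x * tlTensor q n n a) = trivRep q n n a 1 • indMkLin q n x := by
  have h1 : indMk q n n (x * tlTensor q n n a) 1 = indMk q n n x (trivRep q n n a 1) := by
    refine (Submodule.Quotient.eq _).2 ?_
    exact Submodule.subset_span ⟨x, a, 1, rfl⟩
  rw [indMkLin_apply, h1, ← map_smul, indMkLin_apply, indMk, indMk,
    TensorProduct.smul_tmul, smul_eq_mul, mul_one]

/-- No bottom link stays within one of the two halves. -/
def Diagram.Straddles (D : Diagram (n + n)) : Prop :=
  ∀ i j : Fin (n + n), i < j → D.rel (Sum.inr i) (Sum.inr j) → i.val < n ∧ n ≤ j.val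

theorem indMkLin_eq_zero (hq : IsGeneric q) {D : Diagram (n + n)} (hD : ¬ D.Straddles) :
    indMkLin q n (diag q D) = 0 := by
  unfold Diagram.Straddles at hD
  push Not at hD
  obtain ⟨i, j, hij, hr, h⟩ := hD
  obtain ⟨k, l, hkl, hik, hlj, hr'⟩ := exists_adjacent_link D _ i j hij le_rfl hr
  rw [Fin.le_def] at hik hlj
  have kill : ∀ (E E' : Diagram n), D.comp (E.juxta E') = D →
      triv q n (diag q E) * triv q n (diag q E') = 0 → indMkLin q n (diag q D) = 0 := by
    intro E E' hE ht
    have h1 : tlTensor q n n (diag q E ⊗ₜ diag q E') = diag q (E.juxta E') := by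
      change (linExt q fun D => linExt q fun D' => diag q (D.juxta D')) (diag q E) (diag q E') = _
      simp
    have h2 := indMkLin_mul (diag q D) (diag q E ⊗ₜ diag q E')
    rw [h1, diag_mul_diag, hE, map_smul] at h2
    have h3 : trivRep q n n (diag q E ⊗ₜ diag q E') 1 = 0 := by
      simpa [trivRep] using ht
    rw [h3, zero_smul] at h2
    exact (smul_eq_zero.1 h2).resolve_left (pow_ne_zero _ hq.loop_ne_zero)
  have hkl' : k ≠ l := fun e => by rw [e] at hkl; omega
  by_cases hl : l.val < n
  · refine kill (Diagram.gen k.val (by omega)) (Diagram.id n) ?_ (by rw [triv_gen, zero_mul])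
    refine comp_eq_self hkl' hr' ?_ fun v h1 h2 => ?_
    · have := (juxta_ll (Diagram.gen k.val (by omega)).rel (Diagram.id n).rel _ _).2
        (gen_rel_bottom (n := n) k.val (by omega))
      have e1 : (Sum.inr k : Vert (n + n)) = leftVert (Sum.inr ⟨k.val, by omega⟩) :=
        congrArg Sum.inr (Fin.ext rfl)
      have e2 : (Sum.inr l : Vert (n + n)) = leftVert (Sum.inr ⟨k.val + 1, by omega⟩) :=
        congrArg Sum.inr (Fin.ext hkl)
      rw [e1, e2]
      exact this
    · induction v using Fin.addCases with
      | left v =>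
        refine (juxta_ll (Diagram.gen k.val (by omega)).rel (Diagram.id n).rel
          (Sum.inl v) (Sum.inr v)).2 (gen_rel_straight _ _ v ?_ ?_)
        · intro e; exact h1 (Fin.ext (by simpa using e))
        · intro e; exact h2 (Fin.ext (by rw [hkl]; simpa using e))
      | right v =>
        exact (juxta_rr (Diagram.gen k.val (by omega)).rel (Diagram.id n).rel
          (Sum.inl v) (Sum.inr v)).2 rfl
  · have hk : n ≤ k.val := by omega
    refine kill (Diagram.id n) (Diagram.gen (k.val - n) (by omega)) ?_
      (by rw [triv_gen, mul_zero])
    refine comp_eq_self hkl' hr' ?_ fun v h1 h2 => ?_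
    · have := (juxta_rr (Diagram.id n).rel (Diagram.gen (k.val - n) (by omega)).rel _ _).2
        (gen_rel_bottom (n := n) (k.val - n) (by omega))
      have e1 : (Sum.inr k : Vert (n + n)) = rightVert (Sum.inr ⟨k.val - n, by omega⟩) :=
        congrArg Sum.inr (Fin.ext (by simp only [Fin.val_natAdd]; omega))
      have e2 : (Sum.inr l : Vert (n + n)) = rightVert (Sum.inr ⟨k.val - n + 1, by omega⟩) :=
        congrArg Sum.inr (Fin.ext (by simp only [Fin.val_natAdd]; omega))
      rw [e1, e2]
      exact this
    · induction v using Fin.addCases with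
      | left v =>
        exact (juxta_ll (Diagram.id n).rel (Diagram.gen (k.val - n) (by omega)).rel
          (Sum.inl v) (Sum.inr v)).2 rfl
      | right v =>
        refine (juxta_rr (Diagram.id n).rel (Diagram.gen (k.val - n) (by omega)).rel
          (Sum.inl v) (Sum.inr v)).2 (gen_rel_straight _ _ v ?_ ?_)
        · intro e; exact h1 (Fin.ext (by simp; omega))
        · intro e; exact h2 (Fin.ext (by simp; omega))

end Induced

section Leading

variable {q : ℂ} {n : ℕ}

/-- The lexicographically least colouring of the top line that occurs in the image of the extremal
vector. -/
def Diagram.leading (D : Diagram (n + n)) (i : Fin (n + n)) : Fin 2 :=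
  match D.link (Sum.inl i) with
  | Sum.inl j => if i < j then 0 else 1
  | Sum.inr k => extremalColour n k

theorem extremalColour_of_lt {k : Fin (n + n)} (h : k.val < n) : extremalColour n k = 1 := by
  have : k = Fin.castAdd n ⟨k.val, h⟩ := Fin.ext rfl
  rw [this, extremalColour, Fin.append_left]

theorem extremalColour_of_le {k : Fin (n + n)} (h : n ≤ k.val) : extremalColour n k = 0 := by
  have : k = Fin.natAdd n ⟨k.val - n, by omega⟩ := Fin.ext (by simp only [Fin.val_natAdd]; omega)
  rw [this, extremalColour, Fin.append_right]

theorem leading_of_top {D : Diagram (n + n)} {i j : Fin (n + n)}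
    (h : D.link (Sum.inl i) = Sum.inl j) : D.leading i = if i < j then 0 else 1 := by
  simp only [Diagram.leading, h]

theorem leading_of_bottom {D : Diagram (n + n)} {i k : Fin (n + n)}
    (h : D.link (Sum.inl i) = Sum.inr k) : D.leading i = extremalColour n k := by
  simp only [Diagram.leading, h]

theorem Diagram.Straddles.link {D : Diagram (n + n)} (hD : D.Straddles) {i j : Fin (n + n)}
    (h : D.link (Sum.inr i) = Sum.inr j) : (i.val < n ∧ n ≤ j.val) ∨ (j.val < n ∧ n ≤ i.val) := by
  have h1 := D.rel_link (Sum.inr i)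
  have h2 := D.link_ne (Sum.inr i)
  rw [h] at h1 h2
  rcases lt_trichotomy i j with h3 | h3 | h3
  · exact Or.inl (hD i j h3 h1)
  · exact absurd (by rw [h3]) h2
  · exact Or.inr (hD j i h3 (D.rel.symm' h1))

theorem spinCoeff_leading_ne_zero (hq : IsGeneric q) {D : Diagram (n + n)} (hD : D.Straddles) :
    spinCoeff q D D.leading (extremalColour n) ≠ 0 := by
  have h0 := hq.ne_zero
  rw [spinCoeff_eq, diagramCoeff_eq_prod, Finset.prod_ne_zero_iff]
  intro u _
  split_ifs with hu
  swap
  · exact one_ne_zero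
  rcases u with i | i
  · rcases hv : D.link (Sum.inl i) with j | j
    · rw [hv] at hu
      have hij : i < j := hu
      have hv' : D.link (Sum.inl j) = Sum.inl i := by rw [← hv, D.link_link]
      simp only [linkCoeff, Sum.elim_inl, leading_of_top hv, leading_of_top hv', if_pos hij,
        if_neg hij.not_gt]
      simp [deltaCoeff]
    · simp only [linkCoeff, Sum.elim_inl, Sum.elim_inr, leading_of_bottom hv]
      simp
  · rcases hv : D.link (Sum.inr i) with j | j
    · simp only [linkCoeff]
      exact one_ne_zero
    · rw [hv] at hu
      have h1 := hD.link hv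
      simp only [pos, Fin.val_rev] at hu
      simp only [linkCoeff, Sum.elim_inr]
      rw [extremalColour_of_lt (k := j) (by omega), extremalColour_of_le (k := i) (by omega)]
      simp [epsCoeff]

theorem ne_of_spinCoeff_ne_zero {m : ℕ} {D : Diagram m} {s t : Fin m → Fin 2}
    (h : spinCoeff q D s t ≠ 0) {i j : Fin m} (hij : D.link (Sum.inl i) = Sum.inl j) :
    s i ≠ s j := by
  wlog hlt : i < j generalizing i j
  · have hne : i ≠ j := by
      rintro rfl
      exact D.link_ne _ hij
    exact (this (by rw [← hij, D.link_link]) (lt_of_le_of_ne (not_lt.1 hlt) hne.symm)).symm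
  rw [spinCoeff_eq, diagramCoeff_eq_prod, Finset.prod_ne_zero_iff] at h
  have h1 := h (Sum.inl i) (Finset.mem_univ _)
  rw [hij, if_pos (show pos (Sum.inl i) < pos (Sum.inl j) from hlt)] at h1
  simp only [linkCoeff, Sum.elim_inl] at h1
  intro e
  rw [e] at h1
  apply h1
  generalize s j = a
  fin_cases a <;> simp [deltaCoeff]

theorem eq_of_spinCoeff_ne_zero {m : ℕ} {D : Diagram m} {s t : Fin m → Fin 2}
    (h : spinCoeff q D s t ≠ 0) {i j : Fin m} (hij : D.link (Sum.inl i) = Sum.inr j) :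
    s i = t j := by
  rw [spinCoeff_eq, diagramCoeff_eq_prod, Finset.prod_ne_zero_iff] at h
  have h1 := h (Sum.inl i) (Finset.mem_univ _)
  rw [hij, if_pos (by simp only [pos]; omega)] at h1
  simp only [linkCoeff, Sum.elim_inl, Sum.elim_inr] at h1
  by_contra hc
  exact h1 (if_neg hc)

theorem leading_le {D : Diagram (n + n)} {s : Fin (n + n) → Fin 2}
    (h : spinCoeff q D s (extremalColour n) ≠ 0) : toLex D.leading ≤ toLex s := by
  by_contra hc
  rw [not_le] at hc
  obtain ⟨i, hi, hlt⟩ := hc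
  simp only [Pi.toLex_apply] at hi hlt
  rcases hv : D.link (Sum.inl i) with j | j
  · have hne := ne_of_spinCoeff_ne_zero h hv
    rw [leading_of_top hv] at hlt
    by_cases hij : i < j
    · rw [if_pos hij] at hlt
      exact absurd hlt (Fin.not_lt_zero _)
    · have hji : j < i := lt_of_le_of_ne (not_lt.1 hij) fun e => D.link_ne _ (by rw [hv, e])
      have h1 := hi j hji
      have hv' : D.link (Sum.inl j) = Sum.inl i := by rw [← hv, D.link_link]
      rw [leading_of_top hv', if_pos hji] at h1
      rw [if_neg hij] at hlt
      rw [h1] at hne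
      omega
  · rw [leading_of_bottom hv, eq_of_spinCoeff_ne_zero h hv] at hlt
    exact lt_irrefl _ hlt

theorem leading_injective {D D' : Diagram (n + n)} (hD : D.Straddles) (hD' : D'.Straddles)
    (h : D.leading = D'.leading) : D = D' := by
  let p : Vert (n + n) → ℕ := fun u => if pos u < 3 * n then pos u + n else pos u - 3 * n
  have hp : Function.Injective p := by
    intro u v huv
    apply pos_inj
    have h1 := pos_lt u
    have h2 := pos_lt v
    simp only [p] at huv
    split_ifs at huv <;> omega
  have hb : ∀ u : Vert (n + n), pos u < 3 * n + n := fun u => by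
    have := pos_lt u; omega
  have p1 : ∀ i : Fin (n + n), p (Sum.inl i) = i.val + n := by
    intro i
    have h1 : pos (Sum.inl i) = i.val := rfl
    simp only [p, h1]
    rw [if_pos (by omega)]
  have p2 : ∀ i : Fin (n + n), p (Sum.inr i) =
      if i.val < n then n - 1 - i.val else 5 * n - 1 - i.val := by
    intro i
    have h1 : pos (Sum.inr i) = 4 * n - 1 - i.val := by simp only [pos, Fin.val_rev]; omega
    simp only [p, h1]
    split_ifs <;> omega
  have key : ∀ D : Diagram (n + n), D.Straddles → ∀ u, p u < p (D.link u) ↔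
      Sum.elim (fun i => D.leading i = 0) (fun k => k.val < n) u := by
    intro D hD u
    rcases u with i | i
    · rcases hv : D.link (Sum.inl i) with j | j
      · rw [p1, p1, Sum.elim_inl, leading_of_top hv]
        by_cases hij : i < j
        · rw [if_pos hij]
          rw [Fin.lt_def] at hij
          simpa using hij
        · rw [if_neg hij]
          rw [Fin.lt_def] at hij
          simpa using hij
      · rw [p1, p2, Sum.elim_inl, leading_of_bottom hv]
        by_cases hj : j.val < n
        · rw [extremalColour_of_lt hj, if_pos hj]
          simp only [one_ne_zero, iff_false]
          omega
        · rw [extremalColour_of_le (not_lt.1 hj), if_neg hj]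
          simp only [iff_true]
          omega
    · rcases hv : D.link (Sum.inr i) with j | j
      · rw [p1, p2, Sum.elim_inr]
        split_ifs with hi <;> simp only [hi, iff_true, iff_false] <;> omega
      · have h1 := hD.link hv
        rw [p2, p2, Sum.elim_inr]
        split_ifs <;> omega
  refine Diagram.eq_of_link_eq (NC.eq_of_openers hp (D.nc.rotate hb) (D'.nc.rotate hb) fun u => ?_)
  exact (key D hD u).trans ((by rw [h] : _ ↔ _).trans (key D' hD' u).symm)

theorem TL.eq_sum {m : ℕ} (x : Diagram m →₀ ℂ) :
    (x : TL q m) = ∑ D ∈ x.support, x D • diag q D :=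
  (Finsupp.sum_single x).symm.trans
    (Finset.sum_congr rfl fun D _ => (Finsupp.smul_single_one D _).symm)

/-- Linear independence of the images of the extremal vector. -/
theorem eq_zero_of_spin_extremal (hq : IsGeneric q) (x : Diagram (n + n) →₀ ℂ)
    (hx : ∀ D ∈ x.support, D.Straddles)
    (h : spin q (n + n) x (stdVec (extremalColour n)) = 0) : x = 0 := by
  by_contra hne
  have hs : x.support.Nonempty := Finsupp.support_nonempty_iff.2 hne
  obtain ⟨D, hD, hmin⟩ := x.support.exists_min_image (fun D => toLex D.leading) hs
  have h1 : spin q (n + n) x = ∑ D ∈ x.support, x D • spin q (n + n) (diag q D) := by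
    conv_lhs => rw [TL.eq_sum (q := q) x]
    simp only [map_sum, map_smul]
  have h3 := congrArg (fun y => coord (n + n) y D.leading) h
  simp only [h1, LinearMap.sum_apply, LinearMap.smul_apply, map_sum, map_smul, Finset.sum_apply,
    Pi.smul_apply, coord_spin_stdVec, map_zero, Pi.zero_apply, smul_eq_mul] at h3
  rw [Finset.sum_eq_single D] at h3
  · rcases mul_eq_zero.1 h3 with h4 | h4
    · exact Finsupp.mem_support_iff.1 hD h4
    · exact spinCoeff_leading_ne_zero hq (hx D hD) h4
  · intro D' hD' hne'
    by_contra hc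
    have h4 := leading_le (right_ne_zero_of_mul hc)
    have h5 := hmin D' hD'
    exact hne' (leading_injective (hx D' hD') (hx D hD)
      (toLex.injective (le_antisymm h4 h5)))
  · intro h'; exact absurd hD h'

theorem exists_add_of_support {α M : Type*} [AddCommMonoid M] (P : α → Prop) (x : α →₀ M) :
    ∃ y w : α →₀ M, x = y + w ∧ (∀ a ∈ y.support, P a) ∧ ∀ a ∈ w.support, ¬ P a := by
  classical
  refine ⟨x.filter P, x.filter fun a => ¬ P a, (Finsupp.filter_add_filter_not x _).symm,
    fun a ha => ?_, fun a ha => ?_⟩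
  · rw [Finsupp.support_filter] at ha
    exact (Finset.mem_filter.1 ha).2
  · rw [Finsupp.support_filter] at ha
    exact (Finset.mem_filter.1 ha).2

theorem indEmbed_injective (hq : IsGeneric q) : Function.Injective (indEmbed hq n) := by
  classical
  rw [injective_iff_map_eq_zero]
  intro z hz
  obtain ⟨x, rfl⟩ := indMkLin_surjective z
  obtain ⟨y, w, rfl, hy, hw⟩ : ∃ y w : TL q (n + n), x = y + w ∧
      (∀ D ∈ Finsupp.support (α := Diagram (n + n)) (M := ℂ) y, Diagram.Straddles D) ∧
      ∀ D ∈ Finsupp.support (α := Diagram (n + n)) (M := ℂ) w, ¬ Diagram.Straddles D :=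
    exists_add_of_support (M := ℂ) (Diagram.Straddles (n := n)) x
  have h1 : indMkLin q n w = 0 := by
    rw [TL.eq_sum (q := q) w, map_sum]
    refine Finset.sum_eq_zero fun D hD => ?_
    rw [map_smul, indMkLin_eq_zero hq (hw D hD), smul_zero]
  rw [map_add, h1, add_zero] at hz ⊢
  have h2 : y = 0 := by
    refine eq_zero_of_spin_extremal hq y hy ?_
    rwa [indMkLin_apply, indEmbed_indMk, one_smul] at hz
  rw [h2, map_zero]

theorem indEmbed_bend (hq : IsGeneric q) (x : TL q n) :
    indEmbed hq n (bend q n x) = phi hq n (spin q n x) := by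
  have : indEmbed hq n ∘ₗ bend q n = (phi hq n).toLinearMap ∘ₗ spin q n := by
    refine TL.hom_ext fun D => ?_
    change indEmbed hq n (bend q n (diag q D)) = phi hq n (spin q n (diag q D))
    rw [bend, linExt_diag, indEmbed_indMk, one_smul, spin_bend hq]
  exact congrArg (fun f => f x) this

theorem straddles_nested : (Diagram.nested n).Straddles := by
  intro i j hij h
  rw [nested_rel_bot] at h
  rcases h with rfl | rfl
  · exact absurd hij (lt_irrefl _)
  · rw [Fin.lt_def] at hij
    simp only [Fin.val_rev] at hij ⊢
    omega

theorem straddles_comp_nested (D : Diagram (n + n)) : (D.comp (Diagram.nested n)).Straddles := by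
  intro i j hij h
  have h1 : (D.comp (Diagram.nested n)).rel (Sum.inr i) (Sum.inr i.rev) :=
    Relation.EqvGen.rel _ _ (Or.inr ⟨Sum.inr i, Sum.inr i.rev,
      (nested_rel_bot _ _).2 (Or.inr rfl), rfl, rfl⟩)
  have h2 := Diagram.link_eq_of_rel _ (fun e => hij.ne (Sum.inr_injective e).symm) h
  have h3 := Diagram.link_eq_of_rel _ (fun e => by
    have := congrArg Fin.val (Sum.inr_injective e)
    simp only [Fin.val_rev] at this
    omega) h1
  rw [h2] at h3
  rw [Sum.inr_injective h3] at hij ⊢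
  rw [Fin.lt_def] at hij
  simp only [Fin.val_rev] at hij ⊢
  omega

theorem spin_injective (hq : IsGeneric q) : Function.Injective (spin q n) := by
  rw [injective_iff_map_eq_zero]
  intro x hx
  let J : TL q n →ₗ[ℂ] TL q (n + n) := Finsupp.lmapDomain ℂ ℂ fun D : Diagram n =>
    (D.juxta (Diagram.id n)).comp (Diagram.nested n)
  have hJ : ∀ D, J (diag q D) = diag q ((D.juxta (Diagram.id n)).comp (Diagram.nested n)) :=
    fun D => Finsupp.mapDomain_single
  have h1 : (LinearMap.applyₗ (stdVec (extremalColour n)) ∘ₗ spin q (n + n)) ∘ₗ J =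
      (phi hq n).toLinearMap ∘ₗ spin q n := by
    refine TL.hom_ext fun D => ?_
    rw [LinearMap.comp_apply, hJ, ← juxta_id_mul_nested]
    exact spin_bend hq D
  have h2 : spin q (n + n) (J x) (stdVec (extremalColour n)) = 0 := by
    refine (congrArg (fun f => f x) h1).trans ?_
    change phi hq n (spin q n x) = 0
    rw [hx, map_zero]
  have h3 : (J x : Diagram (n + n) →₀ ℂ) = 0 := by
    classical
    refine eq_zero_of_spin_extremal hq _ (fun D hD => ?_) h2
    obtain ⟨D', -, rfl⟩ := Finset.mem_image.1 (Finsupp.mapDomain_support hD)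
    exact straddles_comp_nested _
  exact Finsupp.mapDomain_injective comp_nested_injective
    (h3.trans (Finsupp.mapDomain_zero (f := fun D : Diagram n =>
      (D.juxta (Diagram.id n)).comp (Diagram.nested n))).symm)

theorem bend_injective (hq : IsGeneric q) : Function.Injective (bend q n) := by
  intro x y h
  apply spin_injective hq
  apply (phi hq n).injective
  rw [← indEmbed_bend, ← indEmbed_bend, h]

theorem indMk_nested_ne_zero (hq : IsGeneric q) :
    indMk q n n (diag q (Diagram.nested n)) 1 ≠ 0 := by
  intro h
  have h1 := congrArg (indEmbed hq n) h
  rw [indEmbed_indMk, one_smul, map_zero] at h1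
  have h2 := congrArg (fun y => coord (n + n) y (Diagram.nested n).leading) h1
  simp only [coord_spin_stdVec, map_zero, Pi.zero_apply] at h2
  exact spinCoeff_leading_ne_zero hq straddles_nested h2

theorem eq_nested_of_indMk_ne_zero (hq : IsGeneric q) (D : Diagram (n + n))
    (hD : ∀ i, D.rel (Sum.inl i) (Sum.inl i.rev))
    (h : indMk q n n (diag q D) 1 ≠ 0) : D = Diagram.nested n := by
  have h1 : D.Straddles := by
    by_contra hc
    exact h (indMkLin_eq_zero hq hc)
  refine leading_injective h1 straddles_nested (funext fun i => ?_)
  have hne : (Sum.inl i.rev : Vert (n + n)) ≠ Sum.inl i := fun e => by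
    have := congrArg Fin.val (Sum.inl_injective e)
    simp only [Fin.val_rev] at this
    omega
  rw [leading_of_top (D.link_eq_of_rel hne (hD i)),
    leading_of_top ((Diagram.nested n).link_eq_of_rel hne ((nested_rel_top _ _).2 (Or.inr rfl)))]

end Leading

namespace Uq

variable {q : ℂ}

section Lift

variable {B : Type} [Ring B] [Algebra ℂ B] {e f k k' : B} {h1 : k * k' = 1} {h2 : k' * k = 1}
  {h3 : k * e = q ^ 2 • (e * k)} {h4 : k * f = (q ^ 2)⁻¹ • (f * k)}
  {h5 : e * f - f * e = (q - q⁻¹)⁻¹ • (k - k')}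

theorem lift_E : lift e f k k' h1 h2 h3 h4 h5 (E q) = e :=
  (RingQuot.liftAlgHom_mkAlgHom_apply ℂ _ _ _).trans (FreeAlgebra.lift_ι_apply _ _)

theorem lift_F : lift e f k k' h1 h2 h3 h4 h5 (F q) = f :=
  (RingQuot.liftAlgHom_mkAlgHom_apply ℂ _ _ _).trans (FreeAlgebra.lift_ι_apply _ _)

theorem lift_K : lift e f k k' h1 h2 h3 h4 h5 (K q) = k :=
  (RingQuot.liftAlgHom_mkAlgHom_apply ℂ _ _ _).trans (FreeAlgebra.lift_ι_apply _ _)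

theorem lift_Kinv : lift e f k k' h1 h2 h3 h4 h5 (Kinv q) = k' :=
  (RingQuot.liftAlgHom_mkAlgHom_apply ℂ _ _ _).trans (FreeAlgebra.lift_ι_apply _ _)

end Lift

/-- The skew-primitive elements `E` and `q F K⁻¹`; they have the same comultiplication. -/
def shift (q : ℂ) (a : Fin 2) : Uq q := if a = 0 then E q else q • (F q * Kinv q)

theorem shift_zero : shift q 0 = E q := rfl

theorem F_eq (hq : IsGeneric q) : F q = q⁻¹ • (shift q 1 * K q) := by
  rw [shift, if_neg one_ne_zero, smul_mul_assoc, smul_smul, inv_mul_cancel₀ hq.ne_zero, one_smul,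
    mul_assoc, Kinv_mul_K, mul_one]

theorem comul_K (hq : IsGeneric q) : comul hq (K q) = K q ⊗ₜ K q := lift_K

theorem comul_Kinv (hq : IsGeneric q) : comul hq (Kinv q) = Kinv q ⊗ₜ Kinv q := lift_Kinv

theorem comul_shift (hq : IsGeneric q) (a : Fin 2) :
    comul hq (shift q a) = shift q a ⊗ₜ 1 + Kinv q ⊗ₜ shift q a := by
  fin_cases a
  · exact lift_E
  · simp only [Fin.mk_one, shift, if_neg one_ne_zero, map_smul, map_mul, comul_Kinv]
    rw [comul, lift_F]
    simp only [add_mul, Algebra.TensorProduct.tmul_mul_tmul, K_mul_Kinv, one_mul, smul_add,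
      TensorProduct.smul_tmul', TensorProduct.tmul_smul]

theorem antipode_K (hq : IsGeneric q) : antipode hq (K q) = MulOpposite.op (Kinv q) := lift_K

theorem antipode_Kinv (hq : IsGeneric q) : antipode hq (Kinv q) = MulOpposite.op (K q) := lift_Kinv

theorem antipode_shift (hq : IsGeneric q) (a : Fin 2) :
    antipode hq (shift q a) = MulOpposite.op (-(K q * shift q a)) := by
  fin_cases a
  · exact lift_E
  · simp only [Fin.mk_one, shift, if_neg one_ne_zero, map_smul, map_mul, antipode_Kinv]
    rw [antipode, lift_F, ← MulOpposite.op_mul, ← MulOpposite.op_smul]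
    congr 1
    rw [mul_neg, mul_smul_comm, smul_neg]

theorem counit_K : counit q (K q) = 1 := lift_K

theorem counit_Kinv : counit q (Kinv q) = 1 := lift_Kinv

theorem counit_shift (a : Fin 2) : counit q (shift q a) = 0 := by
  fin_cases a
  · exact lift_E
  · simp only [Fin.mk_one, shift, if_neg one_ne_zero, map_smul, map_mul]
    rw [counit, lift_F, zero_mul, smul_zero]

theorem induction (hq : IsGeneric q) {P : Uq q → Prop} (scalar : ∀ c, P (algebraMap ℂ _ c))
    (add : ∀ x y, P x → P y → P (x + y)) (mul : ∀ x y, P x → P y → P (x * y))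
    (shift : ∀ a, P (shift q a)) (K : P (K q)) (Kinv : P (Kinv q)) (u : Uq q) : P u := by
  obtain ⟨z, rfl⟩ := RingQuot.mkAlgHom_surjective ℂ (UqRel q) u
  induction z using FreeAlgebra.induction with
  | grade0 r =>
    rw [AlgHom.commutes]
    exact scalar r
  | grade1 x =>
    cases x
    · exact shift 0
    · change P (Uq.F q)
      rw [F_eq hq, Algebra.smul_def]
      exact mul _ _ (scalar _) (mul _ _ (shift 1) K)
    · exact K
    · exact Kinv
  | mul a b ha hb =>
    rw [map_mul]
    exact mul _ _ ha hb
  | add a b ha hb =>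
    rw [map_add]
    exact add _ _ ha hb

end Uq

section Operators

variable {q : ℂ} {m n : ℕ}

/-- The eigenvalue of `K` on a basis vector of `ℂ²`. -/
def weightFactor (q : ℂ) (a : Fin 2) : ℂ := if a = 0 then q else q⁻¹

theorem weightFactor_ne_zero (hq : IsGeneric q) (a : Fin 2) : weightFactor q a ≠ 0 := by
  have := hq.ne_zero
  unfold weightFactor
  split_ifs <;> simpa

/-- The eigenvalue of `K⁻¹` on the first `m` factors. -/
def invWeight (q : ℂ) (m : ℕ) (c : ℕ → Fin 2) : ℂ :=
  ∏ i ∈ Finset.range m, (weightFactor q (c i))⁻¹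

/-- The action of `E` (for `a = 0`) and `q F K⁻¹` (for `a = 1`) on coordinate functions. -/
def shiftOp (q : ℂ) (a : Fin 2) (m : ℕ) (φ : (ℕ → Fin 2) → ℂ) (c : ℕ → Fin 2) : ℂ :=
  ∑ j ∈ Finset.range m,
    (if c j = a then invWeight q j c else 0) * φ (Function.update c j (1 - a))

/-- The coordinate function of a tensor, on colourings of `ℕ`. -/
def coordFun (m : ℕ) (x : TP m) (c : ℕ → Fin 2) : ℂ := coord m x fun i => c i

theorem coordFun_add (x y : TP m) (c : ℕ → Fin 2) :
    coordFun m (x + y) c = coordFun m x c + coordFun m y c := by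
  simp only [coordFun, map_add, Pi.add_apply]

theorem coordFun_smul (r : ℂ) (x : TP m) (c : ℕ → Fin 2) :
    coordFun m (r • x) c = r * coordFun m x c := by
  simp only [coordFun, map_smul, Pi.smul_apply, smul_eq_mul]

theorem coordFun_ext {x y : TP m} (h : ∀ c, coordFun m x c = coordFun m y c) : x = y := by
  refine coord_ext fun s => ?_
  have h1 := h fun i => if hi : i < m then s ⟨i, hi⟩ else 0
  simpa [coordFun] using h1

theorem coordFun_congr (x : TP m) {c d : ℕ → Fin 2} (h : ∀ i < m, c i = d i) :
    coordFun m x c = coordFun m x d := by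
  rw [coordFun, coordFun]
  exact congrArg _ (funext fun i => h i i.2)

theorem coordFun_tpSucc (x : TP m) (v : V2) (c : ℕ → Fin 2) :
    coordFun (m + 1) (tpSucc m (x ⊗ₜ v)) c = coordFun m x c * v (c m) := by
  have h1 : (fun i : Fin (m + 1) => c i) =
      Fin.append (fun i : Fin m => c i) (fun _ : Fin 1 => c m) := by
    funext i
    refine Fin.addCases (fun i => ?_) (fun i => ?_) i
    · rw [Fin.append_left]; rfl
    · rw [Fin.append_right]
      congr 1
      simp
  rw [coordFun, h1, tpSucc, LinearEquiv.trans_apply, TensorProduct.congr_tmul, coord_mulEquiv]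
  congr 1
  rw [PiTensorProduct.subsingletonEquiv_symm_apply', coord_tprod]
  simp

theorem vecRep_K (hq : IsGeneric q) (v : V2) (a : Fin 2) :
    vecRep hq (Uq.K q) v a = weightFactor q a * v a := by
  simp only [vecRep, AlgHom.comp_apply, Uq.lift_K]
  change Matrix.toLin' _ v a = _
  rw [Matrix.toLin'_apply]
  fin_cases a <;> simp [weightFactor, Matrix.mulVec, dotProduct, Fin.sum_univ_two]

theorem vecRep_Kinv (hq : IsGeneric q) (v : V2) (a : Fin 2) :
    vecRep hq (Uq.Kinv q) v a = (weightFactor q a)⁻¹ * v a := by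
  simp only [vecRep, AlgHom.comp_apply, Uq.lift_Kinv]
  change Matrix.toLin' _ v a = _
  rw [Matrix.toLin'_apply]
  fin_cases a <;> simp [weightFactor, Matrix.mulVec, dotProduct, Fin.sum_univ_two]

theorem vecRep_shift (hq : IsGeneric q) (a : Fin 2) (v : V2) (b : Fin 2) :
    vecRep hq (Uq.shift q a) v b = if b = a then v (1 - a) else 0 := by
  have h0 := hq.ne_zero
  fin_cases a
  · simp only [Fin.zero_eta, Uq.shift_zero, vecRep, AlgHom.comp_apply, Uq.lift_E]
    change Matrix.toLin' _ v b = _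
    rw [Matrix.toLin'_apply]
    fin_cases b <;> simp [Matrix.mulVec, dotProduct, Fin.sum_univ_two]
  · simp only [Fin.mk_one, Uq.shift, if_neg one_ne_zero, map_smul, map_mul, LinearMap.smul_apply,
      Module.End.mul_apply]
    have h1 : ∀ w : V2, vecRep hq (Uq.F q) w b = if b = 1 then w 0 else 0 := by
      intro w
      simp only [vecRep, AlgHom.comp_apply, Uq.lift_F]
      change Matrix.toLin' _ w b = _
      rw [Matrix.toLin'_apply]
      fin_cases b <;> simp [Matrix.mulVec, dotProduct, Fin.sum_univ_two]
    rw [Pi.smul_apply, h1, vecRep_Kinv, sub_self]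
    split_ifs <;> simp [weightFactor, h0]

theorem tensorRep_tpSucc (hq : IsGeneric q) (u : Uq q) (z : TP m ⊗[ℂ] V2) :
    tensorRep hq (m + 1) u (tpSucc m z) = tpSucc m
      (Module.endTensorEndAlgHom (R := ℂ) (S := ℂ) (A := ℂ)
        (Algebra.TensorProduct.map (tensorRep hq m) (vecRep hq) (Uq.comul hq u)) z) := by
  refine (LinearEquiv.conj_apply_apply (tpSucc m) _ _).trans ?_
  rw [LinearEquiv.symm_apply_apply]
  rfl

theorem tensorRep_K_tmul (hq : IsGeneric q) (x : TP m) (v : V2) :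
    tensorRep hq (m + 1) (Uq.K q) (tpSucc m (x ⊗ₜ v)) =
      tpSucc m (tensorRep hq m (Uq.K q) x ⊗ₜ vecRep hq (Uq.K q) v) := by
  rw [tensorRep_tpSucc, Uq.comul_K]
  rfl

theorem tensorRep_Kinv_tmul (hq : IsGeneric q) (x : TP m) (v : V2) :
    tensorRep hq (m + 1) (Uq.Kinv q) (tpSucc m (x ⊗ₜ v)) =
      tpSucc m (tensorRep hq m (Uq.Kinv q) x ⊗ₜ vecRep hq (Uq.Kinv q) v) := by
  rw [tensorRep_tpSucc, Uq.comul_Kinv]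
  rfl

theorem tensorRep_shift_tmul (hq : IsGeneric q) (a : Fin 2) (x : TP m) (v : V2) :
    tensorRep hq (m + 1) (Uq.shift q a) (tpSucc m (x ⊗ₜ v)) =
      tpSucc m (tensorRep hq m (Uq.shift q a) x ⊗ₜ v +
        tensorRep hq m (Uq.Kinv q) x ⊗ₜ vecRep hq (Uq.shift q a) v) := by
  rw [tensorRep_tpSucc, Uq.comul_shift, map_add, map_add, LinearMap.add_apply,
    Algebra.TensorProduct.map_tmul, Algebra.TensorProduct.map_tmul, map_one]
  rfl

theorem tpSucc_induction {P : TP (m + 1) → Prop} (x : TP (m + 1))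
    (tmul : ∀ x v, P (tpSucc m (x ⊗ₜ v))) (add : ∀ x y, P x → P y → P (x + y)) : P x := by
  obtain ⟨z, rfl⟩ := (tpSucc m).surjective x
  induction z using TensorProduct.induction_on with
  | zero => rw [← TensorProduct.zero_tmul (TP m) (0 : V2)]; exact tmul _ _
  | tmul x v => exact tmul x v
  | add x y hx hy => rw [map_add]; exact add _ _ hx hy

theorem coordFun_K (hq : IsGeneric q) (x : TP m) (c : ℕ → Fin 2) :
    coordFun m (tensorRep hq m (Uq.K q) x) c = (invWeight q m c)⁻¹ * coordFun m x c := by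
  induction m with
  | zero =>
    change coordFun 0 (Uq.counit q (Uq.K q) • x) c = _
    simp [Uq.counit_K, invWeight]
  | succ m ih =>
    induction x using tpSucc_induction with
    | tmul x v =>
      rw [tensorRep_K_tmul, coordFun_tpSucc, coordFun_tpSucc, ih, vecRep_K, invWeight, invWeight,
        Finset.prod_range_succ, mul_inv, inv_inv]
      ring
    | add x y hx hy => rw [map_add, coordFun_add, coordFun_add, hx, hy, mul_add]

theorem coordFun_Kinv (hq : IsGeneric q) (x : TP m) (c : ℕ → Fin 2) :
    coordFun m (tensorRep hq m (Uq.Kinv q) x) c = invWeight q m c * coordFun m x c := by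
  induction m with
  | zero =>
    change coordFun 0 (Uq.counit q (Uq.Kinv q) • x) c = _
    simp [Uq.counit_Kinv, invWeight]
  | succ m ih =>
    induction x using tpSucc_induction with
    | tmul x v =>
      rw [tensorRep_Kinv_tmul, coordFun_tpSucc, coordFun_tpSucc, ih, vecRep_Kinv, invWeight,
        invWeight, Finset.prod_range_succ]
      ring
    | add x y hx hy => rw [map_add, coordFun_add, coordFun_add, hx, hy, mul_add]

theorem shiftOp_succ (a : Fin 2) (φ : (ℕ → Fin 2) → ℂ) (c : ℕ → Fin 2) :
    shiftOp q a (m + 1) φ c = shiftOp q a m φ c +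
      (if c m = a then invWeight q m c else 0) * φ (Function.update c m (1 - a)) :=
  Finset.sum_range_succ _ _

theorem coordFun_shift (hq : IsGeneric q) (a : Fin 2) (x : TP m) (c : ℕ → Fin 2) :
    coordFun m (tensorRep hq m (Uq.shift q a) x) c = shiftOp q a m (coordFun m x) c := by
  induction m with
  | zero =>
    change coordFun 0 (Uq.counit q (Uq.shift q a) • x) c = _
    rw [Uq.counit_shift, coordFun_smul, zero_mul]
    exact Finset.sum_range_zero _ |>.symm
  | succ m ih =>
    induction x using tpSucc_induction with
    | tmul x v =>
      rw [tensorRep_shift_tmul, map_add, coordFun_add, coordFun_tpSucc, coordFun_tpSucc, ih,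
        coordFun_Kinv, vecRep_shift, shiftOp_succ, coordFun_tpSucc, Function.update_self,
        coordFun_congr (m := m) x (c := Function.update c m (1 - a)) (d := c)
          fun i hi => Function.update_of_ne hi.ne _ _]
      congr 1
      · rw [shiftOp, shiftOp, Finset.sum_mul]
        refine Finset.sum_congr rfl fun j hj => ?_
        rw [coordFun_tpSucc, Function.update_of_ne (Finset.mem_range.1 hj).ne', mul_assoc]
      · split_ifs <;> ring
    | add x y hx hy =>
      rw [map_add, coordFun_add, hx, hy]
      simp only [shiftOp, coordFun_add, mul_add, Finset.sum_add_distrib]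

end Operators

section Cups

variable {q : ℂ}

/-- The increasing map of `ℕ` that leaves out `k` and `k + 1`. -/
def skip (k i : ℕ) : ℕ := if i < k then i else i + 2

@[to_additive]
theorem prod_range_skip {M : Type*} [CommMonoid M] {k N : ℕ} (hk : k ≤ N) (g : ℕ → M) :
    ∏ j ∈ Finset.range (N + 2), g j =
      g k * g (k + 1) * ∏ i ∈ Finset.range N, g (skip k i) := by
  obtain ⟨r, rfl⟩ := Nat.exists_eq_add_of_le hk
  have h1 : ∏ i ∈ Finset.range k, g (skip k i) = ∏ i ∈ Finset.range k, g i :=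
    Finset.prod_congr rfl fun i hi => by rw [skip, if_pos (Finset.mem_range.1 hi)]
  have h2 : ∏ i ∈ Finset.range r, g (skip k (k + i)) = ∏ i ∈ Finset.range r, g (k + (i + 1 + 1)) :=
    Finset.prod_congr rfl fun i _ => by rw [skip, if_neg (by omega)]; rfl
  rw [Finset.prod_range_add (fun i => g (skip k i)), h1, h2, add_assoc, Finset.prod_range_add,
    Finset.prod_range_succ', Finset.prod_range_succ', add_zero, zero_add]
  ac_rfl

theorem skip_ne (k i : ℕ) : skip k i ≠ k ∧ skip k i ≠ k + 1 := by
  unfold skip; split_ifs <;> omega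

theorem skip_injective (k : ℕ) : Function.Injective (skip k) := by
  intro i j h
  unfold skip at h
  split_ifs at h <;> omega

/-- The coordinate functions of products of cups, built by inserting one cup at a time. -/
inductive CupForm (q : ℂ) : ℕ → ((ℕ → Fin 2) → ℂ) → Prop
  | nil : CupForm q 0 fun _ => 1
  | insert {N k : ℕ} {ψ : (ℕ → Fin 2) → ℂ} (hk : k ≤ N) (h : CupForm q N ψ) :
      CupForm q (N + 2) fun c => deltaCoeff q (c k) (c (k + 1)) * ψ (c ∘ skip k)

theorem weightFactor_mul_deltaCoeff (hq : IsGeneric q) (a b : Fin 2) :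
    (weightFactor q a)⁻¹ * (weightFactor q b)⁻¹ * deltaCoeff q a b = deltaCoeff q a b := by
  have := hq.ne_zero
  fin_cases a <;> fin_cases b <;> simp [weightFactor, deltaCoeff, this]

theorem shift_deltaCoeff (hq : IsGeneric q) (a x y : Fin 2) :
    (if x = a then 1 else 0) * deltaCoeff q (1 - a) y +
      (if y = a then 1 else 0) * ((weightFactor q x)⁻¹ * deltaCoeff q x (1 - a)) = 0 := by
  have := hq.ne_zero
  fin_cases a <;> fin_cases x <;> fin_cases y <;> simp [weightFactor, deltaCoeff, this]

theorem invWeight_skip {k N : ℕ} (hk : k ≤ N) (c : ℕ → Fin 2) :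
    invWeight q (N + 2) c =
      (weightFactor q (c k))⁻¹ * (weightFactor q (c (k + 1)))⁻¹ * invWeight q N (c ∘ skip k) :=
  prod_range_skip hk _

theorem CupForm.invWeight (hq : IsGeneric q) {N : ℕ} {ψ : (ℕ → Fin 2) → ℂ} (h : CupForm q N ψ)
    (c : ℕ → Fin 2) : invWeight q N c * ψ c = ψ c := by
  induction h generalizing c with
  | nil => simp [TLDiag.invWeight]
  | @insert N k ψ hk h ih =>
    rw [invWeight_skip hk]
    have h1 := weightFactor_mul_deltaCoeff hq (c k) (c (k + 1))
    have h2 := ih (c ∘ skip k)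
    calc _ = ((weightFactor q (c k))⁻¹ * (weightFactor q (c (k + 1)))⁻¹ *
          deltaCoeff q (c k) (c (k + 1))) *
          (TLDiag.invWeight q N (c ∘ skip k) * ψ (c ∘ skip k)) := by ring
      _ = _ := by rw [h1, h2]

theorem CupForm.shiftOp (hq : IsGeneric q) (a : Fin 2) {N : ℕ} {ψ : (ℕ → Fin 2) → ℂ}
    (h : CupForm q N ψ) (c : ℕ → Fin 2) : shiftOp q a N ψ c = 0 := by
  induction h generalizing c with
  | nil => exact Finset.sum_range_zero _
  | @insert N k ψ hk h ih =>
    rw [TLDiag.shiftOp, sum_range_skip hk]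
    have h1 : ∀ i ∈ Finset.range N, (if c (skip k i) = a then TLDiag.invWeight q (skip k i) c else 0) *
        (deltaCoeff q (Function.update c (skip k i) (1 - a) k)
          (Function.update c (skip k i) (1 - a) (k + 1)) *
          ψ (Function.update c (skip k i) (1 - a) ∘ skip k)) =
        deltaCoeff q (c k) (c (k + 1)) *
        ((if (c ∘ skip k) i = a then TLDiag.invWeight q i (c ∘ skip k) else 0) *
          ψ (Function.update (c ∘ skip k) i (1 - a))) := by
      intro i _
      rw [Function.update_of_ne (skip_ne k i).1.symm, Function.update_of_ne (skip_ne k i).2.symm,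
        Function.update_comp_eq_of_injective _ (skip_injective k)]
      have h2 : TLDiag.invWeight q (skip k i) c * deltaCoeff q (c k) (c (k + 1)) =
          TLDiag.invWeight q i (c ∘ skip k) * deltaCoeff q (c k) (c (k + 1)) := by
        by_cases hi : i < k
        · congr 1
          rw [skip, if_pos hi]
          refine Finset.prod_congr rfl fun j hj => ?_
          rw [Function.comp_apply, skip, if_pos ((Finset.mem_range.1 hj).trans hi)]
        · rw [skip, if_neg hi, invWeight_skip (not_lt.1 hi)]
          conv_rhs => rw [← weightFactor_mul_deltaCoeff hq]
          ring
      simp only [Function.comp_apply]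
      split_ifs
      · linear_combination ψ (Function.update (c ∘ skip k) i (1 - a)) * h2
      · ring
    have h3 : ∀ j, j = k ∨ j = k + 1 → Function.update c j (1 - a) ∘ skip k = c ∘ skip k := by
      rintro j hj
      refine Function.update_comp_eq_of_notMem_range _ _ ?_
      rintro ⟨i, rfl⟩
      have := skip_ne k i
      omega
    rw [Finset.sum_congr rfl h1, ← Finset.mul_sum]
    change _ + deltaCoeff q (c k) (c (k + 1)) * TLDiag.shiftOp q a N ψ (c ∘ skip k) = 0
    rw [ih, h3 k (Or.inl rfl), h3 (k + 1) (Or.inr rfl), Function.update_self, Function.update_self,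
      Function.update_of_ne (by omega), Function.update_of_ne (by omega), TLDiag.invWeight,
      TLDiag.invWeight, Finset.prod_range_succ]
    have h4 := shift_deltaCoeff hq a (c k) (c (k + 1))
    generalize ∏ i ∈ Finset.range k, (weightFactor q (c i))⁻¹ = P
    calc _ = P * ψ (c ∘ skip k) * ((if c k = a then 1 else 0) * deltaCoeff q (1 - a) (c (k + 1)) +
          (if c (k + 1) = a then 1 else 0) *
            ((weightFactor q (c k))⁻¹ * deltaCoeff q (c k) (1 - a))) := by
          split_ifs <;> ring
      _ = 0 := by rw [h4, mul_zero]

theorem cupForm_nested (n : ℕ) : CupForm q (n + n) fun c =>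
    ∏ j ∈ Finset.range n, deltaCoeff q (c (n - 1 - j)) (c (n + j)) := by
  induction n with
  | zero => simpa using CupForm.nil
  | succ n ih =>
    have h := CupForm.insert (k := n) (by omega) ih
    rw [show n + 1 + (n + 1) = n + n + 2 by ring]
    convert h using 2 with c
    rw [Finset.prod_range_succ', mul_comm]
    congr 1
    refine Finset.prod_congr rfl fun j hj => ?_
    have hj' := Finset.mem_range.1 hj
    simp only [Function.comp_apply, skip]
    rw [if_pos (by omega), if_neg (by omega)]
    congr 2 <;> omega

end Cups

section PhiLinear

variable {q : ℂ} {n : ℕ}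

/-- The slices of the image of the identity under `phi`. -/
def capVec (q : ℂ) (n : ℕ) (c : ℕ → Fin 2) : TP n :=
  ∑ t, (∏ j : Fin n, deltaCoeff q (t j.rev) (c (n + j))) • stdVec t

theorem coordFun_phi (hq : IsGeneric q) (T : Module.End ℂ (TP n)) (c : ℕ → Fin 2) :
    coordFun (n + n) (phi hq n T) c = coordFun n (T (capVec q n c)) c := by
  have h1 : (fun i : Fin (n + n) => c i) =
      Fin.append (fun i : Fin n => c i) (fun i : Fin n => c (n + i)) := by
    funext i
    refine Fin.addCases (fun i => ?_) (fun i => ?_) i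
    · rw [Fin.append_left]; rfl
    · rw [Fin.append_right]; rfl
  rw [coordFun, h1, coord_phi, coordFun, capVec]
  simp only [map_sum, map_smul, Finset.sum_apply, Pi.smul_apply, smul_eq_mul]
  exact Finset.sum_congr rfl fun t _ => mul_comm _ _

theorem coordFun_capVec (c s : ℕ → Fin 2) : coordFun n (capVec q n c) s =
    ∏ j ∈ Finset.range n, deltaCoeff q (s (n - 1 - j)) (c (n + j)) := by
  rw [coordFun, capVec]
  simp only [map_sum, map_smul, Finset.sum_apply, Pi.smul_apply, coord_stdVec, smul_eq_mul]
  rw [Finset.prod_range]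
  simp only [mul_ite, mul_one, mul_zero, Finset.sum_ite_eq, Finset.mem_univ, if_true]
  refine Finset.prod_congr rfl fun j _ => ?_
  rw [Fin.val_rev]
  congr 2
  omega

/-- The colouring `s` on the first `n` points, and `c` on the others. -/
def splice (n : ℕ) (s c : ℕ → Fin 2) (i : ℕ) : Fin 2 := if i < n then s i else c i

theorem coordFun_capVec_splice (c s : ℕ → Fin 2) : coordFun n (capVec q n c) s =
    ∏ j ∈ Finset.range n, deltaCoeff q (splice n s c (n - 1 - j)) (splice n s c (n + j)) := by
  rw [coordFun_capVec]
  refine Finset.prod_congr rfl fun j hj => ?_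
  have := Finset.mem_range.1 hj
  rw [splice, splice, if_pos (by omega), if_neg (by omega)]

/-- The eigenvalue of `K⁻¹` on the factors from `n` to `n + j`. -/
def tailWeight (q : ℂ) (n j : ℕ) (c : ℕ → Fin 2) : ℂ :=
  ∏ i ∈ Finset.range j, (weightFactor q (c (n + i)))⁻¹

theorem invWeight_add (j : ℕ) (c : ℕ → Fin 2) :
    invWeight q (n + j) c = invWeight q n c * tailWeight q n j c :=
  Finset.prod_range_add _ _ _

theorem shiftOp_add (a : Fin 2) (k : ℕ) (φ : (ℕ → Fin 2) → ℂ) (c : ℕ → Fin 2) :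
    shiftOp q a (n + k) φ c = shiftOp q a n φ c + invWeight q n c * ∑ j ∈ Finset.range k,
      (if c (n + j) = a then tailWeight q n j c else 0) *
        φ (Function.update c (n + j) (1 - a)) := by
  rw [shiftOp, Finset.sum_range_add, Finset.mul_sum]
  congr 1
  refine Finset.sum_congr rfl fun j _ => ?_
  rw [invWeight_add]
  split_ifs <;> ring

/-- The action of `E` or `q F K⁻¹` on the last `n` factors of the slices. -/
def shiftCapVec (q : ℂ) (a : Fin 2) (n : ℕ) (c : ℕ → Fin 2) : TP n :=
  ∑ j ∈ Finset.range n, (if c (n + j) = a then tailWeight q n j c else 0) •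
    capVec q n (Function.update c (n + j) (1 - a))

theorem coordFun_sum {ι : Type*} (S : Finset ι) (f : ι → TP n) (c : ℕ → Fin 2) :
    coordFun n (∑ i ∈ S, f i) c = ∑ i ∈ S, coordFun n (f i) c := by
  simp only [coordFun, map_sum, Finset.sum_apply]

theorem coordFun_zero (c : ℕ → Fin 2) : coordFun n 0 c = 0 := by
  simp only [coordFun, map_zero, Pi.zero_apply]

theorem tailWeight_ne_zero (hq : IsGeneric q) (j : ℕ) (c : ℕ → Fin 2) :
    tailWeight q n j c ≠ 0 :=
  Finset.prod_ne_zero_iff.2 fun _ _ => inv_ne_zero (weightFactor_ne_zero hq _)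

theorem invWeight_splice (s c : ℕ → Fin 2) :
    invWeight q n (splice n s c) = invWeight q n s :=
  Finset.prod_congr rfl fun i hi => by rw [splice, if_pos (Finset.mem_range.1 hi)]

theorem tailWeight_splice (j : ℕ) (s c : ℕ → Fin 2) :
    tailWeight q n j (splice n s c) = tailWeight q n j c :=
  Finset.prod_congr rfl fun i _ => by rw [splice, if_neg (by omega)]

theorem Kinv_capVec (hq : IsGeneric q) (c : ℕ → Fin 2) :
    tensorRep hq n (Uq.Kinv q) (capVec q n c) = (tailWeight q n n c)⁻¹ • capVec q n c := by
  refine coordFun_ext fun s => ?_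
  rw [coordFun_Kinv, coordFun_smul, coordFun_capVec_splice]
  have h := (cupForm_nested n).invWeight hq (splice n s c)
  rw [invWeight_add, invWeight_splice, tailWeight_splice] at h
  rw [eq_inv_mul_iff_mul_eq₀ (tailWeight_ne_zero hq _ _)]
  rw [← mul_assoc, mul_comm (tailWeight q n n c), h]

theorem shift_capVec (hq : IsGeneric q) (a : Fin 2) (c : ℕ → Fin 2) :
    tensorRep hq n (Uq.shift q a) (capVec q n c) +
      tensorRep hq n (Uq.Kinv q) (shiftCapVec q a n c) = 0 := by
  refine coordFun_ext fun s => ?_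
  rw [coordFun_add, coordFun_shift, coordFun_Kinv, coordFun_zero, shiftCapVec, coordFun_sum]
  have h := (cupForm_nested n).shiftOp hq a (splice n s c)
  rw [shiftOp_add, invWeight_splice] at h
  refine Eq.trans ?_ h
  congr 1
  · rw [shiftOp, shiftOp]
    refine Finset.sum_congr rfl fun j hj => ?_
    have hj' := Finset.mem_range.1 hj
    rw [coordFun_capVec_splice]
    have e1 : splice n (Function.update s j (1 - a)) c =
        Function.update (splice n s c) j (1 - a) := by
      funext i
      by_cases hi : i = j
      · subst hi; simp [splice, hj']
      · simp [splice, hi]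
    have e2 : splice n s c j = s j := if_pos hj'
    have e3 : invWeight q j (splice n s c) = invWeight q j s :=
      Finset.prod_congr rfl fun i hi => by
        rw [splice, if_pos ((Finset.mem_range.1 hi).trans hj')]
    rw [e1, e2, e3]
  · congr 1
    refine Finset.sum_congr rfl fun j _ => ?_
    rw [coordFun_smul, coordFun_capVec_splice, tailWeight_splice]
    have e1 : splice n s (Function.update c (n + j) (1 - a)) =
        Function.update (splice n s c) (n + j) (1 - a) := by
      funext i
      by_cases hi : i = n + j
      · subst hi; simp [splice]
      · simp [splice, hi]
    have e2 : splice n s c (n + j) = c (n + j) := if_neg (by omega)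
    rw [e1, e2]

theorem capVec_congr {c d : ℕ → Fin 2} (h : ∀ i, n ≤ i → c i = d i) :
    capVec q n c = capVec q n d := by
  rw [capVec, capVec]
  simp only [h _ (Nat.le_add_right n _)]

theorem coordFun_shift_phi (hq : IsGeneric q) (a : Fin 2) (T : Module.End ℂ (TP n))
    (c : ℕ → Fin 2) :
    coordFun (n + n) (tensorRep hq (n + n) (Uq.shift q a) (phi hq n T)) c =
      coordFun n (tensorRep hq n (Uq.shift q a) (T (capVec q n c)) +
        tensorRep hq n (Uq.Kinv q) (T (shiftCapVec q a n c))) c := by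
  rw [coordFun_shift, shiftOp_add, coordFun_add, coordFun_shift, coordFun_Kinv, shiftCapVec,
    map_sum, coordFun_sum]
  congr 1
  · rw [shiftOp, shiftOp]
    refine Finset.sum_congr rfl fun j hj => ?_
    have hj' := Finset.mem_range.1 hj
    rw [coordFun_phi, capVec_congr (d := c) fun i hi => Function.update_of_ne (by omega) _ _]
  · congr 1
    refine Finset.sum_congr rfl fun j _ => ?_
    rw [coordFun_phi, map_smul, coordFun_smul]
    congr 1
    exact coordFun_congr _ fun i hi => Function.update_of_ne (by omega) _ _

theorem endAct_shift (hq : IsGeneric q) (a : Fin 2) (T : Module.End ℂ (TP n)) (x : TP n) :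
    endAct hq n (Uq.shift q a) T x = tensorRep hq n (Uq.shift q a) (T x) -
      tensorRep hq n (Uq.Kinv q)
        (T (tensorRep hq n (Uq.K q) (tensorRep hq n (Uq.shift q a) x))) := by
  have h1 : tensorRep hq n (-(Uq.K q * Uq.shift q a)) x =
      -tensorRep hq n (Uq.K q) (tensorRep hq n (Uq.shift q a) x) := by
    rw [map_neg, map_mul]; rfl
  rw [sub_eq_add_neg, ← map_neg, ← map_neg, ← h1]
  simp only [endAct, LinearMap.comp_apply, AlgHom.toLinearMap_apply, Uq.comul_shift, map_add,
    TensorProduct.lift.tmul, LinearMap.mk₂_apply, LinearMap.add_apply, Uq.antipode_shift, map_one,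
    MulOpposite.unop_one, MulOpposite.unop_op, LinearMap.mulRight_apply, LinearMap.mulLeft_apply,
    mul_one, Module.End.mul_apply]

theorem endAct_K (hq : IsGeneric q) (T : Module.End ℂ (TP n)) :
    endAct hq n (Uq.K q) T = tensorRep hq n (Uq.K q) * T * tensorRep hq n (Uq.Kinv q) := by
  simp only [endAct, LinearMap.comp_apply, AlgHom.toLinearMap_apply, Uq.comul_K,
    TensorProduct.lift.tmul, LinearMap.mk₂_apply, Uq.antipode_K,
    MulOpposite.unop_op, LinearMap.mulRight_apply, LinearMap.mulLeft_apply, mul_assoc]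

theorem endAct_Kinv (hq : IsGeneric q) (T : Module.End ℂ (TP n)) :
    endAct hq n (Uq.Kinv q) T = tensorRep hq n (Uq.Kinv q) * T * tensorRep hq n (Uq.K q) := by
  simp only [endAct, LinearMap.comp_apply, AlgHom.toLinearMap_apply, Uq.comul_Kinv,
    TensorProduct.lift.tmul, LinearMap.mk₂_apply, Uq.antipode_Kinv,
    MulOpposite.unop_op, LinearMap.mulRight_apply, LinearMap.mulLeft_apply, mul_assoc]

theorem endAct_one (hq : IsGeneric q) : endAct hq n 1 = 1 := by
  refine LinearMap.ext fun T => ?_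
  simp only [endAct, LinearMap.comp_apply, AlgHom.toLinearMap_apply, map_one,
    Algebra.TensorProduct.one_def, TensorProduct.lift.tmul, LinearMap.mk₂_apply,
    MulOpposite.unop_one, LinearMap.mulRight_apply, LinearMap.mulLeft_apply, mul_one, one_mul,
    Module.End.one_apply]

theorem endAct_mul (hq : IsGeneric q) (u v : Uq q) :
    endAct hq n (u * v) = endAct hq n u * endAct hq n v := by
  simp only [endAct, LinearMap.comp_apply, AlgHom.toLinearMap_apply, map_mul]
  generalize Uq.comul hq u = x
  generalize Uq.comul hq v = y
  induction x using TensorProduct.induction_on with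
  | zero => simp only [zero_mul, map_zero]
  | add x x' h h' => simp only [add_mul, map_add, h, h']
  | tmul a b =>
  induction y using TensorProduct.induction_on with
  | zero => simp only [mul_zero, map_zero]
  | add x x' h h' => simp only [mul_add, map_add, h, h']
  | tmul a' b' =>
    refine LinearMap.ext fun T => ?_
    simp only [Algebra.TensorProduct.tmul_mul_tmul, TensorProduct.lift.tmul, LinearMap.mk₂_apply,
      Module.End.mul_apply, LinearMap.comp_apply, LinearMap.mulRight_apply,
      LinearMap.mulLeft_apply, map_mul, MulOpposite.unop_mul, mul_assoc]

theorem K_Kinv_apply (hq : IsGeneric q) (x : TP n) :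
    tensorRep hq n (Uq.K q) (tensorRep hq n (Uq.Kinv q) x) = x := by
  rw [← Module.End.mul_apply, ← map_mul, Uq.K_mul_Kinv, map_one, Module.End.one_apply]

theorem Kinv_K_apply (hq : IsGeneric q) (x : TP n) :
    tensorRep hq n (Uq.Kinv q) (tensorRep hq n (Uq.K q) x) = x := by
  rw [← Module.End.mul_apply, ← map_mul, Uq.Kinv_mul_K, map_one, Module.End.one_apply]

theorem K_capVec (hq : IsGeneric q) (c : ℕ → Fin 2) :
    tensorRep hq n (Uq.K q) (capVec q n c) = tailWeight q n n c • capVec q n c := by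
  have h := congrArg (fun x => tailWeight q n n c • tensorRep hq n (Uq.K q) x) (Kinv_capVec hq c)
  simpa only [K_Kinv_apply, map_smul, smul_smul, mul_inv_cancel₀ (tailWeight_ne_zero hq n c),
    one_smul, eq_comm] using h

theorem phi_endAct (hq : IsGeneric q) (u : Uq q) (T : Module.End ℂ (TP n)) :
    phi hq n (endAct hq n u T) = tensorRep hq (n + n) u (phi hq n T) := by
  induction u using Uq.induction hq generalizing T with
  | scalar r =>
    rw [Algebra.algebraMap_eq_smul_one, map_smul, map_smul, endAct_one, map_one]
    simp
  | add x y hx hy => simp only [map_add, LinearMap.add_apply, hx, hy]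
  | mul x y hx hy => simp only [endAct_mul, map_mul, Module.End.mul_apply, hx, hy]
  | shift a =>
    refine coordFun_ext fun c => ?_
    rw [coordFun_shift_phi, coordFun_phi]
    congr 1
    have h := eq_neg_of_add_eq_zero_left (shift_capVec (n := n) hq a c)
    simp only [endAct_shift, h, map_neg, K_Kinv_apply, sub_neg_eq_add]
  | K =>
    refine coordFun_ext fun c => ?_
    rw [coordFun_K, coordFun_phi, coordFun_phi, endAct_K, Module.End.mul_apply,
      Module.End.mul_apply, Kinv_capVec, map_smul, map_smul, coordFun_smul, coordFun_K,
      invWeight_add, mul_inv]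
    ring
  | Kinv =>
    refine coordFun_ext fun c => ?_
    rw [coordFun_Kinv, coordFun_phi, coordFun_phi, endAct_Kinv, Module.End.mul_apply,
      Module.End.mul_apply, K_capVec, map_smul, map_smul, coordFun_smul, coordFun_Kinv,
      invWeight_add]
    ring

theorem mem_endU_iff (hq : IsGeneric q) (T : Module.End ℂ (TP n)) :
    T ∈ endU hq n ↔ ∀ u, endAct hq n u T = Uq.counit q u • T := by
  have hK : tensorRep hq n (Uq.K q) * tensorRep hq n (Uq.Kinv q) = 1 := by
    rw [← map_mul, Uq.K_mul_Kinv, map_one]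
  have hK' : tensorRep hq n (Uq.Kinv q) * tensorRep hq n (Uq.K q) = 1 := by
    rw [← map_mul, Uq.Kinv_mul_K, map_one]
  constructor
  · intro h u
    replace h : ∀ u, T * tensorRep hq n u = tensorRep hq n u * T := h
    induction u using Uq.induction hq with
    | scalar r =>
      rw [Algebra.algebraMap_eq_smul_one, map_smul, map_smul, endAct_one, map_one]
      simp
    | add x y hx hy => simp only [map_add, LinearMap.add_apply, hx, hy, add_smul]
    | mul x y hx hy =>
      rw [endAct_mul, Module.End.mul_apply, hy, map_smul, hx, map_mul, mul_smul, smul_comm]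
    | shift a =>
      refine LinearMap.ext fun x => ?_
      have h1 : ∀ u x, T (tensorRep hq n u x) = tensorRep hq n u (T x) :=
        fun u x => congrArg (fun S => S x) (h u)
      rw [endAct_shift, h1, h1, Kinv_K_apply, Uq.counit_shift, zero_smul, sub_self,
        LinearMap.zero_apply]
    | K => rw [endAct_K, ← h, mul_assoc, hK, mul_one, Uq.counit_K, one_smul]
    | Kinv => rw [endAct_Kinv, ← h, mul_assoc, hK', mul_one, Uq.counit_Kinv, one_smul]
  · intro h u
    have cK : T * tensorRep hq n (Uq.K q) = tensorRep hq n (Uq.K q) * T := by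
      have h1 := h (Uq.K q)
      rw [endAct_K, Uq.counit_K, one_smul] at h1
      conv_lhs => rw [← h1]
      rw [mul_assoc, hK', mul_one]
    have cKinv : T * tensorRep hq n (Uq.Kinv q) = tensorRep hq n (Uq.Kinv q) * T := by
      have h1 := h (Uq.Kinv q)
      rw [endAct_Kinv, Uq.counit_Kinv, one_smul] at h1
      conv_lhs => rw [← h1]
      rw [mul_assoc, hK, mul_one]
    induction u using Uq.induction hq with
    | scalar r =>
      rw [Algebra.algebraMap_eq_smul_one, map_smul, map_one, mul_smul_comm, smul_mul_assoc, mul_one,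
        one_mul]
    | add x y hx hy => rw [map_add, mul_add, add_mul, hx, hy]
    | mul x y hx hy => rw [map_mul, ← mul_assoc, hx, mul_assoc, hy, mul_assoc]
    | shift a =>
      refine LinearMap.ext fun x => ?_
      have h1 := congrArg (fun S => S x) (h (Uq.shift q a))
      have h2 : ∀ x, T (tensorRep hq n (Uq.K q) x) = tensorRep hq n (Uq.K q) (T x) :=
        fun x => congrArg (fun S => S x) cK
      simp only [endAct_shift, Uq.counit_shift, zero_smul, LinearMap.zero_apply, h2,
        Kinv_K_apply] at h1
      exact (sub_eq_zero.1 h1).symm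
    | K => exact cK
    | Kinv => exact cKinv

theorem map_endU (hq : IsGeneric q) :
    (endU hq n).map (phi hq n).toLinearMap = invariants hq (n + n) := by
  ext x
  constructor
  · rintro ⟨T, hT, rfl⟩ u
    change tensorRep hq (n + n) u (phi hq n T) = Uq.counit q u • phi hq n T
    rw [← phi_endAct, (mem_endU_iff hq T).1 hT, map_smul]
  · intro hx
    refine ⟨(phi hq n).symm x, (mem_endU_iff hq _).2 fun u => ?_, (phi hq n).apply_symm_apply x⟩
    apply (phi hq n).injective
    rw [phi_endAct, map_smul, LinearEquiv.apply_symm_apply]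
    exact hx u

end PhiLinear

section HighestWeight

variable {q : ℂ} {m : ℕ}

/-- The weight of the first `m` colours. -/
def weight (m : ℕ) (c : ℕ → Fin 2) : ℤ := ∑ i ∈ Finset.range m, if c i = 0 then 1 else -1

theorem weight_succ (m : ℕ) (c : ℕ → Fin 2) :
    weight (m + 1) c = weight m c + if c m = 0 then 1 else -1 :=
  Finset.sum_range_succ _ _

theorem weight_congr {c d : ℕ → Fin 2} (h : ∀ i < m, c i = d i) : weight m c = weight m d :=
  Finset.sum_congr rfl fun i hi => by rw [h i (Finset.mem_range.1 hi)]

theorem invWeight_congr {c d : ℕ → Fin 2} (h : ∀ i < m, c i = d i) :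
    invWeight q m c = invWeight q m d :=
  Finset.prod_congr rfl fun i hi => by rw [h i (Finset.mem_range.1 hi)]

theorem neg_le_weight (m : ℕ) (c : ℕ → Fin 2) : -(m : ℤ) ≤ weight m c := by
  induction m with
  | zero => simp [weight]
  | succ m ih =>
    rw [weight_succ]
    push_cast
    split_ifs <;> omega

theorem invWeight_eq (hq : IsGeneric q) (m : ℕ) (c : ℕ → Fin 2) :
    invWeight q m c = (q ^ weight m c)⁻¹ := by
  have h0 := hq.ne_zero
  induction m with
  | zero => simp [invWeight, weight]
  | succ m ih =>
    rw [invWeight, Finset.prod_range_succ, weight_succ, zpow_add₀ h0, mul_inv, ← ih]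
    congr 1
    unfold weightFactor
    split_ifs <;> simp

theorem IsGeneric.zpow_injective (hq : IsGeneric q) : Function.Injective fun k : ℤ => q ^ k := by
  intro a b h
  wlog hab : a ≤ b generalizing a b
  · exact (this h.symm (by omega)).symm
  have h0 := hq.ne_zero
  obtain ⟨k, hk⟩ := Int.le.dest hab
  rcases Nat.eq_zero_or_pos k with rfl | hpos
  · simpa using hk
  · exfalso
    apply hq.pow_ne_one k hpos
    simp only at h
    rw [← hk, zpow_add₀ h0, zpow_natCast] at h
    exact (mul_left_cancel₀ (zpow_ne_zero a h0) (by rw [← h, mul_one]))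

theorem shiftOp_add_fun (a : Fin 2) (φ ψ : (ℕ → Fin 2) → ℂ) (c : ℕ → Fin 2) :
    shiftOp q a m (φ + ψ) c = shiftOp q a m φ c + shiftOp q a m ψ c := by
  simp only [shiftOp, Pi.add_apply, mul_add, Finset.sum_add_distrib]

theorem shiftOp_smul_fun (a : Fin 2) (r : ℂ) (φ : (ℕ → Fin 2) → ℂ) (c : ℕ → Fin 2) :
    shiftOp q a m (r • φ) c = r * shiftOp q a m φ c := by
  simp only [shiftOp, Pi.smul_apply, smul_eq_mul, Finset.mul_sum]
  exact Finset.sum_congr rfl fun _ _ => by ring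

/-- The coordinate functions of highest weight vectors of weight `k` in the `m`-th tensor power. -/
def highestWeight (q : ℂ) (m : ℕ) (k : ℤ) : Submodule ℂ ((ℕ → Fin 2) → ℂ) where
  carrier := {φ | (∀ c d, (∀ i < m, c i = d i) → φ c = φ d) ∧ (∀ c, weight m c ≠ k → φ c = 0) ∧
    ∀ c, shiftOp q 0 m φ c = 0}
  add_mem' := by
    rintro φ ψ ⟨h1, h2, h3⟩ ⟨h1', h2', h3'⟩
    refine ⟨fun c d h => ?_, fun c h => ?_, fun c => ?_⟩
    · rw [Pi.add_apply, Pi.add_apply, h1 c d h, h1' c d h]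
    · rw [Pi.add_apply, h2 c h, h2' c h, add_zero]
    · rw [shiftOp_add_fun, h3, h3', add_zero]
  zero_mem' := ⟨fun _ _ _ => rfl, fun _ _ => rfl, fun c => by simp [shiftOp]⟩
  smul_mem' := by
    rintro r φ ⟨h1, h2, h3⟩
    refine ⟨fun c d h => ?_, fun c h => ?_, fun c => ?_⟩
    · rw [Pi.smul_apply, Pi.smul_apply, h1 c d h]
    · rw [Pi.smul_apply, h2 c h, smul_zero]
    · rw [shiftOp_smul_fun, h3, mul_zero]

section Lowering

variable {x : TP m}

/-- The lowering operators along the string of a vector of weight `-1`. -/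
theorem K_F_pow (hq : IsGeneric q) (hK : tensorRep hq m (Uq.K q) x = q⁻¹ • x) (j : ℕ) :
    tensorRep hq m (Uq.K q) ((tensorRep hq m (Uq.F q) ^ j) x) =
      q ^ (-1 - 2 * j : ℤ) • (tensorRep hq m (Uq.F q) ^ j) x := by
  have h0 := hq.ne_zero
  induction j with
  | zero => simpa using hK
  | succ j ih =>
    have h := congrArg (fun u => tensorRep hq m u ((tensorRep hq m (Uq.F q) ^ j) x))
      (Uq.K_mul_F (q := q))
    simp only [map_mul, map_smul, LinearMap.smul_apply, Module.End.mul_apply, ih] at h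
    rw [pow_succ', Module.End.mul_apply, h, smul_smul]
    congr 1
    push_cast
    rw [show (-1 - 2 * ((j : ℤ) + 1)) = -2 + (-1 - 2 * j) by ring, zpow_add₀ h0, zpow_neg]
    rfl

theorem Kinv_F_pow (hq : IsGeneric q) (hK : tensorRep hq m (Uq.K q) x = q⁻¹ • x) (j : ℕ) :
    tensorRep hq m (Uq.Kinv q) ((tensorRep hq m (Uq.F q) ^ j) x) =
      (q ^ (-1 - 2 * j : ℤ))⁻¹ • (tensorRep hq m (Uq.F q) ^ j) x := by
  have h0 := hq.ne_zero
  have h := congrArg (tensorRep hq m (Uq.Kinv q)) (K_F_pow hq hK j)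
  rw [Kinv_K_apply, map_smul] at h
  conv_rhs => rw [h]
  rw [smul_smul, inv_mul_cancel₀ (zpow_ne_zero _ h0), one_smul]

theorem E_F_pow (hq : IsGeneric q) (hE : tensorRep hq m (Uq.E q) x = 0)
    (hK : tensorRep hq m (Uq.K q) x = q⁻¹ • x) (j : ℕ) :
    tensorRep hq m (Uq.E q) ((tensorRep hq m (Uq.F q) ^ (j + 1)) x) =
      (-((q ^ (j + 1) - (q ^ (j + 1))⁻¹) / (q - q⁻¹)) ^ 2) • (tensorRep hq m (Uq.F q) ^ j) x := by
  have h0 := hq.ne_zero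
  have hd : q - q⁻¹ ≠ 0 := by
    intro h
    apply hq.pow_ne_one 2 (by norm_num)
    field_simp at h
    linear_combination h
  have comm : ∀ y, tensorRep hq m (Uq.E q) (tensorRep hq m (Uq.F q) y) =
      tensorRep hq m (Uq.F q) (tensorRep hq m (Uq.E q) y) +
        (q - q⁻¹)⁻¹ • (tensorRep hq m (Uq.K q) y - tensorRep hq m (Uq.Kinv q) y) := by
    intro y
    have h := congrArg (fun u => tensorRep hq m u y) (sub_eq_iff_eq_add'.1 (Uq.E_mul_F (q := q)))
    have h1 : tensorRep hq m (Uq.K q - Uq.Kinv q) y =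
        tensorRep hq m (Uq.K q) y - tensorRep hq m (Uq.Kinv q) y := by
      rw [map_sub]; rfl
    simpa only [map_mul, map_add, map_smul, LinearMap.add_apply, LinearMap.smul_apply,
      Module.End.mul_apply, h1] using h
  have ss : ∀ (r s : ℂ) (y : TP m), r • y - s • y = (r - s) • y :=
    fun r s y => (sub_smul r s y).symm
  induction j with
  | zero =>
    have h1 := Kinv_F_pow hq hK 0
    rw [pow_zero, Module.End.one_apply] at h1
    rw [pow_succ', Module.End.mul_apply, comm, pow_zero, Module.End.one_apply, hE, map_zero, hK, h1,
      ss, zero_add, smul_smul]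
    congr 1
    simp
    field_simp
    ring
  | succ j ih =>
    rw [pow_succ' _ (j + 1), Module.End.mul_apply, comm, ih, map_smul, ← Module.End.mul_apply,
      ← pow_succ', K_F_pow hq hK, Kinv_F_pow hq hK, ss, smul_smul, ← add_smul]
    congr 1
    have e : q ^ (-1 - 2 * ((j + 1 : ℕ) : ℤ)) = (q * (q ^ (j + 1)) ^ 2)⁻¹ := by
      rw [show (-1 - 2 * ((j + 1 : ℕ) : ℤ)) = -((1 + 2 * (j + 1) : ℕ) : ℤ) by push_cast; ring,
        zpow_neg, zpow_natCast]
      congr 1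
      ring
    rw [e, pow_succ q (j + 1), inv_inv]
    have hQ : q ^ (j + 1) ≠ 0 := pow_ne_zero _ h0
    generalize q ^ (j + 1) = Q at hQ
    have hd' : q ^ 2 - 1 ≠ 0 := fun h => hq.pow_ne_one 2 (by norm_num) (by linear_combination h)
    rw [show q - q⁻¹ = (q ^ 2 - 1) / q by field_simp]
    field_simp
    ring

/-- There are no highest weight vectors of weight `-1`. -/
theorem eq_zero_of_weight_neg_one (hq : IsGeneric q) (hE : tensorRep hq m (Uq.E q) x = 0)
    (hK : tensorRep hq m (Uq.K q) x = q⁻¹ • x) : x = 0 := by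
  have h0 := hq.ne_zero
  have hd : q - q⁻¹ ≠ 0 := by
    intro h
    apply hq.pow_ne_one 2 (by norm_num)
    field_simp at h
    linear_combination h
  have top : (tensorRep hq m (Uq.F q) ^ m) x = 0 := by
    refine coordFun_ext fun c => ?_
    have h := congrArg (fun y => coordFun m y c) (K_F_pow hq hK m)
    simp only [coordFun_K, coordFun_smul, invWeight_eq hq, inv_inv] at h
    rw [coordFun_zero]
    by_contra hc
    have h1 := hq.zpow_injective (mul_right_cancel₀ hc h)
    have h2 := neg_le_weight m c
    omega
  have down : ∀ j, (tensorRep hq m (Uq.F q) ^ (j + 1)) x = 0 →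
      (tensorRep hq m (Uq.F q) ^ j) x = 0 := by
    intro j hj
    have h := E_F_pow hq hE hK j
    rw [hj, map_zero] at h
    refine (smul_eq_zero.1 h.symm).resolve_left ?_
    refine neg_ne_zero.2 (pow_ne_zero 2 (div_ne_zero (fun h => ?_) hd))
    apply hq.pow_ne_one (2 * (j + 1)) (by omega)
    have hQ : q ^ (j + 1) ≠ 0 := pow_ne_zero _ h0
    rw [mul_comm, pow_mul]
    generalize q ^ (j + 1) = Q at hQ h
    field_simp at h
    linear_combination h
  have all : ∀ j ≤ m, (tensorRep hq m (Uq.F q) ^ (m - j)) x = 0 := by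
    intro j hj
    induction j with
    | zero => exact top
    | succ j ih =>
      apply down
      rw [show m - (j + 1) + 1 = m - j by omega]
      exact ih (by omega)
  simpa using all m le_rfl

end Lowering

theorem highestWeight_neg_one (hq : IsGeneric q) {φ : (ℕ → Fin 2) → ℂ}
    (hφ : φ ∈ highestWeight q m (-1)) : φ = 0 := by
  obtain ⟨h1, h2, h3⟩ := hφ
  let x : TP m := (coord m).symm fun s => φ fun i => if h : i < m then s ⟨i, h⟩ else 0
  have hx : coordFun m x = φ := by
    funext c
    rw [coordFun, LinearEquiv.apply_symm_apply]
    exact h1 _ _ fun i hi => by simp [hi]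
  have h4 : x = 0 := by
    refine eq_zero_of_weight_neg_one hq (coordFun_ext fun c => ?_) (coordFun_ext fun c => ?_)
    · rw [← Uq.shift_zero, coordFun_shift, hx, h3, coordFun_zero]
    · rw [coordFun_K, coordFun_smul, hx, invWeight_eq hq, inv_inv]
      by_cases hc : weight m c = -1
      · rw [hc, zpow_neg_one]
      · rw [h2 c hc, mul_zero, mul_zero]
  rw [← hx, h4]
  exact funext coordFun_zero

end HighestWeight

section Spanning

variable {q : ℂ} {m k : ℕ}

/-- The span of the products of cups whose last `k` end points carry `v₋`. -/
def cupSpan (q : ℂ) (m k : ℕ) : Submodule ℂ ((ℕ → Fin 2) → ℂ) :=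
  Submodule.span ℂ {φ | ∃ ψ, CupForm q (m + k) ψ ∧ φ = fun c => ψ (splice m c fun _ => 1)}

theorem weight_skip {j N : ℕ} (hj : j ≤ N) (c : ℕ → Fin 2) :
    weight (N + 2) c = (if c j = 0 then 1 else -1) + (if c (j + 1) = 0 then 1 else -1) +
      weight N (c ∘ skip j) :=
  sum_range_skip hj _

theorem CupForm.weight {N : ℕ} {ψ : (ℕ → Fin 2) → ℂ} (h : CupForm q N ψ) (c : ℕ → Fin 2)
    (hc : ψ c ≠ 0) : weight N c = 0 := by
  induction h generalizing c with
  | nil => rfl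
  | @insert N k ψ hk h ih =>
    rw [weight_skip hk, ih _ (right_ne_zero_of_mul hc), add_zero]
    have h1 := left_ne_zero_of_mul hc
    generalize c k = a at *
    generalize c (k + 1) = b at *
    fin_cases a <;> fin_cases b <;> simp [deltaCoeff] at h1 ⊢

theorem CupForm.congr {N : ℕ} {ψ : (ℕ → Fin 2) → ℂ} (h : CupForm q N ψ) {c d : ℕ → Fin 2}
    (hcd : ∀ i < N, c i = d i) : ψ c = ψ d := by
  induction h generalizing c d with
  | nil => rfl
  | @insert N k ψ hk h ih =>
    beta_reduce
    rw [hcd k (by omega), hcd (k + 1) (by omega)]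
    congr 1
    refine ih fun i hi => hcd _ ?_
    unfold skip
    split_ifs <;> omega

theorem weight_splice (c : ℕ → Fin 2) (k : ℕ) :
    weight (m + k) (splice m c fun _ => 1) = weight m c - k := by
  induction k with
  | zero =>
    rw [add_zero, Nat.cast_zero, sub_zero]
    exact weight_congr fun i hi => if_pos hi
  | succ k ih =>
    rw [← add_assoc, weight_succ, ih]
    have e : splice m c (fun _ => 1) (m + k) = 1 := if_neg (by omega)
    rw [e, if_neg one_ne_zero]
    push_cast
    ring

theorem cupSpan_le (hq : IsGeneric q) : cupSpan q m k ≤ highestWeight q m k := by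
  refine Submodule.span_le.2 ?_
  rintro φ ⟨ψ, hψ, rfl⟩
  refine ⟨fun c d h => ?_, fun c hc => ?_, fun c => ?_⟩
  · refine congrArg ψ (funext fun i => ?_)
    unfold splice
    split_ifs with hi
    · exact h i hi
    · rfl
  · by_contra h
    have h1 := hψ.weight _ h
    rw [weight_splice] at h1
    omega
  · have h := hψ.shiftOp hq 0 (splice m c fun _ => 1)
    rw [shiftOp_add, Finset.sum_eq_zero, mul_zero, add_zero] at h
    · rw [← h]
      refine Finset.sum_congr rfl fun j hj => ?_
      have hj' := Finset.mem_range.1 hj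
      have e1 : splice m c (fun _ => 1) j = c j := if_pos hj'
      have e2 : splice m (Function.update c j (1 - 0)) (fun _ => 1) =
          Function.update (splice m c fun _ => 1) j (1 - 0) := by
        funext i
        by_cases hi : i = j
        · subst hi; simp [splice, hj']
        · simp [splice, hi]
      beta_reduce
      have e3 : invWeight q j (splice m c fun _ => 1) = invWeight q j c :=
        invWeight_congr fun i hi => if_pos (hi.trans hj')
      rw [e1, e2, e3]
    · intro j _
      have e1 : splice m c (fun _ => 1) (m + j) = 1 := if_neg (by omega)
      rw [e1, if_neg one_ne_zero, zero_mul]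

theorem exists_lift {φ : (ℕ → Fin 2) → ℂ} (hφ : φ ∈ cupSpan q m (k + 1)) :
    ∃ φ' ∈ cupSpan q (m + 1) k, ∀ c, φ' (Function.update c m 1) = φ c := by
  induction hφ using Submodule.span_induction with
  | mem φ h =>
    obtain ⟨ψ, hψ, rfl⟩ := h
    refine ⟨_, Submodule.subset_span ⟨ψ, by rwa [show m + 1 + k = m + (k + 1) by ring], rfl⟩,
      fun c => ?_⟩
    congr 1
    funext i
    unfold splice
    rcases lt_trichotomy i m with hi | rfl | hi
    · rw [if_pos (by omega), if_pos hi, Function.update_of_ne hi.ne]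
    · simp
    · rw [if_neg (by omega), if_neg (by omega)]
  | zero => exact ⟨0, zero_mem _, fun _ => rfl⟩
  | add φ ψ _ _ h1 h2 =>
    obtain ⟨φ', h1, h1'⟩ := h1
    obtain ⟨ψ', h2, h2'⟩ := h2
    exact ⟨φ' + ψ', add_mem h1 h2, fun c => by rw [Pi.add_apply, h1', h2', Pi.add_apply]⟩
  | smul r φ _ h1 =>
    obtain ⟨φ', h1, h1'⟩ := h1
    exact ⟨r • φ', Submodule.smul_mem _ _ h1, fun c => by rw [Pi.smul_apply, h1', Pi.smul_apply]⟩

theorem insert_mem_cupSpan {φ : (ℕ → Fin 2) → ℂ} (hφ : φ ∈ cupSpan q m k) :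
    (fun c => if c m = 0 then φ c else 0) ∈ cupSpan q (m + 1) (k + 1) := by
  induction hφ using Submodule.span_induction with
  | mem φ h =>
    obtain ⟨ψ, hψ, rfl⟩ := h
    refine Submodule.subset_span
      ⟨fun c => deltaCoeff q (c m) (c (m + 1)) * ψ (c ∘ skip m), ?_, ?_⟩
    · rw [show m + 1 + (k + 1) = m + k + 2 by ring]
      exact CupForm.insert (by omega) hψ
    · funext c
      beta_reduce
      have e1 : splice (m + 1) c (fun _ => 1) m = c m := if_pos (by omega)
      have e2 : splice (m + 1) c (fun _ => 1) (m + 1) = 1 := if_neg (by omega)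
      have e3 : splice (m + 1) c (fun _ => 1) ∘ skip m = splice m c fun _ => 1 := by
        funext i
        by_cases hi : i < m
        · have e : skip m i = i := if_pos hi
          rw [Function.comp_apply, e, splice, splice, if_pos hi, if_pos (by omega)]
        · have e : skip m i = i + 2 := if_neg hi
          rw [Function.comp_apply, e, splice, splice, if_neg hi, if_neg (by omega)]
      rw [e1, e2, e3]
      generalize c m = a
      fin_cases a <;> simp [deltaCoeff]
  | zero =>
    convert zero_mem (cupSpan q (m + 1) (k + 1)) using 1
    funext c
    simp
  | add φ ψ _ _ h1 h2 =>
    convert add_mem h1 h2 using 1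
    funext c
    simp only [Pi.add_apply]
    split_ifs <;> simp
  | smul r φ _ h1 =>
    convert Submodule.smul_mem _ r h1 using 1
    funext c
    simp only [Pi.smul_apply]
    split_ifs <;> simp

theorem shiftOp_restrict (φ : (ℕ → Fin 2) → ℂ) (e : Fin 2) (c : ℕ → Fin 2) :
    shiftOp q 0 m (fun d => φ (Function.update d m e)) c =
      shiftOp q 0 m φ (Function.update c m e) := by
  refine Finset.sum_congr rfl fun j hj => ?_
  have hj' := Finset.mem_range.1 hj
  beta_reduce
  have e3 : invWeight q j (Function.update c m e) = invWeight q j c :=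
    invWeight_congr fun i hi => Function.update_of_ne (by omega) _ _
  rw [Function.update_of_ne hj'.ne, Function.update_comm hj'.ne, e3]

theorem restrict_mem {k : ℤ} {φ : (ℕ → Fin 2) → ℂ} (hφ : φ ∈ highestWeight q (m + 1) k) (e : Fin 2)
    (h : ∀ c, shiftOp q 0 m φ (Function.update c m e) = 0) :
    (fun c => φ (Function.update c m e)) ∈ highestWeight q m (k - if e = 0 then 1 else -1) := by
  refine ⟨fun c d hcd => hφ.1 _ _ fun i hi => ?_, fun c hc => hφ.2.1 _ ?_, fun c => ?_⟩
  · by_cases him : i = m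
    · subst him; simp
    · rw [Function.update_of_ne him, Function.update_of_ne him, hcd i (by omega)]
  · rw [weight_succ, Function.update_self,
      weight_congr (d := c) fun i hi => Function.update_of_ne hi.ne _ _]
    omega
  · rw [shiftOp_restrict, h]

theorem highestWeight_le_cupSpan (hq : IsGeneric q) (m k : ℕ) :
    highestWeight q m k ≤ cupSpan q m k := by
  induction m generalizing k with
  | zero =>
    intro φ hφ
    rcases Nat.eq_zero_or_pos k with rfl | hk
    · have h1 : φ = φ (fun _ => 0) • fun _ => 1 := by
        funext c
        rw [hφ.1 c (fun _ => 0) (by omega)]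
        simp
      rw [h1]
      exact Submodule.smul_mem _ _ (Submodule.subset_span ⟨_, CupForm.nil, rfl⟩)
    · have h1 : φ = 0 := by
        funext c
        refine hφ.2.1 c ?_
        simp only [weight, Finset.range_zero, Finset.sum_empty]
        omega
      rw [h1]
      exact zero_mem _
  | succ m ih =>
    intro φ hφ
    have hb := restrict_mem hφ 1 fun c => by
      have h := hφ.2.2 (Function.update c m 1)
      rwa [shiftOp_succ, Function.update_self, if_neg one_ne_zero, zero_mul, add_zero] at h
    rw [if_neg one_ne_zero, sub_neg_eq_add] at hb
    obtain ⟨φ', h1, h2⟩ := exists_lift (ih (k + 1) (by exact_mod_cast hb))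
    have hχ : φ - φ' ∈ highestWeight q (m + 1) k := sub_mem hφ (cupSpan_le hq h1)
    have hχ1 : ∀ c, (φ - φ') (Function.update c m 1) = 0 := fun c => by
      rw [Pi.sub_apply, h2, sub_self]
    suffices h : φ - φ' ∈ cupSpan q (m + 1) k by
      have := add_mem h h1
      rwa [sub_add_cancel] at this
    generalize φ - φ' = χ at hχ hχ1
    have ha := restrict_mem hχ 0 fun c => by
      have h := hχ.2.2 (Function.update c m 0)
      rwa [shiftOp_succ, Function.update_idem, sub_zero, hχ1, mul_zero, add_zero] at h
    rw [if_pos rfl] at ha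
    have e : χ = fun c => if c m = 0 then χ (Function.update c m 0) else 0 := by
      funext c
      split_ifs with hc
      · rw [← hc, Function.update_eq_self]
      · have h1 : c m = 1 := by omega
        rw [← hχ1 c, ← h1, Function.update_eq_self]
    rw [e]
    rcases k with _ | k
    · have h3 := highestWeight_neg_one hq (by simpa using ha)
      have h4 : (fun c : ℕ → Fin 2 => if c m = 0 then χ (Function.update c m 0) else 0) = 0 := by
        funext c
        rw [congrFun h3 c]
        simp
      rw [h4]
      exact zero_mem _
    · refine insert_mem_cupSpan (ih k ?_)
      convert ha using 1
      push_cast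
      ring_nf

theorem coordFun_invariants (hq : IsGeneric q) {x : TP m} (hx : x ∈ invariants hq m) :
    coordFun m x ∈ cupSpan q m 0 := by
  refine highestWeight_le_cupSpan hq m 0 ⟨fun c d => coordFun_congr x, fun c hc => ?_, fun c => ?_⟩
  · by_contra h
    have h1 := congrArg (fun y => coordFun m y c) (hx (Uq.K q))
    simp only [coordFun_K, Uq.counit_K, coordFun_smul, invWeight_eq hq, inv_inv] at h1
    refine hc (hq.zpow_injective ?_)
    simpa using mul_right_cancel₀ h h1
  · rw [← coordFun_shift hq, hx, Uq.counit_shift, zero_smul, coordFun_zero]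

end Spanning

section Matching

variable {q : ℂ} {N : ℕ}

/-- `f` is the partner map of a non-crossing perfect matching of the numbers below `N`. -/
structure Matching (N : ℕ) (f : ℕ → ℕ) : Prop where
  lt : ∀ i < N, f i < N
  inv : ∀ i < N, f (f i) = i
  ne : ∀ i < N, f i ≠ i
  planar : ∀ u < N, ∀ v < N, ¬ (u < v ∧ v < f u ∧ f u < f v)

/-- The product of the cups of a matching. -/
def cupProduct (q : ℂ) (N : ℕ) (f : ℕ → ℕ) (c : ℕ → Fin 2) : ℂ :=
  ∏ i ∈ Finset.range N, if i < f i then deltaCoeff q (c i) (c (f i)) else 1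

/-- A left inverse of `skip k`. -/
def unskip (k i : ℕ) : ℕ := if i < k then i else i - 2

theorem unskip_skip (k i : ℕ) : unskip k (skip k i) = i := by
  unfold unskip skip; split_ifs <;> omega

theorem skip_unskip {k i : ℕ} (h1 : i ≠ k) (h2 : i ≠ k + 1) : skip k (unskip k i) = i := by
  unfold unskip skip; split_ifs <;> omega

theorem skip_lt_skip {k i j : ℕ} : skip k i < skip k j ↔ i < j := by
  unfold skip; split_ifs <;> omega

theorem skip_lt {k i : ℕ} (hk : k ≤ N) : skip k i < N + 2 ↔ i < N := by
  unfold skip; split_ifs <;> omega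

theorem cupProduct_skip {k : ℕ} (hk : k ≤ N) {f g : ℕ → ℕ} (h1 : g k = k + 1) (h2 : g (k + 1) = k)
    (h3 : ∀ i < N, g (skip k i) = skip k (f i)) (c : ℕ → Fin 2) :
    cupProduct q (N + 2) g c =
      deltaCoeff q (c k) (c (k + 1)) * cupProduct q N f (c ∘ skip k) := by
  rw [cupProduct, prod_range_skip hk, h1, h2, if_pos (by omega), if_neg (by omega), mul_one]
  congr 1
  refine Finset.prod_congr rfl fun i hi => ?_
  rw [h3 i (Finset.mem_range.1 hi)]
  simp only [skip_lt_skip, Function.comp_apply]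

theorem Matching.insert {k : ℕ} (hk : k ≤ N) {f : ℕ → ℕ} (hf : Matching N f) :
    ∃ g, Matching (N + 2) g ∧ g k = k + 1 ∧ g (k + 1) = k ∧
      ∀ i < N, g (skip k i) = skip k (f i) := by
  let g : ℕ → ℕ := fun i => if i = k then k + 1 else if i = k + 1 then k else
    skip k (f (unskip k i))
  have g1 : g k = k + 1 := if_pos rfl
  have g2 : g (k + 1) = k := (if_neg (by omega)).trans (if_pos rfl)
  have g3 : ∀ i, g (skip k i) = skip k (f i) := by
    intro i
    have h := skip_ne k i
    simp only [g, if_neg h.1, if_neg h.2, unskip_skip]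
  have cases : ∀ i < N + 2, i = k ∨ i = k + 1 ∨ ∃ j < N, i = skip k j := by
    intro i hi
    by_cases h1 : i = k
    · exact Or.inl h1
    by_cases h2 : i = k + 1
    · exact Or.inr (Or.inl h2)
    · have h := skip_unskip h1 h2
      exact Or.inr (Or.inr ⟨unskip k i, (skip_lt hk).1 (by rwa [h]), h.symm⟩)
  refine ⟨g, ⟨fun i hi => ?_, fun i hi => ?_, fun i hi => ?_, fun u hu v hv => ?_⟩, g1, g2,
    fun i _ => g3 i⟩
  · obtain rfl | rfl | ⟨j, hj, rfl⟩ := cases i hi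
    · omega
    · omega
    · rw [g3, skip_lt hk]
      exact hf.lt j hj
  · obtain rfl | rfl | ⟨j, hj, rfl⟩ := cases i hi
    · rw [g1, g2]
    · rw [g2, g1]
    · rw [g3, g3, hf.inv j hj]
  · obtain rfl | rfl | ⟨j, hj, rfl⟩ := cases i hi
    · omega
    · omega
    · rw [g3]
      exact fun h => hf.ne j hj (skip_injective k h)
  · obtain rfl | rfl | ⟨u', hu', rfl⟩ := cases u hu
    · omega
    · omega
    · obtain rfl | rfl | ⟨v', hv', rfl⟩ := cases v hv
      · have := skip_ne v (f u')
        rw [g3]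
        omega
      · have := skip_ne k (f u')
        rw [g3]
        omega
      · rw [g3, g3, skip_lt_skip, skip_lt_skip, skip_lt_skip]
        exact hf.planar u' hu' v' hv'

theorem Matching.remove {k : ℕ} (hk : k ≤ N) {g : ℕ → ℕ} (hg : Matching (N + 2) g)
    (h1 : g k = k + 1) (h2 : g (k + 1) = k) :
    ∃ f, Matching N f ∧ ∀ i < N, g (skip k i) = skip k (f i) := by
  have h3 : ∀ i < N, g (skip k i) = skip k (unskip k (g (skip k i))) := by
    intro i hi
    have hi' := (skip_lt hk).2 hi
    have h := skip_ne k i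
    refine (skip_unskip (fun e => ?_) fun e => ?_).symm
    · have := hg.inv _ hi'
      rw [e, h1] at this
      omega
    · have := hg.inv _ hi'
      rw [e, h2] at this
      omega
  generalize hf : (fun i => unskip k (g (skip k i))) = f
  replace h3 : ∀ i < N, g (skip k i) = skip k (f i) := fun i hi => by rw [← hf]; exact h3 i hi
  have lt : ∀ i < N, f i < N := fun i hi => by
    rw [← skip_lt hk, ← h3 i hi]
    exact hg.lt _ ((skip_lt hk).2 hi)
  refine ⟨f, ⟨lt, fun i hi => ?_, fun i hi => ?_, fun u hu v hv => ?_⟩, h3⟩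
  · apply skip_injective k
    rw [← h3 _ (lt i hi), ← h3 i hi, hg.inv _ ((skip_lt hk).2 hi)]
  · intro e
    apply hg.ne _ ((skip_lt hk).2 hi)
    rw [h3 i hi, e]
  · have h := hg.planar _ ((skip_lt hk).2 hu) _ ((skip_lt hk).2 hv)
    rwa [h3 u hu, h3 v hv, skip_lt_skip, skip_lt_skip, skip_lt_skip] at h

theorem Matching.exists_adjacent {g : ℕ → ℕ} (hN : 0 < N) (hg : Matching N g) :
    ∃ k, k + 1 < N ∧ g k = k + 1 ∧ g (k + 1) = k := by
  have h0 : ∃ d i, i < N ∧ g i = i + d + 1 := by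
    have := hg.ne 0 hN
    exact ⟨g 0 - 1, 0, hN, by omega⟩
  obtain ⟨i, hi, hd⟩ := Nat.find_spec h0
  have hmin := fun d' hd' => Nat.find_min h0 (m := d') hd'
  generalize Nat.find h0 = d at hd hmin
  have hgi := hg.lt i hi
  rcases Nat.eq_zero_or_pos d with rfl | hpos
  · refine ⟨i, by omega, hd, ?_⟩
    have := hg.inv i hi
    rwa [hd] at this
  · exfalso
    have hj : i + 1 < N := by omega
    have h1 := hg.planar i hi (i + 1) hj
    have h2 := hg.ne (i + 1) hj
    have h3 := hg.inv (i + 1) hj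
    have h4 := hg.planar (g (i + 1)) (hg.lt _ hj) i hi
    rw [h3] at h4
    have h5 : g (i + 1) ≠ i := by
      intro e
      rw [e, hd] at h3
      omega
    have h6 : g (i + 1) ≠ g i := by
      intro e
      rw [e, hg.inv i hi] at h3
      omega
    exact hmin (g (i + 1) - (i + 1) - 1) (by omega) ⟨i + 1, hj, by omega⟩

theorem CupForm.exists_matching {ψ : (ℕ → Fin 2) → ℂ} (h : CupForm q N ψ) :
    ∃ f, Matching N f ∧ ψ = cupProduct q N f := by
  induction h with
  | nil => exact ⟨_root_.id, ⟨by omega, by omega, by omega, by omega⟩, rfl⟩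
  | insert hk h ih =>
    obtain ⟨f, hf, rfl⟩ := ih
    obtain ⟨g, hg, h1, h2, h3⟩ := hf.insert hk
    exact ⟨g, hg, funext fun c => (cupProduct_skip hk h1 h2 h3 c).symm⟩

theorem Matching.cupForm {f : ℕ → ℕ} (hf : Matching N f) : CupForm q N (cupProduct q N f) := by
  induction N using Nat.strong_induction_on generalizing f with
  | _ N ih =>
    rcases Nat.eq_zero_or_pos N with rfl | hN
    · exact CupForm.nil
    · obtain ⟨k, hk, h1, h2⟩ := hf.exists_adjacent hN
      obtain ⟨M, rfl⟩ : ∃ M, N = M + 2 := ⟨N - 2, by omega⟩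
      obtain ⟨g, hg, h3⟩ := hf.remove (by omega) h1 h2
      have h := CupForm.insert (k := k) (by omega) (ih M (by omega) hg)
      convert h using 1
      exact funext (cupProduct_skip (by omega) h1 h2 h3)

end Matching

section Range

variable {q : ℂ} {n : ℕ}

/-- The vertices of a diagram in the order of their positions. -/
def posEquiv (n : ℕ) : Vert n ≃ Fin (n + n) :=
  Equiv.ofBijective (fun u => ⟨pos u, by have := pos_lt u; omega⟩)
    ((Fintype.bijective_iff_injective_and_card _).2
      ⟨fun _ _ h => pos_inj (Fin.mk.inj h), by simp⟩)

theorem val_posEquiv (u : Vert n) : (posEquiv n u).val = pos u := rfl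

theorem pos_posEquiv_symm (i : Fin (n + n)) : pos ((posEquiv n).symm i) = i := by
  rw [← val_posEquiv, Equiv.apply_symm_apply]

/-- The vertex at a position. -/
def vertAt (n i : ℕ) (hi : i < n + n) : Vert n := (posEquiv n).symm ⟨i, hi⟩

theorem pos_vertAt {i : ℕ} (hi : i < n + n) : pos (vertAt n i hi) = i := pos_posEquiv_symm _

theorem vertAt_pos (u : Vert n) (h : pos u < n + n) : vertAt n (pos u) h = u :=
  (posEquiv n).symm_apply_apply u

theorem exists_matching_of_diagram (D : Diagram n) :
    ∃ f, Matching (n + n) f ∧ ∀ u, f (pos u) = pos (D.link u) := by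
  have hlt : ∀ u : Vert n, pos u < n + n := fun u => (posEquiv n u).2
  let f : ℕ → ℕ := fun i => if h : i < n + n then pos (D.link (vertAt n i h)) else 0
  have hf : ∀ u, f (pos u) = pos (D.link u) := by
    intro u
    simp only [f, dif_pos (hlt u), vertAt_pos]
  have hs : ∀ i < n + n, ∃ u : Vert n, i = pos u := fun i hi => ⟨vertAt n i hi, (pos_vertAt hi).symm⟩
  refine ⟨f, ⟨fun i hi => ?_, fun i hi => ?_, fun i hi => ?_, fun i hi j hj => ?_⟩, hf⟩
  · obtain ⟨u, rfl⟩ := hs i hi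
    rw [hf]
    exact hlt _
  · obtain ⟨u, rfl⟩ := hs i hi
    rw [hf, hf, D.link_link]
  · obtain ⟨u, rfl⟩ := hs i hi
    rw [hf]
    exact fun h => D.link_ne u (pos_inj h)
  · obtain ⟨u, rfl⟩ := hs i hi
    obtain ⟨v, rfl⟩ := hs j hj
    rw [hf, hf]
    exact D.nc.2.2 u v

theorem exists_diagram_of_matching {f : ℕ → ℕ} (hf : Matching (n + n) f) :
    ∃ D : Diagram n, ∀ u, f (pos u) = pos (D.link u) := by
  have hlt : ∀ u : Vert n, pos u < n + n := fun u => (posEquiv n u).2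
  let l : Vert n → Vert n := fun u => vertAt n (f (pos u)) (hf.lt _ (hlt u))
  have hl : ∀ u, pos (l u) = f (pos u) := fun u => pos_vertAt _
  have hnc : NC pos l := by
    refine ⟨fun u => pos_inj ?_, fun u h => ?_, fun u v => ?_⟩
    · rw [hl, hl, hf.inv _ (hlt u)]
    · apply hf.ne _ (hlt u)
      rw [← hl, h]
    · rw [hl, hl]
      exact hf.planar _ (hlt u) _ (hlt v)
  exact ⟨Diagram.ofLink l hnc, fun u => by rw [Diagram.link_ofLink, hl]⟩

theorem coordFun_phi_spin (hq : IsGeneric q) (D : Diagram n) (c : ℕ → Fin 2) :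
    coordFun (n + n) (phi hq n (spin q n (diag q D))) c =
      lineWeight (deltaCoeff q) pos D.link fun u => c (pos u) := by
  have h0 : (fun u : Vert n => c (pos u)) =
      Sum.elim (fun i : Fin n => c i) fun i : Fin n => c (n + i.rev) := by
    funext u
    rcases u with i | i <;> rfl
  have h1 : ∀ b : Fin n → Fin 2,
      ∑ t : Fin n → Fin 2, ∏ j, epsCoeff q (b j) (t j) * deltaCoeff q (t j) (c (n + j.rev)) =
      if b = fun j => c (n + j.rev) then 1 else 0 := by
    intro b
    have h := (Finset.prod_univ_sum (fun _ : Fin n => (Finset.univ : Finset (Fin 2)))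
      fun j a => epsCoeff q (b j) a * deltaCoeff q a (c (n + j.rev))).symm
    rw [Fintype.piFinset_univ] at h
    rw [h]
    simp only [(duality_spin hq).eps_delta]
    rw [Finset.prod_ite_zero, Finset.prod_const_one]
    simp [funext_iff]
  rw [coordFun_phi, coordFun, capVec, map_sum, map_sum, Finset.sum_apply, h0]
  have h2 : ∀ t : Fin n → Fin 2, ∏ j : Fin n, deltaCoeff q (t j.rev) (c (n + j)) =
      ∏ j : Fin n, deltaCoeff q (t j) (c (n + j.rev)) := by
    intro t
    rw [← Equiv.prod_comp Fin.revPerm]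
    simp
  simp only [map_smul, Pi.smul_apply, coord_spin_stdVec, spinCoeff_eq,
    diagramCoeff_eq_sum (duality_spin hq), smul_eq_mul, h2, Finset.mul_sum]
  rw [Finset.sum_comm]
  have h3 : ∀ b t : Fin n → Fin 2, (∏ j, deltaCoeff q (t j) (c (n + j.rev))) *
      (lineWeight (deltaCoeff q) pos D.link (Sum.elim (fun i : Fin n => c i) b) *
        ∏ j, epsCoeff q (b j) (t j)) =
      lineWeight (deltaCoeff q) pos D.link (Sum.elim (fun i : Fin n => c i) b) *
        ∏ j, epsCoeff q (b j) (t j) * deltaCoeff q (t j) (c (n + j.rev)) := by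
    intro b t
    rw [Finset.prod_mul_distrib]
    ring
  simp only [h3, ← Finset.mul_sum, h1]
  simp

theorem lineWeight_eq_cupProduct (D : Diagram n) {f : ℕ → ℕ}
    (hf : ∀ u, f (pos u) = pos (D.link u)) (c : ℕ → Fin 2) :
    lineWeight (deltaCoeff q) pos D.link (fun u => c (pos u)) = cupProduct q (n + n) f c := by
  rw [cupProduct, Finset.prod_range, ← (posEquiv n).prod_comp, lineWeight]
  simp only [val_posEquiv, hf]

theorem exists_spin_of_cupForm (hq : IsGeneric q) {ψ : (ℕ → Fin 2) → ℂ}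
    (h : CupForm q (n + n) ψ) :
    ∃ D : Diagram n, coordFun (n + n) (phi hq n (spin q n (diag q D))) = ψ := by
  obtain ⟨f, hf, rfl⟩ := h.exists_matching
  obtain ⟨D, hD⟩ := exists_diagram_of_matching hf
  exact ⟨D, funext fun c => by rw [coordFun_phi_spin, lineWeight_eq_cupProduct D hD]⟩

theorem phi_spin_mem_invariants (hq : IsGeneric q) (D : Diagram n) :
    phi hq n (spin q n (diag q D)) ∈ invariants hq (n + n) := by
  obtain ⟨f, hf, hD⟩ := exists_matching_of_diagram D
  have h : CupForm q (n + n) (coordFun (n + n) (phi hq n (spin q n (diag q D)))) := by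
    convert hf.cupForm (q := q) using 1
    exact funext fun c => by rw [coordFun_phi_spin, lineWeight_eq_cupProduct D hD]
  generalize phi hq n (spin q n (diag q D)) = x at h
  intro u
  induction u using Uq.induction hq with
  | scalar r => rw [AlgHom.commutes, AlgHom.commutes]; rfl
  | add u v hu hv => rw [map_add, map_add, LinearMap.add_apply, hu, hv, add_smul]
  | mul u v hu hv =>
    rw [map_mul, map_mul, Module.End.mul_apply, hv, map_smul, hu, mul_smul, smul_comm]
  | shift a =>
    refine coordFun_ext fun c => ?_
    rw [coordFun_shift, h.shiftOp hq, Uq.counit_shift, zero_smul, coordFun_zero]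
  | K =>
    refine coordFun_ext fun c => ?_
    have h1 : invWeight q (n + n) c ≠ 0 :=
      Finset.prod_ne_zero_iff.2 fun _ _ => inv_ne_zero (weightFactor_ne_zero hq _)
    rw [coordFun_K, Uq.counit_K, one_smul, inv_mul_eq_iff_eq_mul₀ h1, h.invWeight hq]
  | Kinv =>
    refine coordFun_ext fun c => ?_
    rw [coordFun_Kinv, Uq.counit_Kinv, one_smul, h.invWeight hq]

theorem exists_spin_of_mem_cupSpan (hq : IsGeneric q) {φ : (ℕ → Fin 2) → ℂ}
    (hφ : φ ∈ cupSpan q (n + n) 0) :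
    ∃ z : TL q n, coordFun (n + n) (phi hq n (spin q n z)) = φ := by
  induction hφ using Submodule.span_induction with
  | mem φ h =>
    obtain ⟨ψ, hψ, rfl⟩ := h
    obtain ⟨D, hD⟩ := exists_spin_of_cupForm hq (n := n) hψ
    exact ⟨diag q D, hD.trans (funext fun c => hψ.congr fun i hi => (if_pos hi).symm)⟩
  | zero => exact ⟨0, funext fun c => by rw [map_zero, map_zero, coordFun_zero]; rfl⟩
  | add φ ψ _ _ h1 h2 =>
    obtain ⟨z, rfl⟩ := h1
    obtain ⟨w, rfl⟩ := h2
    exact ⟨z + w, funext fun c => by rw [map_add, map_add, coordFun_add]; rfl⟩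
  | smul r φ _ h1 =>
    obtain ⟨z, rfl⟩ := h1
    exact ⟨r • z, funext fun c => by rw [map_smul, map_smul, coordFun_smul]; rfl⟩

theorem range_spin (hq : IsGeneric q) : LinearMap.range (spin q n) = endU hq n := by
  have hmem : ∀ T, T ∈ endU hq n ↔ phi hq n T ∈ invariants hq (n + n) := by
    intro T
    rw [← map_endU]
    exact ((phi hq n).injective.mem_set_image (s := endU hq n)).symm
  ext T
  rw [hmem]
  constructor
  · rintro ⟨z, rfl⟩
    induction z using TL.induction with
    | add x y hx hy => rw [map_add, map_add]; exact add_mem hx hy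
    | smul r D =>
      rw [map_smul, map_smul]
      exact Submodule.smul_mem _ _ (phi_spin_mem_invariants hq D)
  · intro hT
    obtain ⟨z, hz⟩ := exists_spin_of_mem_cupSpan hq (coordFun_invariants hq hT)
    exact ⟨z, (phi hq n).injective (coordFun_ext (congrFun hz))⟩

end Range

end TLDiag

end

theorem mainTheorem9 (q : ℂ) (hq : IsGeneric q) (n : ℕ) :
    -- the action of diagrams is the spin representation of the Temperley-Lieb algebra
    (∀ m : ℕ, spin q m 1 = 1 ∧ (∀ x y : TL q m, spin q m (x * y) = spin q m x * spin q m y) ∧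
      ∀ (i : ℕ) (hi : i + 1 < m) (w : Fin m → V2),
        spin q m (diag q (Diagram.gen i hi)) (PiTensorProduct.tprod ℂ w) =
          eps q (w ⟨i, by omega⟩) (w ⟨i + 1, hi⟩) •
            (PiTensorProduct.tprod ℂ
                (Function.update (Function.update w ⟨i, by omega⟩ vPlus) ⟨i + 1, hi⟩ vMinus) -
              q⁻¹ • PiTensorProduct.tprod ℂ
                (Function.update (Function.update w ⟨i, by omega⟩ vMinus) ⟨i + 1, hi⟩ vPlus))) ∧
    -- it identifies `TL_n` with the endomorphisms that commute with the quantum group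
    Function.Injective (spin q n) ∧
    LinearMap.range (spin q n) = endU hq n ∧
    -- `phi` is an isomorphism of modules over the quantum group, and restricts to an
    -- isomorphism of the commuting endomorphisms with the invariants
    (∀ (u : Uq q) (T : Module.End ℂ (TP n)),
      phi hq n (endAct hq n u T) = tensorRep hq (n + n) u (phi hq n T)) ∧
    (endU hq n).map (phi hq n).toLinearMap = invariants hq (n + n) ∧
    -- the diagrammatic map is an embedding that sends diagrams to classes of diagrams
    Function.Injective (bend q n) ∧
    (∀ D : Diagram n, bend q n (diag q D) =
      indMk q n n (diag q ((D.juxta (Diagram.id n)).comp (Diagram.nested n))) 1) ∧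
    -- the lower diagram is the only one with `n` nested top links and nonzero class
    indMk q n n (diag q (Diagram.nested n)) 1 ≠ 0 ∧
    (∀ D : Diagram (n + n), (∀ i, D.rel (Sum.inl i) (Sum.inl i.rev)) →
      indMk q n n (diag q D) 1 ≠ 0 → D = Diagram.nested n) ∧
    -- the induced module embeds in the tensor power, and the diagrammatic map becomes `phi`
    ∃ b : IndTriv q n n →ₗ[ℂ] TP (n + n),
      (∀ (x : TL q (n + n)) (c : ℂ), b (indMk q n n x c) =
        c • spin q (n + n) x (stdVec (Fin.append (fun _ : Fin n => 1) (fun _ : Fin n => 0)))) ∧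
      Function.Injective b ∧
      ∀ x : TL q n, b (bend q n x) = phi hq n (spin q n x) := by
  exact ⟨fun m => ⟨spin_one, spin_mul hq, fun i hi w => spin_gen i hi w⟩, spin_injective hq,
    range_spin hq, phi_endAct hq, map_endU hq, bend_injective hq, bend_diag,
    indMk_nested_ne_zero hq, eq_nested_of_indMk_ne_zero hq,
    indEmbed hq n, indEmbed_indMk hq, indEmbed_injective hq, indEmbed_bend hq⟩
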